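/- **Setting.** Let $m,q\ge 0$ be integers, $U\subset\mathbb{R}^m$ a nonempty open set, $\Omega$ a locally compact Hausdorff space with its Borel $\sigma$-algebra, and $\mathcal H$ a separable complex Hilbert space (inner products are linear in the first argument). For a multi-index $\alpha\in\mathbb{Z}_+^m$ write $|\alpha|=\alpha_1+\dots+\alpha_m$. *Differentiability.* A kernel $K:U\times U\to V$ ($V$ a normed space) is in $C^{q,q}(U\times U,V)$ if the derivatives $\partial_1^\alpha\partial_2^\beta K$, $|\alpha|,|\beta|\le q$, exist and are jointly continuous. A function $p:\Omega\times U\times U\to\mathbb{C}$ is in $C^{0,q,q}$ if $p_w:=p(w,\cdot,\cdot)\in C^{q,q}$ for every $w$ and each $(w,x,y)\mapsto\partial_1^\alpha\partial_2^\beta p_w(x,y)$, $|\alpha|,|\beta|\le q$, is continuous. It is $C^q$-dominated with respect to a measure $\mu$ if there is a $\mu$-integrable $h:\Omega\to\mathbb{C}$ with $|\partial_1^\alpha\partial_2^\beta p_w(x,y)|\le|h(w)|$ for all $w,x,y$ and $|\alpha|,|\beta|\le q$. $C^q_0(U,\mathcal H)$ is the set of $F\in C^q(U,\mathcal H)$ such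 that $\partial^\alpha F$ vanishes at infinity on $U$ for all $|\alpha|\le q$. *Kernels.* A kernel $K:U\times U\to\mathcal L(\mathcal H)$ is positive definite if $\sum_{i,j}\langle K(x_i,x_j)v_j,v_i\rangle\ge 0$ for all finite families $x_i\in U$, $v_i\in\mathcal H$; $\mathcal H_K$ is its reproducing kernel Hilbert space of functions $U\to\mathcal H$, generated by the functions $K(\cdot,y)v$. Complex valued kernels are the case $\mathcal H=\mathbb{C}$. $K$ is *$C^q$-universal* if it is positive definite, $\mathcal H_K\subset C^q(U,\mathcal H)$, and for every compact $A\subset U$, every $g\in C^q(U,\mathcal H)$ and every $\varepsilon>0$ there is $f\in\mathcal H_K$ with $\sup_{x\in A}\sum_{|\alpha|\le q}\|\partial^\alpha f(x)-\partial^\alpha g(x)\|<\varepsilon$. For an $\mathcal H$-valued measure $\eta$ of bounded variation, $\int\langle F,d\eta\rangle$ denotes the integral with $\int\langle v\chi_A,d\eta\rangle=\langle v,\eta(A)\rangle$, and, for an operator valued function $T$, $\int T\,d\eta\in\mathcal H$ is the vector such that $\langle v,\int T\,d\eta\rangle=\int\langle T(x)v,d\eta(x)\rangle$ for all $v\in\mathcal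 H$. $K$ is *$C^q$-integrally strictly positive definite* if it is positive definite, $K\in C^{q,q}(U\times U,\mathcal L(\mathcal H))$, the functions $x\mapsto\|\partial_1^\alpha\partial_2^\alpha K(x,x)\|$ are bounded on $U$ for $|\alpha|\le q$, and for all families $(\eta_\alpha)_{|\alpha|\le q}$ of $\mathcal H$-valued Radon measures of bounded variation on $U$, $$\sum_{|\alpha|,|\beta|\le q}\int\Big\langle\int\partial_1^\alpha\partial_2^\beta K(x,y)\,d\eta_\alpha(x),d\eta_\beta(y)\Big\rangle=0\ \Longrightarrow\ \sum_{|\alpha|\le q}\int\langle\partial^\alpha F,d\eta_\alpha\rangle=0\ \text{ for all }F\in C_0^q(U,\mathcal H).$$ **Theorem.** Let $p\in C^{0,q,q}(\Omega\times U\times U)$ be complex valued such that $p_w$ is positive definite for every $w\in\Omega$. Let $\Lambda$ be an $\mathcal L(\mathcal H)$-valued Radon measure of bounded variation on $\Omega$ (countably additive in operator norm, with $|\Lambda|$ finite, outer regular on Borel sets and inner regular on open sets), such that $\Lambda(A)$ is positive semidefinite for every Borel set $A$, and which admits a Radon–Nikodým decomposition $d\Lambda=G\,d\lambda$ with $\lambda$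 a finite nonnegative measure and $G:\Omega\to\mathcal L(\mathcal H)$ Bochner integrable with respect to $\lambda$. Assume that $p$ is $C^q$-dominated with respect to the variation $|\Lambda|$. Put $$P(x,y)=\int_\Omega p_w(x,y)\,d\Lambda(w),\qquad P_v(x,y)=\langle P(x,y)v,v\rangle,\qquad \Lambda_v(A)=\langle\Lambda(A)v,v\rangle .$$ Then: 1. $P$ is well defined ($w\mapsto p_w(x,y)$ is $|\Lambda|$-integrable for all $x,y$) and positive definite, $P\in C^{q,q}(U\times U,\mathcal L(\mathcal H))$, and $\mathcal H_P\subset C^q(U,\mathcal H)$. 2. If $p_w$ is $C^q$-universal for every $w\in\Omega$, the following are equivalent: $P$ is $C^q$-universal; $P_v$ is $C^q$-universal for every $v\in\mathcal H\setminus\{0\}$; $\Lambda_v$ is a nonzero measure for every $v\in\mathcal H\setminus\{0\}$. 3. If $p_w$ is $C^q$-integrally strictly positive definite for every $w\in\Omega$, the following are equivalent: $P$ is $C^q$-integrally strictly positive definite; $P_v$ is $C^q$-integrally strictly positive definite for every $v\in\mathcal H\setminus\{0\}$; $\Lambda_v$ is a nonzero measure for every $v\in\mathcal H\setminus\{0\}$.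 -/

import Mathlib

open MeasureTheory TopologicalSpace

noncomputable section

namespace OpKernel

/-! ## Differentiable functions on an open subset of `ℝᵐ` -/

section Differentiability

variable {m : ℕ} {U : Opens (EuclideanSpace ℝ (Fin m))}
  {V : Type*} [NormedAddCommGroup V] [NormedSpace ℝ V]

/-- Extension by zero of a function defined on the open set `U`. Differentiability and derivatives
at the points of `U` do not depend on the values outside `U`. -/
def zeroExt (F : U → V) : EuclideanSpace ℝ (Fin m) → V :=
  Function.extend Subtype.val F 0

/-- The partial derivative in the direction of the `i`-th coordinate vector. -/
def partialDeriv (i : Fin m) (F : U → V) : U → V :=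
  fun x => lineDeriv ℝ (zeroExt F) x (EuclideanSpace.single i (1 : ℝ))

/-- The iterated partial derivative `∂^α`, for a multi-index `α`. -/
def multiDeriv (α : Fin m → ℕ) (F : U → V) : U → V :=
  (List.finRange m).foldr (fun i G => (partialDeriv i)^[α i] G) F

/-- The multi-indices `α` in `m` variables with `|α| ≤ q`. -/
def multiIndices (m q : ℕ) : Finset (Fin m → ℕ) :=
  (Fintype.piFinset fun _ : Fin m => Finset.range (q + 1)).filter fun α => ∑ i, α i ≤ q

theorem mem_multiIndices {q : ℕ} {α : Fin m → ℕ} : α ∈ multiIndices m q ↔ ∑ i, α i ≤ q := by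
  simp only [multiIndices, Finset.mem_filter, Fintype.mem_piFinset, Finset.mem_range,
    and_iff_right_iff_imp]
  intro h i
  have := Finset.single_le_sum (f := α) (fun j _ => Nat.zero_le _) (Finset.mem_univ i)
  omega

/-- `F ∈ C^q(U, V)`. -/
def IsCq (q : ℕ) (F : U → V) : Prop :=
  ContDiffOn ℝ q (zeroExt F) U

/-- `F ∈ C^q_0(U, V)`: every derivative of order at most `q` vanishes at infinity on `U`. -/
def IsCqZero (q : ℕ) (F : U → V) : Prop :=
  IsCq q F ∧ ∀ α ∈ multiIndices m q,
    Filter.Tendsto (multiDeriv α F) (Filter.cocompact U) (nhds 0)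

/-- The mixed derivative `∂₁^α ∂₂^β K (x, y)`. -/
def mixedDeriv (α β : Fin m → ℕ) (K : U → U → V) (x y : U) : V :=
  multiDeriv α (fun x' => multiDeriv β (K x') y) x

/-- `K ∈ C^{q,q}(U × U, V)`: the derivatives `∂₁^α ∂₂^β K` with `|α|, |β| ≤ q` exist and are
jointly continuous. -/
def IsCqq (q : ℕ) (K : U → U → V) : Prop :=
  (∀ x, IsCq q (K x)) ∧
  (∀ β ∈ multiIndices m q, ∀ y, IsCq q fun x => multiDeriv β (K x) y) ∧
  ∀ α ∈ multiIndices m q, ∀ β ∈ multiIndices m q,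
    Continuous fun z : U × U => mixedDeriv α β K z.1 z.2

/-- `p ∈ C^{0,q,q}(Ω × U × U, V)`. -/
def IsCzqq {Ω : Type*} [TopologicalSpace Ω] (q : ℕ) (p : Ω → U → U → V) : Prop :=
  (∀ w, IsCqq q (p w)) ∧
  ∀ α ∈ multiIndices m q, ∀ β ∈ multiIndices m q,
    Continuous fun z : Ω × U × U => mixedDeriv α β (p z.1) z.2.1 z.2.2

/-- `p` is `C^q`-dominated with respect to the measure `μ`. -/
def IsCqDominated {Ω : Type*} [MeasurableSpace Ω] (q : ℕ) (p : Ω → U → U → V)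
    (μ : Measure Ω) : Prop :=
  ∃ h : Ω → ℂ, Integrable h μ ∧
    ∀ α ∈ multiIndices m q, ∀ β ∈ multiIndices m q, ∀ w x y,
      ‖mixedDeriv α β (p w) x y‖ ≤ ‖h w‖

end Differentiability

/-! ## Operator valued positive definite kernels and their reproducing kernel Hilbert spaces -/

section Kernels

variable {X : Type*} {H : Type*} [NormedAddCommGroup H] [InnerProductSpace ℂ H] [CompleteSpace H]

/-- Positive definite operator valued kernels (see `isPosDef_iff` for the finite sums). -/
def IsPosDef (K : X → X → H →L[ℂ] H) : Prop :=
  (Matrix.of K).PosSemidef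

open scoped ComplexOrder in
/-- A kernel is positive definite if and only if all the double sums
`∑ ⟨K(x_μ, x_ν) v_ν, v_μ⟩` are nonnegative real numbers. -/
theorem isPosDef_iff (K : X → X → H →L[ℂ] H) :
    IsPosDef K ↔ ∀ v : X →₀ H,
      0 ≤ v.sum fun x a => v.sum fun y b => inner ℂ a (K x y b) := by
  have key := (RKHS.posSemidef_tfae (K := Matrix.of K)).out 0 2
  rw [IsPosDef, key]
  have hconj : ∀ v : X →₀ H, (starRingEnd ℂ)
      (v.sum fun x w => v.sum fun x' w' => inner ℂ (K x' x w) w') =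
      v.sum fun x a => v.sum fun y b => inner ℂ a (K x y b) := by
    intro v
    rw [Finsupp.sum_comm]
    simp only [map_finsuppSum, inner_conj_symm]
  constructor
  · rintro ⟨hH, h⟩ v
    have h1 := h v
    simp only [Matrix.of_apply] at h1
    have hsym : (v.sum fun x w => v.sum fun x' w' => inner ℂ (K x' x w) w') =
        v.sum fun x a => v.sum fun y b => inner ℂ a (K x y b) := by
      congr! 6 with x w y b
      have h3 : star (K x y) = K y x := hH.apply y x
      rw [← h3, ContinuousLinearMap.star_eq_adjoint, ContinuousLinearMap.adjoint_inner_left]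
    rw [Complex.le_def]
    have h2 := hconj v
    rw [hsym] at h1 h2
    refine ⟨h1, ?_⟩
    have := congrArg Complex.im h2
    simp only [Complex.conj_im] at this
    simp only [Complex.zero_im]
    linarith
  · intro h
    refine ⟨?_, fun v => ?_⟩
    · let B : (X →₀ H) → (X →₀ H) → ℂ := fun u v => u.sum fun x a => v.sum fun y b => inner ℂ a (K x y b)
      have hadd1 : ∀ u u' v, B (u + u') v = B u v + B u' v := by
        intro u u' v
        classical
        refine Finsupp.sum_add_index' (by simp) fun x a a' => ?_
        simp only [inner_add_left, Finsupp.sum_add]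
      have hadd2 : ∀ u v v', B u (v + v') = B u v + B u v' := by
        intro u v v'
        classical
        simp only [B]
        have h3 : ∀ x a, ((v + v').sum fun y b => inner ℂ a (K x y b)) =
            (v.sum fun y b => inner ℂ a (K x y b)) + v'.sum fun y b => inner ℂ a (K x y b) :=
          fun x a => Finsupp.sum_add_index' (by simp) fun y b b1 => by simp
        simp only [h3, Finsupp.sum_add]
      have hs1 : ∀ (c : ℂ) u v, B (c • u) v = (starRingEnd ℂ) c * B u v := by
        intro c u v
        simp only [B]
        rw [Finsupp.sum_smul_index' (fun x => by simp)]
        simp only [inner_smul_left, Finsupp.sum, Finset.mul_sum]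
      have hs2 : ∀ (c : ℂ) u v, B u (c • v) = c * B u v := by
        intro c u v
        simp only [B]
        have h3 : ∀ x a, ((c • v).sum fun y b => inner ℂ a (K x y b)) =
            c * v.sum fun y b => inner ℂ a (K x y b) := by
          intro x a
          rw [Finsupp.sum_smul_index' (by simp)]
          simp only [map_smul, inner_smul_right, Finsupp.sum, Finset.mul_sum]
        simp only [h3]
        simp only [Finsupp.sum, Finset.mul_sum]
      have him : ∀ u, (B u u).im = 0 := fun u => (Complex.le_def.1 (h u)).2.symm
      have hsymm : ∀ u v, B u v = (starRingEnd ℂ) (B v u) := by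
        intro u v
        have e1 := him (u + v)
        have e2 := him (u + Complex.I • v)
        simp only [hadd1, hadd2, hs1, hs2, Complex.add_im, him, Complex.conj_I, Complex.mul_im, Complex.mul_re,
          Complex.neg_re, Complex.neg_im, Complex.I_re, Complex.I_im] at e1 e2
        apply Complex.ext
        · simp only [Complex.conj_re]; linarith [him v]
        · simp only [Complex.conj_im]; linarith
      ext x y : 1
      refine ContinuousLinearMap.ext fun b => ext_inner_left ℂ fun a => ?_
      have := hsymm (Finsupp.single x a) (Finsupp.single y b)
      simp only [B, inner_zero_left, inner_zero_right, map_zero, Finsupp.sum_single_index, inner_conj_symm] at this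
      simp [ContinuousLinearMap.star_eq_adjoint, ContinuousLinearMap.adjoint_inner_right, this]
    · have h1 := (Complex.le_def.1 (h v)).1
      rw [← hconj v] at h1
      simpa using h1

/-- The reproducing kernel Hilbert space `H_K` of a positive definite kernel, as a set of functions
from `X` to `H`. -/
def rkhs (K : X → X → H →L[ℂ] H) : Set (X → H) :=
  {f | ∃ hK : (Matrix.of K).PosSemidef,
    haveI : Fact (Matrix.of K).PosSemidef := ⟨hK⟩
    ∃ F : RKHS.OfKernel (Matrix.of K), RKHS.coeCLM ℂ F = f}

/-- A complex valued kernel, regarded as an operator valued kernel with `H = ℂ`. -/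
def scalarKernel (k : X → X → ℂ) : X → X → ℂ →L[ℂ] ℂ :=
  fun x y => ContinuousLinearMap.mul ℂ ℂ (k x y)

/-- The scalar valued projection `K_v(x, y) = ⟨K(x, y) v, v⟩` (the inner product of Mathlib is
conjugate linear in its first argument). -/
def kernelProj (K : X → X → H →L[ℂ] H) (v : H) : X → X → ℂ :=
  fun x y => inner ℂ v (K x y v)

end Kernels

/-! ## Vector valued measures -/

section Measures

variable {X : Type*} [MeasurableSpace X]
  {H : Type*} [NormedAddCommGroup H] [InnerProductSpace ℂ H]

/-- A vector valued Radon measure of bounded variation. -/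
def IsRadonBV [TopologicalSpace X] {V : Type*} [NormedAddCommGroup V]
    (η : VectorMeasure X V) : Prop :=
  IsFiniteMeasure η.variation ∧ η.variation.Regular

variable (H) in
/-- The pairing `(u, v) ↦ ⟨u, v⟩`, linear in `u` and conjugate linear in `v`, as a real bilinear
map. -/
def pairing : H →L[ℝ] H →L[ℝ] ℂ :=
  LinearMap.mkContinuous₂
    (LinearMap.mk₂ ℝ (fun u v : H => inner ℂ v u)
      (fun _ _ _ => inner_add_right _ _ _)
      (fun c u v => by
        rw [← Complex.coe_smul, inner_smul_right, Complex.real_smul])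
      (fun _ _ _ => inner_add_left _ _ _)
      (fun c u v => by
        rw [← Complex.coe_smul, inner_smul_left, Complex.conj_ofReal, Complex.real_smul]))
    1 (fun u v => by
      simpa [mul_comm] using norm_inner_le_norm (𝕜 := ℂ) v u)

theorem pairing_apply (u v : H) : pairing H u v = inner ℂ v u := rfl

/-- The integral `∫ ⟨F(x), dη(x)⟩` of an `H`-valued function with respect to an `H`-valued
measure. -/
def bartleIntegral (η : VectorMeasure X H) (F : X → H) : ℂ :=
  η.integral F (pairing H)

/-- `u` is the weak-Bochner integral `∫ T(x) dη(x)`, that is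
`⟨v, u⟩ = ∫ ⟨T(x) v, dη(x)⟩` for all `v`. -/
def IsWeakBochnerIntegral (η : VectorMeasure X H) (T : X → H →L[ℂ] H) (u : H) : Prop :=
  (∀ v, η.Integrable fun x => T x v) ∧
    ∀ v, inner ℂ u v = bartleIntegral η fun x => T x v

open scoped Classical in
/-- The weak-Bochner integral `∫ T(x) dη(x)` (zero if it does not exist). -/
def weakBochnerIntegral (η : VectorMeasure X H) (T : X → H →L[ℂ] H) : H :=
  if h : ∃ u, IsWeakBochnerIntegral η T u then h.choose else 0

/-- The scalar valued projection `Λ_v(A) = ⟨Λ(A) v, v⟩` of an operator valued measure. -/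
def measureProj (Λ : VectorMeasure X (H →L[ℂ] H)) (v : H) : VectorMeasure X ℂ :=
  Λ.mapRange ((innerSL ℂ v).comp (ContinuousLinearMap.apply ℂ H v)).toLinearMap.toAddMonoidHom
    ((innerSL ℂ v).comp (ContinuousLinearMap.apply ℂ H v)).continuous

/-- The kernel `P(x, y) = ∫ p_w(x, y) dΛ(w)`. -/
def integralKernel {Y : Type*} (p : X → Y → Y → ℂ) (Λ : VectorMeasure X (H →L[ℂ] H)) :
    Y → Y → H →L[ℂ] H :=
  fun x y => Λ.integral (fun w => p w x y) (ContinuousLinearMap.lsmul ℝ ℂ)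

end Measures

/-! ## Differentiable universality -/

section Universality

variable {m : ℕ} {U : Opens (EuclideanSpace ℝ (Fin m))}
  {H : Type*} [NormedAddCommGroup H] [InnerProductSpace ℂ H] [CompleteSpace H]

/-- `C^q`-universal kernels. -/
def IsCqUniversal (q : ℕ) (K : U → U → H →L[ℂ] H) : Prop :=
  IsPosDef K ∧ (∀ f ∈ rkhs K, IsCq q f) ∧
  ∀ A : Set U, IsCompact A → ∀ g : U → H, IsCq q g → ∀ ε > (0 : ℝ),
    ∃ f ∈ rkhs K, ∀ x ∈ A,
      ∑ α ∈ multiIndices m q, ‖multiDeriv α f x - multiDeriv α g x‖ < ε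

/-- The quadratic form
`∑_{|α|,|β| ≤ q} ∫ ⟨∫ ∂₁^α ∂₂^β K(x, y) dη_α(x), dη_β(y)⟩`. -/
def energy (q : ℕ) (K : U → U → H →L[ℂ] H) (η : (Fin m → ℕ) → VectorMeasure U H) : ℂ :=
  ∑ α ∈ multiIndices m q, ∑ β ∈ multiIndices m q,
    bartleIntegral (η β) fun y => weakBochnerIntegral (η α) fun x => mixedDeriv α β K x y

/-- `C^q`-integrally strictly positive definite kernels. -/
def IsCqIntStrictPosDef (q : ℕ) (K : U → U → H →L[ℂ] H) : Prop :=
  IsPosDef K ∧ IsCqq q K ∧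
  (∀ α ∈ multiIndices m q, ∃ M : ℝ, ∀ x, ‖mixedDeriv α α K x x‖ ≤ M) ∧
  ∀ η : (Fin m → ℕ) → VectorMeasure U H, (∀ α ∈ multiIndices m q, IsRadonBV (η α)) →
    energy q K η = 0 →
    ∀ F : U → H, IsCqZero q F →
      ∑ α ∈ multiIndices m q, bartleIntegral (η α) (multiDeriv α F) = 0

end Universality

end OpKernel

end

/-!
Bounded continuous functions on the disjoint union of copies of `A ⊆ U`, one for each multi-index of
order at most `q`, contain the jets `(∂^α f)_{|α| ≤ q}` of the functions involved. By the
Hahn–Banach theorem, `C^q`-universality says that a continuous functional `L` on this space which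
vanishes on the jets of `H_K` vanishes on all jets; integral strict positive definiteness says the
same for the functionals given by families of measures, since their energy is the squared norm of
the vector of `H_K` representing them.

Let `P = ∫ p_w G(w) dλ(w)` and let `L` vanish on the jets of `H_P`. As `H_P` contains the
corresponding space for the integral over any subset of `Ω`, for almost every `w` the functional `L`
vanishes on the jets of `p_w(·, y) G(w) v`. Thus `φ ↦ L(φ ⊗ G(w) v)` vanishes on `H_{p_w}`, hence on
every scalar function `φ`. Writing `v ↦ L(φ ⊗ v)` as `⟨u, ·⟩`, we get `⟨u, G(w) u⟩ = 0` for almost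
every `w`, that is `Λ_u = 0`, and so `u = 0`. Hence `L` vanishes on the tensors `φ ⊗ v`, which are
enough to approximate a function whose jet has a totally bounded range.

Conversely, the defining property passes from `P` to `P_v`, and `Λ_v = 0` would make `P_v` the zero
kernel, which does not have it.
-/

namespace OpKernel

open Filter Topology
open scoped BoundedContinuousFunction

/-! ### Partial derivatives on an open set -/

section Calculus

variable {m : ℕ} {U : Opens (EuclideanSpace ℝ (Fin m))} {V : Type*} [NormedAddCommGroup V]

@[simp]
theorem zeroExt_coe (F : U → V) (x : U) : zeroExt F x = F x :=
  Subtype.val_injective.extend_apply _ _ _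

theorem zeroExt_of_mem (F : U → V) {x : EuclideanSpace ℝ (Fin m)} (hx : x ∈ U) :
    zeroExt F x = F ⟨x, hx⟩ :=
  zeroExt_coe F ⟨x, hx⟩

theorem zeroExt_of_notMem (F : U → V) {x : EuclideanSpace ℝ (Fin m)} (hx : x ∉ U) :
    zeroExt F x = 0 :=
  Function.extend_apply' _ _ _ fun ⟨a, ha⟩ => hx (ha ▸ a.2)

theorem eventually_add_smul_single_mem (x : U) (i : Fin m) :
    ∀ᶠ t : ℝ in 𝓝 0, x.1 + t • EuclideanSpace.single i (1 : ℝ) ∈ U := by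
  have hcont : Continuous fun t : ℝ => x.1 + t • EuclideanSpace.single i (1 : ℝ) := by fun_prop
  exact hcont.continuousAt.eventually_mem (U.isOpen.mem_nhds (by simp))

variable [NormedSpace ℝ V] {W : Type*} [NormedAddCommGroup W] [NormedSpace ℝ W]

/-- `F'` is the partial derivative of `F` in the `i`-th coordinate direction; unlike an equation
for `partialDeriv i F`, this includes the existence of the derivative. -/
def HasPartial (i : Fin m) (F F' : U → V) : Prop :=
  ∀ x : U, HasLineDerivAt ℝ (zeroExt F) (F' x) x (EuclideanSpace.single i (1 : ℝ))

theorem HasPartial.partialDeriv_eq {i : Fin m} {F F' : U → V} (h : HasPartial i F F') :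
    partialDeriv i F = F' :=
  funext fun x => (h x).lineDeriv

theorem hasPartial_iff {i : Fin m} {F F' : U → V} :
    HasPartial i F F' ↔ ∀ x : U, ∀ ε > 0, ∃ δ > 0, ∀ (t : ℝ) (y : U), |t| < δ →
      y.1 = x + t • EuclideanSpace.single i (1 : ℝ) → ‖F y - F x - t • F' x‖ ≤ ε * |t| := by
  refine forall_congr' fun x => ?_
  rw [hasLineDerivAt_iff_isLittleO_nhds_zero, Asymptotics.isLittleO_iff]
  constructor
  · intro h ε hε
    obtain ⟨δ, hδ, hball⟩ := Metric.eventually_nhds_iff.1 (h hε)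
    refine ⟨δ, hδ, fun t y ht hy => ?_⟩
    simpa only [← hy, zeroExt_coe, Real.norm_eq_abs] using hball (y := t) (by simpa using ht)
  · intro h ε hε
    obtain ⟨δ, hδ, hball⟩ := h ε hε
    filter_upwards [eventually_add_smul_single_mem x i, Metric.ball_mem_nhds (0 : ℝ) hδ]
      with t htU htδ
    simpa only [zeroExt_of_mem F htU, zeroExt_coe, Real.norm_eq_abs]
      using hball t ⟨_, htU⟩ (by simpa using htδ) rfl

theorem HasPartial.comp_clm {i : Fin m} {F F' : U → V} (h : HasPartial i F F') (L : V →L[ℝ] W) :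
    HasPartial i (fun x => L (F x)) fun x => L (F' x) := by
  have hext : zeroExt (fun x => L (F x)) = fun y => L (zeroExt F y) := by
    funext y
    by_cases hy : y ∈ U
    · simp only [zeroExt_of_mem _ hy]
    · simp only [zeroExt_of_notMem _ hy, map_zero]
  intro x
  rw [hext]
  exact L.hasFDerivAt.comp_hasDerivAt (0 : ℝ) (h x)

theorem HasPartial.sub {i : Fin m} {F F' G G' : U → V} (h : HasPartial i F F')
    (h' : HasPartial i G G') : HasPartial i (fun x => F x - G x) fun x => F' x - G' x := by
  have hext : zeroExt (fun x => F x - G x) = fun y => zeroExt F y - zeroExt G y := by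
    funext y
    by_cases hy : y ∈ U
    · simp only [zeroExt_of_mem _ hy]
    · simp only [zeroExt_of_notMem _ hy, sub_zero]
  intro x
  rw [hext]
  exact HasDerivAt.fun_sub (h x) (h' x)

theorem HasPartial.hasDerivAt_add_smul {i : Fin m} {F F' : U → V} (h : HasPartial i F F')
    {y : EuclideanSpace ℝ (Fin m)} {s : ℝ} (hs : y + s • EuclideanSpace.single i (1 : ℝ) ∈ U) :
    HasDerivAt (fun s' : ℝ => zeroExt F (y + s' • EuclideanSpace.single i (1 : ℝ)))
      (F' ⟨_, hs⟩) s := by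
  have hshift : HasDerivAt (fun s' : ℝ => s' - s) 1 s := by
    simpa using (hasDerivAt_id s).sub_const s
  have hline := HasDerivAt.scomp_of_eq s (h ⟨_, hs⟩) hshift (sub_self s).symm
  rw [one_smul] at hline
  refine hline.congr_of_eventuallyEq (Eventually.of_forall fun s' => ?_)
  dsimp only [Function.comp_apply]
  congr 1
  module

theorem HasPartial.norm_sub_sub_smul_le {i : Fin m} {F F' : U → V} (h : HasPartial i F F')
    {C : Set (EuclideanSpace ℝ (Fin m))} (hC : Convex ℝ C) (hCU : C ⊆ U) {c : V} {ε : ℝ}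
    (hε : ∀ z : U, z.1 ∈ C → ‖F' z - c‖ ≤ ε) {y y' : U} {t : ℝ} (hy : y.1 ∈ C) (hy' : y'.1 ∈ C)
    (hyy' : y'.1 = y + t • EuclideanSpace.single i (1 : ℝ)) :
    ‖F y' - F y - t • c‖ ≤ ε * |t| := by
  set e := EuclideanSpace.single i (1 : ℝ)
  let S : Set ℝ := AffineMap.lineMap y.1 (y.1 + e) ⁻¹' C
  have hS : ∀ s, s ∈ S ↔ y.1 + s • e ∈ C := fun s => by
    simp [S, AffineMap.lineMap_apply, add_comm]
  have hderiv : ∀ s ∈ S, HasDerivWithinAt (fun s : ℝ => zeroExt F (y + s • e) - s • c)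
      (zeroExt F' (y + s • e) - c) S s := fun s hs => by
    have hsU := hCU ((hS s).1 hs)
    have hlin : HasDerivAt (fun s : ℝ => s • c) c s := by
      simpa using (hasDerivAt_id s).smul_const c
    rw [zeroExt_of_mem F' hsU]
    exact ((h.hasDerivAt_add_smul hsU).fun_sub hlin).hasDerivWithinAt
  have hbound : ∀ s ∈ S, ‖zeroExt F' (y + s • e) - c‖ ≤ ε := fun s hs => by
    rw [zeroExt_of_mem F' (hCU ((hS s).1 hs))]
    exact hε _ ((hS s).1 hs)
  have hmvt := (hC.affine_preimage _).norm_image_sub_le_of_norm_hasDerivWithin_le hderiv hbound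
    ((hS 0).2 (by simpa using hy)) ((hS t).2 (hyy' ▸ hy'))
  simp only [← hyy', zeroExt_coe, zero_smul, add_zero, sub_zero, Real.norm_eq_abs] at hmvt
  rwa [sub_right_comm] at hmvt

theorem norm_second_difference_le {i j : Fin m} {f g k : U → U → V}
    (hgk : ∀ y, HasPartial i (fun x => g x y) fun x => k x y)
    (hfg : ∀ x, HasPartial j (f x) (g x))
    (hk : Continuous fun z : U × U => k z.1 z.2) (x y : U) {ε : ℝ} (hε : 0 < ε) :
    ∃ δ > 0, ∀ (s t : ℝ) (x' y' : U), |s| < δ → |t| < δ →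
      x'.1 = x + s • EuclideanSpace.single i (1 : ℝ) →
      y'.1 = y + t • EuclideanSpace.single j (1 : ℝ) →
      ‖f x' y' - f x y' - (f x' y - f x y) - (s * t) • k x y‖ ≤ ε * |s| * |t| := by
  obtain ⟨δ₁, hδ₁, hkδ⟩ := Metric.continuous_iff.1 hk (x, y) ε hε
  obtain ⟨δ₂, hδ₂, hxU⟩ := Metric.isOpen_iff.1 U.isOpen x x.2
  obtain ⟨δ₃, hδ₃, hyU⟩ := Metric.isOpen_iff.1 U.isOpen y y.2
  obtain ⟨δ, hδ, hle₁, hle₂, hle₃⟩ : ∃ δ > 0, δ ≤ δ₁ ∧ δ ≤ δ₂ ∧ δ ≤ δ₃ :=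
    ⟨min δ₁ (min δ₂ δ₃), by positivity, by simp, by simp, by simp⟩
  have hkε : ∀ x' y' : U, x'.1 ∈ Metric.ball x.1 δ → y'.1 ∈ Metric.ball y.1 δ →
      ‖k x' y' - k x y‖ ≤ ε := fun x' y' hx' hy' => by
    rw [← dist_eq_norm]
    refine (hkδ (x', y') ?_).le
    rw [Prod.dist_eq, max_lt_iff]
    exact ⟨hx'.trans_le hle₁, hy'.trans_le hle₁⟩
  refine ⟨δ, hδ, fun s t x' y' hs ht hx' hy' => ?_⟩
  have hx'b : x'.1 ∈ Metric.ball x.1 δ := by simpa [hx', norm_smul] using hs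
  have hy'b : y'.1 ∈ Metric.ball y.1 δ := by simpa [hy', norm_smul] using ht
  have hg : ∀ b : U, b.1 ∈ Metric.ball y.1 δ → ‖(g x' b - g x b) - s • k x y‖ ≤ ε * |s| :=
    fun b hb => (hgk b).norm_sub_sub_smul_le (convex_ball _ _)
      ((Metric.ball_subset_ball hle₂).trans hxU) (fun z hz => hkε z b hz hb)
      (Metric.mem_ball_self hδ) hx'b hx'
  have hdiff := ((hfg x').sub (hfg x)).norm_sub_sub_smul_le (convex_ball _ _)
    ((Metric.ball_subset_ball hle₃).trans hyU) hg (Metric.mem_ball_self hδ) hy'b hy'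
  rwa [smul_smul, mul_comm t s] at hdiff

/-- As in Schwarz's theorem, `k` is the limit of the mixed second difference quotients of `f`. -/
theorem HasPartial.interchange {i j : Fin m} {f g h k : U → U → V}
    (hfh : ∀ y, HasPartial i (fun x => f x y) fun x => h x y)
    (hgk : ∀ y, HasPartial i (fun x => g x y) fun x => k x y)
    (hfg : ∀ x, HasPartial j (f x) (g x))
    (hk : Continuous fun z : U × U => k z.1 z.2) (x : U) : HasPartial j (h x) (k x) := by
  refine hasPartial_iff.2 fun y ε hε => ?_
  obtain ⟨δ, hδ, hdiff⟩ := norm_second_difference_le hgk hfg hk x y hε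
  refine ⟨δ, hδ, fun t y' ht hy' => ?_⟩
  have hlim := ((hfh y').sub (hfh y) x).tendsto_slope_zero
  rw [zeroExt_coe] at hlim
  refine le_of_tendsto (hlim.sub_const (t • k x y)).norm ?_
  filter_upwards [self_mem_nhdsWithin, nhdsWithin_le_nhds (eventually_add_smul_single_mem x i),
    nhdsWithin_le_nhds (Metric.ball_mem_nhds (0 : ℝ) hδ)] with s (hs₀ : s ≠ 0) hsU hsδ
  rw [zeroExt_of_mem _ hsU]
  set x' : U := ⟨_, hsU⟩
  have hquot : s⁻¹ • (f x' y' - f x' y - (f x y' - f x y)) - t • k x y =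
      s⁻¹ • (f x' y' - f x y' - (f x' y - f x y) - (s * t) • k x y) := by
    rw [smul_sub s⁻¹ _ ((s * t) • k x y), smul_smul, inv_mul_cancel_left₀ hs₀,
      sub_sub_sub_comm]
  rw [hquot, norm_smul, norm_inv, Real.norm_eq_abs, inv_mul_le_iff₀ (abs_pos.2 hs₀)]
  linarith [hdiff s t x' y' (by simpa using hsδ) ht rfl hy']

/-- Changing one coordinate after the other telescopes the increment of `F`. -/
theorem norm_sub_sub_sum_smul_le {F : U → V} {F' : Fin m → U → V}
    (h : ∀ i, HasPartial i F (F' i)) {C : Set (EuclideanSpace ℝ (Fin m))} (hC : Convex ℝ C)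
    (hCU : C ⊆ U) {x : U} {ε : ℝ} (hε : ∀ i, ∀ z : U, z.1 ∈ C → ‖F' i z - F' i x‖ ≤ ε)
    {v : Fin m → ℝ}
    (hv : ∀ s : Finset (Fin m), x.1 + ∑ i ∈ s, v i • EuclideanSpace.single i (1 : ℝ) ∈ C)
    (s : Finset (Fin m)) :
    ‖zeroExt F (x + ∑ i ∈ s, v i • EuclideanSpace.single i (1 : ℝ)) - F x -
      ∑ i ∈ s, v i • F' i x‖ ≤ ε * ∑ i ∈ s, |v i| := by
  classical
  induction s using Finset.induction_on with
  | empty => simp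
  | insert i s his ih =>
    have hstep := (h i).norm_sub_sub_smul_le hC hCU (hε i) (y := ⟨_, hCU (hv s)⟩)
      (y' := ⟨_, hCU (hv (insert i s))⟩) (t := v i) (hv s) (hv _)
      (by simp only [Finset.sum_insert his, add_comm (v i • _), add_assoc])
    rw [← zeroExt_of_mem F, ← zeroExt_of_mem F] at hstep
    calc _ = ‖_ + _‖ := by
          rw [Finset.sum_insert his (f := fun i => v i • F' i x)]
          congr 1
          abel
      _ ≤ _ := norm_add_le_of_le hstep ih
      _ = _ := by rw [Finset.sum_insert his, mul_add]

theorem hasFDerivAt_zeroExt {F : U → V} {F' : Fin m → U → V} (h : ∀ i, HasPartial i F (F' i))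
    (hc : ∀ i, Continuous (F' i)) (x : U) :
    HasFDerivAt (zeroExt F)
      (∑ i, (EuclideanSpace.proj i : EuclideanSpace ℝ (Fin m) →L[ℝ] ℝ).smulRight (F' i x)) x := by
  rw [hasFDerivAt_iff_isLittleO_nhds_zero, Asymptotics.isLittleO_iff]
  intro ε hε
  have hm : (0 : ℝ) < m + 1 := by positivity
  have hcont : ∀ᶠ z : U in 𝓝 x, ∀ i, dist (F' i z) (F' i x) < ε / (m + 1) :=
    eventually_all.2 fun i => Metric.tendsto_nhds.1 ((hc i).tendsto x) _ (by positivity)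
  obtain ⟨δ₁, hδ₁, hF'⟩ := Metric.eventually_nhds_iff.1 hcont
  obtain ⟨δ₂, hδ₂, hU⟩ := Metric.isOpen_iff.1 U.isOpen x x.2
  obtain ⟨r, hr, hr₁, hr₂⟩ : ∃ r > 0, r ≤ δ₁ ∧ r ≤ δ₂ :=
    ⟨min δ₁ δ₂, lt_min hδ₁ hδ₂, min_le_left _ _, min_le_right _ _⟩
  filter_upwards [Metric.ball_mem_nhds (0 : EuclideanSpace ℝ (Fin m))
    (show 0 < r / (m + 1) by positivity)] with v hv
  have hv : (m + 1) * ‖v‖ < r := by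
    rw [mem_ball_zero_iff, lt_div_iff₀ hm] at hv
    linarith
  have hsum : ∀ s : Finset (Fin m), ∑ i ∈ s, |v i| ≤ (m + 1) * ‖v‖ := fun s =>
    calc ∑ i ∈ s, |v i| ≤ ∑ _i ∈ s, ‖v‖ := Finset.sum_le_sum fun i _ => PiLp.norm_apply_le v i
      _ = s.card * ‖v‖ := by rw [Finset.sum_const, nsmul_eq_mul]
      _ ≤ (m + 1) * ‖v‖ := by
        gcongr
        exact (Nat.cast_le.2 s.card_le_univ).trans (by simp)
  have hmem : ∀ s : Finset (Fin m),
      x.1 + ∑ i ∈ s, v i • EuclideanSpace.single i (1 : ℝ) ∈ Metric.ball x.1 r := fun s => by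
    rw [Metric.mem_ball, dist_eq_norm, add_sub_cancel_left]
    calc _ ≤ ∑ i ∈ s, ‖v i • EuclideanSpace.single i (1 : ℝ)‖ := norm_sum_le _ _
      _ = ∑ i ∈ s, |v i| := by simp [norm_smul]
      _ < r := (hsum s).trans_lt hv
  have htel := norm_sub_sub_sum_smul_le h (convex_ball x.1 r)
    ((Metric.ball_subset_ball hr₂).trans hU)
    (fun i z hz => (dist_eq_norm _ _).symm.trans_le (hF' (hz.trans_le hr₁) i).le) hmem .univ
  have hbasis : ∑ i, v i • EuclideanSpace.single i (1 : ℝ) = v := by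
    ext j
    simp [Pi.single_apply]
  calc _ = _ := by simp [hbasis]
    _ ≤ _ := htel
    _ ≤ ε / (m + 1) * ((m + 1) * ‖v‖) := by gcongr; exact hsum _
    _ = ε * ‖v‖ := by field_simp

end Calculus

/-! ### Jets -/

section Jets

variable {m q : ℕ} {U : Opens (EuclideanSpace ℝ (Fin m))}
  {V : Type*} [NormedAddCommGroup V] [NormedSpace ℝ V]
  {W : Type*} [NormedAddCommGroup W] [NormedSpace ℝ W]

theorem IsCq.mono {q' : ℕ} {F : U → V} (h : IsCq q F) (hq : q' ≤ q) : IsCq q' F :=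
  ContDiffOn.of_le h (by exact_mod_cast hq)

theorem IsCq.contDiffAt {F : U → V} (h : IsCq q F) (x : U) :
    ContDiffAt ℝ q (zeroExt F) x.1 :=
  ContDiffOn.contDiffAt h (U.isOpen.mem_nhds x.2)

theorem IsCq.continuous {F : U → V} (h : IsCq q F) : Continuous F :=
  (continuousOn_iff_continuous_domRestrict.1 (ContDiffOn.continuousOn h)).congr (zeroExt_coe F)

theorem IsCq.hasPartial {F : U → V} (h : IsCq (q + 1) F) (i : Fin m) :
    HasPartial i F (partialDeriv i F) := fun x =>
  ((h.contDiffAt x).differentiableAt (by simp)).lineDifferentiableAt.hasLineDerivAt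

theorem IsCq.zeroExt_partialDeriv {F : U → V} (h : IsCq (q + 1) F) (i : Fin m)
    {x : EuclideanSpace ℝ (Fin m)} (hx : x ∈ U) :
    zeroExt (partialDeriv i F) x = fderiv ℝ (zeroExt F) x (EuclideanSpace.single i (1 : ℝ)) :=
  (zeroExt_of_mem _ hx).trans
    ((h.contDiffAt ⟨x, hx⟩).differentiableAt (by simp)).lineDeriv_eq_fderiv

theorem isCq_partialDeriv {F : U → V} (h : IsCq (q + 1) F) (i : Fin m) :
    IsCq q (partialDeriv i F) :=
  ((ContDiffOn.fderiv_of_isOpen (n := (q + 1 : ℕ)) h U.isOpen (by simp)).clm_apply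
    contDiffOn_const).congr fun _ hx => h.zeroExt_partialDeriv i hx

theorem IsCq.partialDeriv_partialDeriv {F : U → V} (h : IsCq 2 F) (i j : Fin m) (x : U) :
    partialDeriv i (partialDeriv j F) x = fderiv ℝ (fderiv ℝ (zeroExt F)) x
      (EuclideanSpace.single i (1 : ℝ)) (EuclideanSpace.single j (1 : ℝ)) := by
  have hnear : zeroExt (partialDeriv j F) =ᶠ[𝓝 x.1]
      fun y => fderiv ℝ (zeroExt F) y (EuclideanSpace.single j (1 : ℝ)) := by
    filter_upwards [U.isOpen.mem_nhds x.2] with y hy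
    exact h.zeroExt_partialDeriv (q := 1) j hy
  have hdiff : DifferentiableAt ℝ (fderiv ℝ (zeroExt F)) x.1 :=
    ((h.contDiffAt x).fderiv_right (m := 1) (by norm_num)).differentiableAt (by simp)
  rw [← zeroExt_coe (partialDeriv i _) x,
    (isCq_partialDeriv (q := 1) h j).zeroExt_partialDeriv (q := 0) i x.2, hnear.fderiv_eq,
    fderiv_clm_apply hdiff (differentiableAt_const _)]
  simp

theorem IsCq.partialDeriv_comm {F : U → V} (h : IsCq 2 F) (i j : Fin m) :
    partialDeriv i (partialDeriv j F) = partialDeriv j (partialDeriv i F) := by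
  funext x
  rw [h.partialDeriv_partialDeriv, h.partialDeriv_partialDeriv]
  exact ((h.contDiffAt x).isSymmSndFDerivAt (by simp)).eq _ _

theorem isCq_iterate_partialDeriv {a : ℕ} {F : U → V} (h : IsCq (q + a) F) (j : Fin m) :
    IsCq q ((partialDeriv j)^[a] F) := by
  induction a generalizing F with
  | zero => exact h
  | succ a ih => exact ih (isCq_partialDeriv (q := q + a) h j)

theorem IsCq.partialDeriv_iterate_comm {a : ℕ} {F : U → V} (h : IsCq (a + 1) F) (i j : Fin m) :
    partialDeriv i ((partialDeriv j)^[a] F) = (partialDeriv j)^[a] (partialDeriv i F) := by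
  induction a generalizing F with
  | zero => rfl
  | succ a ih =>
    rw [Function.iterate_succ_apply, ih (isCq_partialDeriv (q := a + 1) h j),
      Function.iterate_succ_apply, (h.mono (q' := 2) (by lia)).partialDeriv_comm i j]

/-- The iterated partial derivative in the variables of the list `l` only; `multiDeriv α` is the
case of the list of all variables, and the recursion on `l` is used to compute it. -/
noncomputable def listDeriv (l : List (Fin m)) (α : Fin m → ℕ) (F : U → V) : U → V :=
  l.foldr (fun i G => (partialDeriv i)^[α i] G) F

theorem listDeriv_cons (i : Fin m) (l : List (Fin m)) (α : Fin m → ℕ) (F : U → V) :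
    listDeriv (i :: l) α F = (partialDeriv i)^[α i] (listDeriv l α F) := rfl

theorem multiDeriv_eq_listDeriv (α : Fin m → ℕ) (F : U → V) :
    multiDeriv α F = listDeriv (List.finRange m) α F := rfl

theorem listDeriv_congr {l : List (Fin m)} {α β : Fin m → ℕ} (h : ∀ i ∈ l, α i = β i)
    (F : U → V) : listDeriv l α F = listDeriv l β F := by
  induction l with
  | nil => rfl
  | cons i l ih =>
    rw [listDeriv_cons, listDeriv_cons, h i List.mem_cons_self,
      ih fun j hj => h j (List.mem_cons_of_mem i hj)]

theorem isCq_listDeriv {l : List (Fin m)} {α : Fin m → ℕ} {F : U → V}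
    (h : IsCq (q + (l.map α).sum) F) : IsCq q (listDeriv l α F) := by
  induction l generalizing q with
  | nil => exact h
  | cons i l ih =>
    refine isCq_iterate_partialDeriv (ih (h.mono ?_)) i
    simp only [List.map_cons, List.sum_cons]
    lia

theorem partialDeriv_listDeriv {l : List (Fin m)} (hl : l.Nodup) {α : Fin m → ℕ} {F : U → V}
    (h : IsCq (1 + (l.map α).sum) F) {i : Fin m} (hi : i ∈ l) :
    partialDeriv i (listDeriv l α F) = listDeriv l (α + Pi.single i 1) F := by
  induction l with
  | nil => simp at hi
  | cons j l ih =>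
    rw [List.nodup_cons] at hl
    rw [List.map_cons, List.sum_cons] at h
    rw [listDeriv_cons, listDeriv_cons]
    obtain rfl | hij := eq_or_ne i j
    · have hl' : listDeriv l α F = listDeriv l (α + Pi.single i 1) F :=
        listDeriv_congr (fun k hk => by simp [ne_of_mem_of_not_mem hk hl.1]) F
      rw [← Function.iterate_succ_apply' (partialDeriv i), hl', Pi.add_apply, Pi.single_eq_same]
    · rw [(isCq_listDeriv (h.mono (by lia))).partialDeriv_iterate_comm,
        ih hl.2 (h.mono (by lia)) (List.mem_of_ne_of_mem hij hi), Pi.add_apply,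
        Pi.single_eq_of_ne hij.symm, add_zero]

@[simp]
theorem multiDeriv_zero (F : U → V) : multiDeriv 0 F = F := by
  rw [multiDeriv_eq_listDeriv]
  induction List.finRange m with
  | nil => rfl
  | cons i l ih => rw [listDeriv_cons, ih]; rfl

theorem zero_mem_multiIndices (m q : ℕ) : (0 : Fin m → ℕ) ∈ multiIndices m q := by
  simp [mem_multiIndices]

/-- The family `J` of functions indexed by multi-indices consists of all the derivatives of order
at most `q` of its member of index zero. Unlike `IsCq`, the notion is stable under passing to
limits and integrals of the family, and it determines `multiDeriv`. -/
structure IsJet (q : ℕ) (J : (Fin m → ℕ) → U → V) : Prop where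
  continuous : ∀ α, ∑ i, α i ≤ q → Continuous (J α)
  hasPartial : ∀ α i, ∑ j, α j + 1 ≤ q → HasPartial i (J α) (J (α + Pi.single i 1))

theorem sum_add_single (α : Fin m → ℕ) (i : Fin m) (a : ℕ) :
    ∑ j, (α + Pi.single i a : Fin m → ℕ) j = ∑ j, α j + a := by
  simp [Finset.sum_add_distrib]

theorem IsCq.isJet {F : U → V} (h : IsCq q F) : IsJet q fun α => multiDeriv α F where
  continuous α hα := by
    rw [Fin.sum_univ_def] at hα
    exact (isCq_listDeriv (q := 0) (h.mono (by lia))).continuous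
  hasPartial α i hα := by
    rw [Fin.sum_univ_def, add_comm] at hα
    rw [multiDeriv_eq_listDeriv, multiDeriv_eq_listDeriv,
      ← partialDeriv_listDeriv (List.nodup_finRange m) (h.mono hα) (List.mem_finRange i)]
    exact (isCq_listDeriv (h.mono hα)).hasPartial (q := 0) i

theorem IsCq.continuous_multiDeriv {F : U → V} (h : IsCq q F) {α : Fin m → ℕ}
    (hα : α ∈ multiIndices m q) : Continuous (multiDeriv α F) :=
  h.isJet.continuous α (mem_multiIndices.1 hα)

theorem IsJet.shift {J : (Fin m → ℕ) → U → V} (h : IsJet (q + 1) J) (i : Fin m) :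
    IsJet q fun α => J (α + Pi.single i 1) where
  continuous α hα := h.continuous _ (by rw [sum_add_single]; lia)
  hasPartial α j hα := by
    rw [add_right_comm]
    exact h.hasPartial _ j (by rw [sum_add_single]; lia)

theorem isCq_succ_of_hasPartial {F : U → V} {F' : Fin m → U → V}
    (h : ∀ i, HasPartial i F (F' i)) (hF' : ∀ i, IsCq q (F' i)) : IsCq (q + 1) F := by
  have hfderiv := hasFDerivAt_zeroExt h fun i => (hF' i).continuous
  rw [IsCq, Nat.cast_succ, contDiffOn_succ_iff_fderiv_of_isOpen U.isOpen]
  refine ⟨fun x hx => (hfderiv ⟨x, hx⟩).differentiableAt.differentiableWithinAt, by simp, ?_⟩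
  have hsum : ContDiffOn ℝ q (fun x => ∑ i,
      (EuclideanSpace.proj i : EuclideanSpace ℝ (Fin m) →L[ℝ] ℝ).smulRight
        (zeroExt (F' i) x)) U :=
    ContDiffOn.sum fun i _ =>
      (ContinuousLinearMap.smulRightL ℝ (EuclideanSpace ℝ (Fin m)) V
        (EuclideanSpace.proj i)).contDiff.comp_contDiffOn (hF' i)
  refine hsum.congr fun x hx => ?_
  simp only [(hfderiv ⟨x, hx⟩).fderiv, zeroExt_of_mem _ hx]

theorem isCq_zero_iff {F : U → V} : IsCq 0 F ↔ Continuous F := by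
  rw [IsCq, Nat.cast_zero, contDiffOn_zero, continuousOn_iff_continuous_domRestrict]
  exact iff_of_eq (congrArg _ (funext (zeroExt_coe F)))

theorem IsJet.isCq {J : (Fin m → ℕ) → U → V} (h : IsJet q J) : IsCq q (J 0) := by
  induction q generalizing J with
  | zero => exact isCq_zero_iff.2 (h.continuous 0 (by simp))
  | succ q ih =>
    exact isCq_succ_of_hasPartial (F' := fun i => J (Pi.single i 1))
      (fun i => by simpa using h.hasPartial 0 i (by simp)) fun i => by simpa using ih (h.shift i)

theorem IsJet.iterate_partialDeriv {J : (Fin m → ℕ) → U → V} (h : IsJet q J)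
    (β : Fin m → ℕ) (i : Fin m) (a : ℕ) (ha : ∑ j, β j + a ≤ q) :
    (partialDeriv i)^[a] (J β) = J (β + Pi.single i a) := by
  induction a with
  | zero => simp
  | succ a ih =>
    rw [Function.iterate_succ_apply', ih (by lia),
      (h.hasPartial _ i (by rw [sum_add_single]; lia)).partialDeriv_eq, add_assoc,
      ← Pi.single_add]

theorem IsJet.listDeriv_eq {J : (Fin m → ℕ) → U → V} (h : IsJet q J) {α : Fin m → ℕ}
    (hα : ∑ i, α i ≤ q) {l : List (Fin m)} (hl : l.Nodup) :
    listDeriv l α (J 0) = J fun i => if i ∈ l then α i else 0 := by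
  induction l with
  | nil => simp only [List.not_mem_nil, if_false]; rfl
  | cons i l ih =>
    rw [List.nodup_cons] at hl
    have hcons : (fun j => if j ∈ i :: l then α j else 0) =
        (fun j => if j ∈ l then α j else 0) + Pi.single i (α i) := by
      funext j
      obtain rfl | hj := eq_or_ne j i
      · simp [hl.1]
      · simp [hj]
    rw [listDeriv_cons, ih hl.2, h.iterate_partialDeriv, hcons]
    rw [← sum_add_single, ← hcons]
    refine (Finset.sum_le_sum fun j _ => ?_).trans hα
    split_ifs <;> simp

theorem IsJet.multiDeriv_eq {J : (Fin m → ℕ) → U → V} (h : IsJet q J) {F : U → V} (hF : J 0 = F)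
    {α : Fin m → ℕ} (hα : α ∈ multiIndices m q) : multiDeriv α F = J α := by
  rw [← hF, multiDeriv_eq_listDeriv,
    h.listDeriv_eq (mem_multiIndices.1 hα) (List.nodup_finRange m)]
  simp only [List.mem_finRange, if_true]

theorem IsJet.comp_clm {J : (Fin m → ℕ) → U → V} (h : IsJet q J) (L : V →L[ℝ] W) :
    IsJet q fun α x => L (J α x) where
  continuous α hα := L.continuous.comp (h.continuous α hα)
  hasPartial α i hα := (h.hasPartial α i hα).comp_clm L

theorem IsCq.comp_clm {F : U → V} (h : IsCq q F) (L : V →L[ℝ] W) :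
    IsCq q fun x => L (F x) := by
  simpa using (h.isJet.comp_clm L).isCq

theorem IsCq.multiDeriv_comp_clm {F : U → V} (h : IsCq q F) (L : V →L[ℝ] W)
    {α : Fin m → ℕ} (hα : α ∈ multiIndices m q) (x : U) :
    multiDeriv α (fun x => L (F x)) x = L (multiDeriv α F x) :=
  congrFun ((h.isJet.comp_clm L).multiDeriv_eq (by simp) hα) x

variable {Ω : Type*} [MeasurableSpace Ω] {μ : Measure Ω} {b : Ω → ℝ}

theorem hasPartial_integral {i : Fin m} {F F' : Ω → U → V} (h : ∀ w, HasPartial i (F w) (F' w))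
    (hF : ∀ x, Integrable (fun w => F w x) μ)
    (hF' : ∀ x, AEStronglyMeasurable (fun w => F' w x) μ)
    (hle : ∀ w x, ‖F' w x‖ ≤ b w) (hb : Integrable b μ) :
    HasPartial i (fun x => ∫ w, F w x ∂μ) fun x => ∫ w, F' w x ∂μ := by
  intro x
  have hext : zeroExt (fun x => ∫ w, F w x ∂μ) = fun y => ∫ w, zeroExt (F w) y ∂μ := by
    funext y
    by_cases hy : y ∈ U
    · simp only [zeroExt_of_mem _ hy]
    · simp only [zeroExt_of_notMem _ hy, integral_zero]
  have hmeas : ∀ y, AEStronglyMeasurable (fun w => zeroExt (F w) y) μ := fun y => by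
    by_cases hy : y ∈ U
    · simpa only [zeroExt_of_mem _ hy] using (hF ⟨y, hy⟩).1
    · simp only [zeroExt_of_notMem _ hy, aestronglyMeasurable_const]
  set e := EuclideanSpace.single i (1 : ℝ)
  have hderiv := (hasDerivAt_integral_of_dominated_loc_of_deriv_le (x₀ := (0 : ℝ))
    (F := fun t w => zeroExt (F w) (x + t • e)) (F' := fun t w => zeroExt (F' w) (x + t • e))
    (eventually_add_smul_single_mem x i) (Eventually.of_forall fun t => hmeas _)
    (by simpa using hF x) (by simpa using hF' x)
    (Eventually.of_forall fun w t ht => (zeroExt_of_mem (F' w) ht).symm ▸ hle w _) hb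
    (Eventually.of_forall fun w t ht =>
      (zeroExt_of_mem (F' w) ht).symm ▸ (h w).hasDerivAt_add_smul ht)).2
  rw [HasLineDerivAt, hext]
  simpa using hderiv

theorem isJet_integral {J : Ω → (Fin m → ℕ) → U → V} (hJ : ∀ w, IsJet q (J w))
    (hm : ∀ α, ∑ i, α i ≤ q → ∀ x, AEStronglyMeasurable (fun w => J w α x) μ)
    (hle : ∀ α, ∑ i, α i ≤ q → ∀ w x, ‖J w α x‖ ≤ b w) (hb : Integrable b μ) :
    IsJet q fun α x => ∫ w, J w α x ∂μ where
  continuous α hα := continuous_of_dominated (hm α hα)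
    (fun x => Eventually.of_forall fun w => hle α hα w x) hb
    (Eventually.of_forall fun w => (hJ w).continuous α hα)
  hasPartial α i hα := by
    have hα' : ∑ j, (α + Pi.single i 1 : Fin m → ℕ) j ≤ q := by rwa [sum_add_single]
    exact hasPartial_integral (fun w => (hJ w).hasPartial α i hα)
      (fun x => hb.mono' (hm α (by lia) x) (Eventually.of_forall fun w => hle α (by lia) w x))
      (hm _ hα') (hle _ hα') hb

end Jets

/-! ### Kernels of class `C^{q,q}` -/

section TwoVariables

variable {m q : ℕ} {U : Opens (EuclideanSpace ℝ (Fin m))}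
  {V : Type*} [NormedAddCommGroup V] [NormedSpace ℝ V]
  {W : Type*} [NormedAddCommGroup W] [NormedSpace ℝ W]

theorem mixedDeriv_zero_left (β : Fin m → ℕ) (K : U → U → V) (x y : U) :
    mixedDeriv 0 β K x y = multiDeriv β (K x) y := by
  rw [mixedDeriv, multiDeriv_zero]

theorem mixedDeriv_zero_right (α : Fin m → ℕ) (K : U → U → V) (x y : U) :
    mixedDeriv α 0 K x y = multiDeriv α (fun x => K x y) x := by
  simp only [mixedDeriv, multiDeriv_zero]

theorem mixedDeriv_zero (K : U → U → V) (x y : U) : mixedDeriv 0 0 K x y = K x y := by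
  simp only [mixedDeriv, multiDeriv_zero]

theorem exists_add_single_of_sum_eq_succ {n : ℕ} {α : Fin m → ℕ} (h : ∑ i, α i = n + 1) :
    ∃ (β : Fin m → ℕ) (i : Fin m), α = β + Pi.single i 1 ∧ ∑ j, β j = n := by
  obtain ⟨i, -, hi⟩ := Finset.exists_ne_zero_of_sum_ne_zero (h.trans_ne n.succ_ne_zero)
  have hle : Pi.single i 1 ≤ α := fun j => by
    rcases eq_or_ne j i with rfl | hj
    · simpa using Nat.one_le_iff_ne_zero.2 hi
    · simp [hj]
  have hα : α = (α - Pi.single i 1) + Pi.single i 1 := (tsub_add_cancel_of_le hle).symm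
  refine ⟨α - Pi.single i 1, i, hα, ?_⟩
  rw [hα, sum_add_single] at h
  exact Nat.succ_injective h

theorem IsCqq.continuous_mixedDeriv {K : U → U → V} (h : IsCqq q K) {α β : Fin m → ℕ}
    (hα : ∑ i, α i ≤ q) (hβ : ∑ i, β i ≤ q) :
    Continuous fun z : U × U => mixedDeriv α β K z.1 z.2 :=
  h.2.2 α (mem_multiIndices.2 hα) β (mem_multiIndices.2 hβ)

theorem IsCqq.isJet_left {K : U → U → V} (h : IsCqq q K) {β : Fin m → ℕ}
    (hβ : β ∈ multiIndices m q) (y : U) : IsJet q fun α x => mixedDeriv α β K x y :=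
  (h.2.1 β hβ y).isJet

theorem IsCqq.isJet_right {K : U → U → V} (h : IsCqq q K) {α : Fin m → ℕ}
    (hα : α ∈ multiIndices m q) (x : U) : IsJet q fun β y => mixedDeriv α β K x y := by
  induction hn : ∑ i, α i generalizing α x with
  | zero =>
    obtain rfl : α = 0 := funext fun i => Finset.sum_eq_zero_iff.1 hn i (Finset.mem_univ i)
    simpa only [mixedDeriv_zero_left] using (h.1 x).isJet
  | succ n ih =>
    rw [mem_multiIndices] at hα
    obtain ⟨α, i, rfl, rfl⟩ := exists_add_single_of_sum_eq_succ hn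
    rw [sum_add_single] at hα
    refine ⟨fun β hβ => ?_, fun β j hβ => ?_⟩
    · exact (h.continuous_mixedDeriv (by rwa [sum_add_single]) hβ).comp (Continuous.prodMk_right x)
    · have hβj : ∑ k, (β + Pi.single j 1 : Fin m → ℕ) k ≤ q := by rwa [sum_add_single]
      exact HasPartial.interchange (f := mixedDeriv α β K)
        (g := mixedDeriv α (β + Pi.single j 1) K)
        (fun y => (h.isJet_left (mem_multiIndices.2 (by lia)) y).hasPartial α i hα)
        (fun y => (h.isJet_left (mem_multiIndices.2 hβj) y).hasPartial α i hα)
        (fun x => (ih (mem_multiIndices.2 (by lia)) x rfl).hasPartial β j hβ)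
        (h.continuous_mixedDeriv (by rwa [sum_add_single]) hβj) x

theorem isCqq_of_jets {J : (Fin m → ℕ) → (Fin m → ℕ) → U → U → V}
    (h_right : ∀ x, IsJet q fun β y => J 0 β x y)
    (h_left : ∀ β ∈ multiIndices m q, ∀ y, IsJet q fun α x => J α β x y)
    (h_cont : ∀ α ∈ multiIndices m q, ∀ β ∈ multiIndices m q,
      Continuous fun z : U × U => J α β z.1 z.2) :
    IsCqq q (J 0 0) ∧ ∀ α ∈ multiIndices m q, ∀ β ∈ multiIndices m q, ∀ x y,
      mixedDeriv α β (J 0 0) x y = J α β x y := by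
  have hmulti : ∀ β ∈ multiIndices m q, ∀ x y, multiDeriv β (J 0 0 x) y = J 0 β x y :=
    fun β hβ x y => congrFun ((h_right x).multiDeriv_eq rfl hβ) y
  have hmixed : ∀ α ∈ multiIndices m q, ∀ β ∈ multiIndices m q, ∀ x y,
      mixedDeriv α β (J 0 0) x y = J α β x y := by
    intro α hα β hβ x y
    simp only [mixedDeriv, hmulti β hβ]
    exact congrFun ((h_left β hβ y).multiDeriv_eq rfl hα) x
  refine ⟨⟨fun x => (h_right x).isCq, fun β hβ y => ?_, fun α hα β hβ => ?_⟩, hmixed⟩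
  · simpa only [hmulti β hβ] using (h_left β hβ y).isCq
  · simpa only [hmixed α hα β hβ] using h_cont α hα β hβ

theorem IsCqq.comp_clm {K : U → U → V} (h : IsCqq q K) (L : V →L[ℝ] W) :
    IsCqq q (fun x y => L (K x y)) ∧ ∀ α ∈ multiIndices m q, ∀ β ∈ multiIndices m q, ∀ x y,
      mixedDeriv α β (fun x y => L (K x y)) x y = L (mixedDeriv α β K x y) := by
  have hL := isCqq_of_jets (J := fun α β x y => L (mixedDeriv α β K x y)) (q := q)
    (fun x => (h.isJet_right (zero_mem_multiIndices m q) x).comp_clm L)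
    (fun β hβ y => (h.isJet_left hβ y).comp_clm L)
    (fun α hα β hβ => L.continuous.comp (h.2.2 α hα β hβ))
  simpa only [mixedDeriv_zero] using hL

theorem IsCqq.shift {K : U → U → V} (h : IsCqq (q + 1) K) (i : Fin m) :
    IsCqq q (mixedDeriv (Pi.single i 1) (Pi.single i 1) K) := by
  have hmem : ∀ α ∈ multiIndices m q, α + Pi.single i 1 ∈ multiIndices m (q + 1) := fun α hα => by
    rw [mem_multiIndices, sum_add_single]
    exact Nat.succ_le_succ (mem_multiIndices.1 hα)
  have hshift := isCqq_of_jets (q := q)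
    (J := fun α β => mixedDeriv (α + Pi.single i 1) (β + Pi.single i 1) K)
    (fun x => (h.isJet_right (hmem 0 (zero_mem_multiIndices m q)) x).shift i)
    (fun β hβ y => (h.isJet_left (hmem β hβ) y).shift i)
    (fun α hα β hβ => h.2.2 _ (hmem α hα) _ (hmem β hβ))
  simpa only [zero_add] using hshift.1

end TwoVariables

/-! ### Feature maps -/

section Features

open ContinuousLinearMap (adjoint)

variable {X : Type*} {H : Type*} [NormedAddCommGroup H] [InnerProductSpace ℂ H] [CompleteSpace H]
  {E : Type*} [NormedAddCommGroup E] [InnerProductSpace ℂ E] [CompleteSpace E]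
  {R : Type*} [NormedAddCommGroup R] [InnerProductSpace ℂ R] [CompleteSpace R]

open scoped ComplexOrder in
theorem isPosDef_of_factor {K : X → X → H →L[ℂ] H} {Φ : X → H →L[ℂ] E}
    (hK : ∀ x y, K x y = adjoint (Φ x) ∘L Φ y) : IsPosDef K := by
  rw [isPosDef_iff]
  intro v
  have hsum : (v.sum fun x a => v.sum fun y b => inner ℂ a (K x y b)) =
      inner ℂ (v.sum fun x a => Φ x a) (v.sum fun x a => Φ x a) := by
    simp only [hK, ContinuousLinearMap.comp_apply, ContinuousLinearMap.adjoint_inner_right,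
      Finsupp.sum, sum_inner, inner_sum]
    rw [Finset.sum_comm]
  rw [hsum, inner_self_eq_norm_sq_to_K, ← RCLike.ofReal_pow]
  exact RCLike.ofReal_nonneg.2 (sq_nonneg _)

theorem denseRange_lsum_of_adjoint_eq_zero {Ψ : X → H →L[ℂ] R}
    (hΨ : ∀ u : R, (∀ x, adjoint (Ψ x) u = 0) → u = 0) :
    DenseRange (Finsupp.lsum ℂ fun x => (Ψ x).toLinearMap : (X →₀ H) →ₗ[ℂ] R) := by
  set A : (X →₀ H) →ₗ[ℂ] R := Finsupp.lsum ℂ fun x => (Ψ x).toLinearMap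
  suffices h : (LinearMap.range A)ᗮ = ⊥ from
    Submodule.dense_iff_topologicalClosure_eq_top.2 (Submodule.topologicalClosure_eq_top_iff.2 h)
  refine (Submodule.eq_bot_iff _).2 fun u hu => hΨ u fun x => ext_inner_left ℂ fun v => ?_
  rw [ContinuousLinearMap.adjoint_inner_right, inner_zero_right]
  exact hu _ ⟨Finsupp.single x v, by simp [A]⟩

theorem inner_lsum_congr_of_adjoint_comp {Ψ : X → H →L[ℂ] R} {Φ : X → H →L[ℂ] E}
    (h : ∀ x y, adjoint (Ψ x) ∘L Ψ y = adjoint (Φ x) ∘L Φ y) (c d : X →₀ H) :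
    inner ℂ (Finsupp.lsum ℂ (fun x => (Φ x).toLinearMap) c)
        (Finsupp.lsum ℂ (fun x => (Φ x).toLinearMap) d) =
      inner ℂ (Finsupp.lsum ℂ (fun x => (Ψ x).toLinearMap) c)
        (Finsupp.lsum ℂ (fun x => (Ψ x).toLinearMap) d) := by
  have hker : ∀ x y v w, inner ℂ (Ψ x v) (Ψ y w) = inner ℂ (Φ x v) (Φ y w) := by
    intro x y v w
    rw [← ContinuousLinearMap.adjoint_inner_right, ← ContinuousLinearMap.adjoint_inner_right]
    exact congrArg (inner ℂ v) (DFunLike.congr_fun (h x y) w)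
  simp only [Finsupp.lsum_apply, Finsupp.sum, sum_inner, inner_sum,
    ContinuousLinearMap.coe_coe, hker]

theorem exists_isometry_of_features {Ψ : X → H →L[ℂ] R} {Φ : X → H →L[ℂ] E}
    (h : ∀ x y, adjoint (Ψ x) ∘L Ψ y = adjoint (Φ x) ∘L Φ y)
    (hΨ : ∀ u : R, (∀ x, adjoint (Ψ x) u = 0) → u = 0) :
    ∃ T : R →L[ℂ] E, (∀ x, T ∘L Ψ x = Φ x) ∧ ∀ F, adjoint T (T F) = F := by
  set A : (X →₀ H) →ₗ[ℂ] R := Finsupp.lsum ℂ fun x => (Ψ x).toLinearMap with hA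
  set B : (X →₀ H) →ₗ[ℂ] E := Finsupp.lsum ℂ fun x => (Φ x).toLinearMap with hB
  have hdense : DenseRange A := denseRange_lsum_of_adjoint_eq_zero hΨ
  have hinner : ∀ c d, inner ℂ (B c) (B d) = inner ℂ (A c) (A d) :=
    inner_lsum_congr_of_adjoint_comp h
  have hnorm : ∀ c, ‖B c‖ ≤ 1 * ‖A c‖ := fun c => by
    rw [one_mul, @norm_eq_sqrt_re_inner ℂ, @norm_eq_sqrt_re_inner ℂ, hinner]
  have hT := LinearMap.extendOfNorm_eq hdense ⟨1, hnorm⟩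
  refine ⟨B.extendOfNorm A, fun x => ContinuousLinearMap.ext fun v => ?_, fun F => ?_⟩
  · simpa [hA, hB] using hT (Finsupp.single x v)
  · refine hdense.induction_on F (isClosed_eq (by fun_prop) continuous_id) fun c =>
      hdense.eq_of_inner_right ℂ fun d => ?_
    rw [ContinuousLinearMap.adjoint_inner_right, hT, hT, hinner]

theorem mem_rkhs_iff {K : X → X → H →L[ℂ] H} {Φ : X → H →L[ℂ] E}
    (hK : ∀ x y, K x y = adjoint (Φ x) ∘L Φ y) {f : X → H} :
    f ∈ rkhs K ↔ ∃ u : E, ∀ x, f x = adjoint (Φ x) u := by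
  have hpd : (Matrix.of K).PosSemidef := isPosDef_of_factor hK
  have : Fact (Matrix.of K).PosSemidef := ⟨hpd⟩
  obtain ⟨T, hT, hTT⟩ := exists_isometry_of_features
    (Ψ := RKHS.kerFun (RKHS.OfKernel (Matrix.of K))) (Φ := Φ)
    (fun x y => by rw [← RKHS.kernel_apply, RKHS.OfKernel.kernel_ofKernel, ← hK, Matrix.of_apply])
    (fun u hu => RKHS.ext fun x => by
      rw [← RKHS.adjoint_kerFun, hu, RKHS.coe_zero, Pi.zero_apply])
  have hadj : ∀ u x, (adjoint T u) x = adjoint (Φ x) u := fun u x => by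
    rw [← RKHS.adjoint_kerFun, ← hT, ContinuousLinearMap.adjoint_comp,
      ContinuousLinearMap.comp_apply]
  constructor
  · rintro ⟨_, F, rfl⟩
    exact ⟨T F, fun x => by rw [← hadj, hTT]; rfl⟩
  · rintro ⟨u, hu⟩
    exact ⟨hpd, adjoint T u, funext fun x => by rw [hu, ← hadj]; rfl⟩

universe u v in
theorem IsPosDef.exists_features {H : Type u} [NormedAddCommGroup H] [InnerProductSpace ℂ H]
    [CompleteSpace H] {X : Type v} {K : X → X → H →L[ℂ] H} (h : IsPosDef K) :
    ∃ (E : Type (max u v)) (_ : NormedAddCommGroup E) (_ : InnerProductSpace ℂ E)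
      (_ : CompleteSpace E) (Φ : X → H →L[ℂ] E), (∀ x y, K x y = adjoint (Φ x) ∘L Φ y) ∧
      ∀ u : E, (∀ x, adjoint (Φ x) u = 0) → u = 0 := by
  have : Fact (Matrix.of K).PosSemidef := ⟨h⟩
  refine ⟨RKHS.OfKernel (Matrix.of K), inferInstance, inferInstance, inferInstance,
    RKHS.kerFun _, fun x y => ?_, fun u hu => RKHS.ext fun x => ?_⟩
  · rw [← RKHS.kernel_apply, RKHS.OfKernel.kernel_ofKernel, Matrix.of_apply]
  · rw [← RKHS.adjoint_kerFun, hu, RKHS.coe_zero, Pi.zero_apply]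

theorem kernel_section_mem_rkhs {K : X → X → H →L[ℂ] H} (h : IsPosDef K) (y : X) (v : H) :
    (fun x => K x y v) ∈ rkhs K := by
  obtain ⟨E, _, _, _, Φ, hΦ, -⟩ := h.exists_features
  exact (mem_rkhs_iff hΦ).2 ⟨Φ y v, fun x => by rw [hΦ, ContinuousLinearMap.comp_apply]⟩

theorem adjoint_real_smul (t : ℝ) (T : H →L[ℂ] E) : adjoint (t • T) = t • adjoint T := by
  simp only [← Complex.coe_smul, map_smulₛₗ, Complex.conj_ofReal]

/-- The adjoint as a real linear map; over `ℂ` it is only conjugate linear. -/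
noncomputable def realAdjoint : (H →L[ℂ] E) →L[ℝ] (E →L[ℂ] H) where
  toFun := adjoint
  map_add' := map_add _
  map_smul' := adjoint_real_smul
  cont := adjoint.continuous

end Features

/-! ### Differentiability of feature maps -/

section DifferentiableFeatures

open ContinuousLinearMap (adjoint)

variable {m q : ℕ} {U : Opens (EuclideanSpace ℝ (Fin m))}
  {H : Type*} [NormedAddCommGroup H] [InnerProductSpace ℂ H] [CompleteSpace H]
  {E : Type*} [NormedAddCommGroup E] [InnerProductSpace ℂ E] [CompleteSpace E]
  {K : U → U → H →L[ℂ] H} {Φ Φ' : U → H →L[ℂ] E}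

theorem adjoint_sub_comp_sub (hK : ∀ x y, K x y = adjoint (Φ x) ∘L Φ y) (x x' y y' : U) :
    adjoint (Φ x' - Φ x) ∘L (Φ y' - Φ y) = K x' y' - K x y' - (K x' y - K x y) := by
  simp only [hK, map_sub, ContinuousLinearMap.sub_comp, ContinuousLinearMap.comp_sub]

theorem continuous_of_factor (hK : ∀ x y, K x y = adjoint (Φ x) ∘L Φ y)
    (hc : Continuous fun z : U × U => K z.1 z.2) : Continuous Φ := by
  refine continuous_iff_continuousAt.2 fun x => tendsto_iff_norm_sub_tendsto_zero.2 ?_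
  have hnorm : ∀ y, ‖Φ y - Φ x‖ = √‖K y y - K x y - (K y x - K x x)‖ := fun y => by
    rw [← adjoint_sub_comp_sub hK, ContinuousLinearMap.norm_adjoint_comp_self,
      Real.sqrt_mul_self (norm_nonneg _)]
  have hcont : Continuous fun y => √‖K y y - K x y - (K y x - K x x)‖ :=
    Real.continuous_sqrt.comp (((hc.comp (continuous_id.prodMk continuous_id)).sub
      (hc.comp (Continuous.prodMk_right x))).sub
      ((hc.comp (Continuous.prodMk_left x)).sub continuous_const)).norm
  simpa only [hnorm, sub_self, norm_zero, Real.sqrt_zero] using hcont.tendsto x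

theorem norm_sub_sq_le_of_adjoint_comp {S T : H →L[ℂ] E} {A : H →L[ℂ] H} {ε : ℝ}
    (hSS : ‖adjoint S ∘L S - A‖ ≤ ε) (hST : ‖adjoint S ∘L T - A‖ ≤ ε)
    (hTS : ‖adjoint T ∘L S - A‖ ≤ ε) (hTT : ‖adjoint T ∘L T - A‖ ≤ ε) :
    ‖S - T‖ * ‖S - T‖ ≤ 4 * ε := by
  have hexpand : adjoint (S - T) ∘L (S - T) =
      (adjoint S ∘L S - A) - (adjoint S ∘L T - A) -
        ((adjoint T ∘L S - A) - (adjoint T ∘L T - A)) := by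
    simp only [map_sub, ContinuousLinearMap.sub_comp, ContinuousLinearMap.comp_sub]
    abel
  rw [← ContinuousLinearMap.norm_adjoint_comp_self, hexpand]
  linarith [norm_sub_le ((adjoint S ∘L S - A) - (adjoint S ∘L T - A))
    ((adjoint T ∘L S - A) - (adjoint T ∘L T - A)),
    norm_sub_le (adjoint S ∘L S - A) (adjoint S ∘L T - A),
    norm_sub_le (adjoint T ∘L S - A) (adjoint T ∘L T - A)]

theorem cauchy_map_of_adjoint_comp {ι : Type*} {l : Filter ι} [l.NeBot] {D : ι → H →L[ℂ] E}
    {A : H →L[ℂ] H}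
    (h : ∀ ε > 0, ∀ᶠ z : ι × ι in l ×ˢ l, ‖adjoint (D z.1) ∘L D z.2 - A‖ ≤ ε) :
    Cauchy (map D l) := by
  refine cauchy_map_iff'.2 (Metric.uniformity_basis_dist.tendsto_right_iff.2 fun ε hε => ?_)
  have hε' : 0 < ε ^ 2 / 8 := by positivity
  obtain ⟨s, hs, hle⟩ : ∃ s ∈ l, ∀ a ∈ s, ∀ b ∈ s, ‖adjoint (D a) ∘L D b - A‖ ≤ ε ^ 2 / 8 := by
    simpa only [eventually_prod_self_iff'] using h _ hε'
  filter_upwards [prod_mem_prod hs hs] with z ⟨ha, hb⟩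
  have hsq := norm_sub_sq_le_of_adjoint_comp (hle _ ha _ ha) (hle _ ha _ hb) (hle _ hb _ ha)
    (hle _ hb _ hb)
  rw [dist_eq_norm]
  exact lt_of_pow_lt_pow_left₀ 2 hε.le (by nlinarith)

theorem norm_adjoint_inv_smul_comp_sub_le {S T : H →L[ℂ] E} {A : H →L[ℂ] H} {s t ε : ℝ}
    (hs : s ≠ 0) (ht : t ≠ 0) (h : ‖adjoint S ∘L T - (s * t) • A‖ ≤ ε * (|s| * |t|)) :
    ‖adjoint (s⁻¹ • S) ∘L (t⁻¹ • T) - A‖ ≤ ε := by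
  have hscale : adjoint (s⁻¹ • S) ∘L (t⁻¹ • T) - A =
      (s * t)⁻¹ • (adjoint S ∘L T - (s * t) • A) := by
    rw [smul_sub _ (adjoint S ∘L T), inv_smul_smul₀ (mul_ne_zero hs ht), mul_inv, mul_smul,
      adjoint_real_smul, ContinuousLinearMap.smul_comp, ContinuousLinearMap.comp_smul]
  rw [hscale, norm_smul, norm_inv, norm_mul, Real.norm_eq_abs, Real.norm_eq_abs,
    inv_mul_le_iff₀ (mul_pos (abs_pos.2 hs) (abs_pos.2 ht)), mul_comm _ ε]
  exact h

theorem norm_adjoint_diffQuot_comp_diffQuot_sub_le {i : Fin m} {g k : U → U → H →L[ℂ] H}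
    (hK : ∀ x y, K x y = adjoint (Φ x) ∘L Φ y)
    (hgk : ∀ y, HasPartial i (fun x => g x y) fun x => k x y)
    (hKg : ∀ x, HasPartial i (K x) (g x))
    (hk : Continuous fun z : U × U => k z.1 z.2) (x : U) {ε : ℝ} (hε : 0 < ε) :
    ∀ᶠ z : ℝ × ℝ in 𝓝[≠] 0 ×ˢ 𝓝[≠] 0,
      ‖adjoint (z.1⁻¹ • (zeroExt Φ (x + z.1 • EuclideanSpace.single i (1 : ℝ)) - Φ x)) ∘L
        (z.2⁻¹ • (zeroExt Φ (x + z.2 • EuclideanSpace.single i (1 : ℝ)) - Φ x)) - k x x‖ ≤ ε := by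
  obtain ⟨δ, hδ, hle⟩ := norm_second_difference_le hgk hKg hk x x hε
  have hnear : ∀ᶠ t : ℝ in 𝓝[≠] 0, t ≠ 0 ∧ |t| < δ ∧
      x.1 + t • EuclideanSpace.single i (1 : ℝ) ∈ U := by
    filter_upwards [self_mem_nhdsWithin, nhdsWithin_le_nhds (eventually_add_smul_single_mem x i),
      nhdsWithin_le_nhds (Metric.ball_mem_nhds (0 : ℝ) hδ)] with t ht₀ htU htδ
    exact ⟨ht₀, by simpa using htδ, htU⟩
  filter_upwards [hnear.prod_mk hnear] with z ⟨⟨hs, hsδ, hsU⟩, ht, htδ, htU⟩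
  have hquot := hle z.1 z.2 ⟨_, hsU⟩ ⟨_, htU⟩ hsδ htδ rfl rfl
  rw [← adjoint_sub_comp_sub hK] at hquot
  rw [zeroExt_of_mem _ hsU, zeroExt_of_mem _ htU]
  exact norm_adjoint_inv_smul_comp_sub_le hs ht (hquot.trans_eq (by ring))

/-- Completeness of the feature space turns differentiability of the kernel into
differentiability of the feature map. -/
theorem exists_hasPartial_of_factor {i : Fin m} {g k : U → U → H →L[ℂ] H}
    (hK : ∀ x y, K x y = adjoint (Φ x) ∘L Φ y)
    (hgk : ∀ y, HasPartial i (fun x => g x y) fun x => k x y)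
    (hKg : ∀ x, HasPartial i (K x) (g x))
    (hk : Continuous fun z : U × U => k z.1 z.2) : ∃ Φ', HasPartial i Φ Φ' := by
  suffices h : ∀ x : U, ∃ T, HasLineDerivAt ℝ (zeroExt Φ) T x (EuclideanSpace.single i (1 : ℝ)) by
    choose Φ' hΦ' using h
    exact ⟨Φ', hΦ'⟩
  intro x
  have hcauchy := cauchy_map_of_adjoint_comp (l := 𝓝[≠] (0 : ℝ))
    (D := fun t => t⁻¹ • (zeroExt Φ (x + t • EuclideanSpace.single i (1 : ℝ)) - Φ x))
    (A := k x x) fun ε hε => norm_adjoint_diffQuot_comp_diffQuot_sub_le hK hgk hKg hk x hε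
  obtain ⟨T, hT⟩ := CompleteSpace.complete hcauchy
  rw [← Tendsto] at hT
  refine ⟨T, hasDerivAt_iff_tendsto_slope_zero.2 ?_⟩
  simpa only [zero_add, zero_smul, add_zero, zeroExt_coe] using hT

theorem HasPartial.adjoint_comp_features {i : Fin m} {g k : U → U → H →L[ℂ] H}
    (h : HasPartial i Φ Φ') (hK : ∀ x y, K x y = adjoint (Φ x) ∘L Φ y)
    (hgk : ∀ y, HasPartial i (fun x => g x y) fun x => k x y)
    (hKg : ∀ x, HasPartial i (K x) (g x)) (x y : U) :
    k x y = adjoint (Φ' x) ∘L Φ' y := by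
  have hg : ∀ x y, g x y = adjoint (Φ x) ∘L Φ' y := fun x y => by
    have hcomp := h.comp_clm
      ((ContinuousLinearMap.compL ℂ H E H (adjoint (Φ x))).restrictScalars ℝ)
    rw [← (hKg x).partialDeriv_eq, funext (hK x)]
    exact congrFun hcomp.partialDeriv_eq y
  have hcomp := h.comp_clm
    (((ContinuousLinearMap.compL ℂ H E H).flip (Φ' y)).restrictScalars ℝ ∘L realAdjoint)
  have hky := (hgk y).partialDeriv_eq
  simp only [hg] at hky
  rw [← congrFun hky x]
  exact congrFun hcomp.partialDeriv_eq x

theorem isCq_of_factor (hq : IsCqq q K) (hK : ∀ x y, K x y = adjoint (Φ x) ∘L Φ y) :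
    IsCq q Φ := by
  induction q generalizing K Φ with
  | zero =>
    have hcont := hq.2.2 0 (zero_mem_multiIndices m 0) 0 (zero_mem_multiIndices m 0)
    simp only [mixedDeriv_zero] at hcont
    exact isCq_zero_iff.2 (continuous_of_factor hK hcont)
  | succ q ih =>
    have hmem : ∀ i, Pi.single i 1 ∈ multiIndices m (q + 1) := fun i => by simp [mem_multiIndices]
    have hKg : ∀ i x, HasPartial i (K x) (mixedDeriv 0 (Pi.single i 1) K x) := fun i x => by
      simpa [mixedDeriv_zero] using
        (hq.isJet_right (zero_mem_multiIndices m _) x).hasPartial 0 i (by simp)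
    have hgk : ∀ i y, HasPartial i (fun x => mixedDeriv 0 (Pi.single i 1) K x y)
        fun x => mixedDeriv (Pi.single i 1) (Pi.single i 1) K x y := fun i y => by
      simpa using (hq.isJet_left (hmem i) y).hasPartial 0 i (by simp)
    choose Φ' hΦ' using fun i =>
      exists_hasPartial_of_factor hK (hgk i) (hKg i) (hq.2.2 _ (hmem i) _ (hmem i))
    exact isCq_succ_of_hasPartial hΦ' fun i =>
      ih (hq.shift i) ((hΦ' i).adjoint_comp_features hK (hgk i) (hKg i))

theorem mixedDeriv_of_factor (hΦ : IsCq q Φ) (hK : ∀ x y, K x y = adjoint (Φ x) ∘L Φ y)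
    {α β : Fin m → ℕ} (hα : α ∈ multiIndices m q) (hβ : β ∈ multiIndices m q) (x y : U) :
    mixedDeriv α β K x y = adjoint (multiDeriv α Φ x) ∘L multiDeriv β Φ y := by
  have hright : ∀ x, multiDeriv β (K x) y = adjoint (Φ x) ∘L multiDeriv β Φ y := fun x => by
    rw [funext (hK x)]
    exact hΦ.multiDeriv_comp_clm
      ((ContinuousLinearMap.compL ℂ H E H (adjoint (Φ x))).restrictScalars ℝ) hβ y
  simp only [mixedDeriv, hright]
  exact hΦ.multiDeriv_comp_clm
    (((ContinuousLinearMap.compL ℂ H E H).flip (multiDeriv β Φ y)).restrictScalars ℝ ∘L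
      realAdjoint) hα x

theorem isCq_adjoint_apply (hΦ : IsCq q Φ) (u : E) : IsCq q fun x => adjoint (Φ x) u :=
  hΦ.comp_clm ((ContinuousLinearMap.apply ℂ H u).restrictScalars ℝ ∘L realAdjoint)

theorem multiDeriv_adjoint_apply (hΦ : IsCq q Φ) {α : Fin m → ℕ} (hα : α ∈ multiIndices m q)
    (u : E) (x : U) :
    multiDeriv α (fun x => adjoint (Φ x) u) x = adjoint (multiDeriv α Φ x) u :=
  hΦ.multiDeriv_comp_clm ((ContinuousLinearMap.apply ℂ H u).restrictScalars ℝ ∘L realAdjoint) hα x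

theorem norm_multiDeriv_features_le (hΦ : IsCq q Φ) (hK : ∀ x y, K x y = adjoint (Φ x) ∘L Φ y)
    {α : Fin m → ℕ} (hα : α ∈ multiIndices m q) {M : ℝ} {x : U}
    (hM : ‖mixedDeriv α α K x x‖ ≤ M) : ‖multiDeriv α Φ x‖ ≤ √M := by
  refine Real.le_sqrt_of_sq_le ?_
  rwa [sq, ← ContinuousLinearMap.norm_adjoint_comp_self, ← mixedDeriv_of_factor hΦ hK hα hα]

theorem isCq_of_mem_rkhs (hK : IsPosDef K) (hq : IsCqq q K) {f : U → H} (hf : f ∈ rkhs K) :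
    IsCq q f := by
  obtain ⟨E, _, _, _, Φ, hΦ, -⟩ := hK.exists_features
  obtain ⟨u, hu⟩ := (mem_rkhs_iff hΦ).1 hf
  rw [funext hu]
  exact isCq_adjoint_apply (isCq_of_factor hq hΦ) u

end DifferentiableFeatures

section ScalarKernels

open ContinuousLinearMap (adjoint toSpanSingleton)

variable {H : Type*} [NormedAddCommGroup H] [InnerProductSpace ℂ H]

variable {m q : ℕ} {U : Opens (EuclideanSpace ℝ (Fin m))}

theorem isCqq_scalarKernel {k : U → U → ℂ} (hk : IsCqq q k) :
    IsCqq q (scalarKernel k) ∧ ∀ α ∈ multiIndices m q, ∀ β ∈ multiIndices m q, ∀ x y,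
      mixedDeriv α β (scalarKernel k) x y = ContinuousLinearMap.mul ℂ ℂ (mixedDeriv α β k x y) :=
  hk.comp_clm ((ContinuousLinearMap.mul ℂ ℂ).restrictScalars ℝ)

theorem isCqq_kernelProj {K : U → U → H →L[ℂ] H} (hK : IsCqq q K) (v : H) :
    IsCqq q (kernelProj K v) ∧ ∀ α ∈ multiIndices m q, ∀ β ∈ multiIndices m q, ∀ x y,
      mixedDeriv α β (kernelProj K v) x y = inner ℂ v (mixedDeriv α β K x y v) :=
  hK.comp_clm (((innerSL ℂ v).comp (ContinuousLinearMap.apply ℂ H v)).restrictScalars ℝ)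

variable [CompleteSpace H] {X : Type*} {K : X → X → H →L[ℂ] H}

theorem kernelProj_factor {E : Type*} [NormedAddCommGroup E] [InnerProductSpace ℂ E]
    [CompleteSpace E] {Φ : X → H →L[ℂ] E} (hK : ∀ x y, K x y = adjoint (Φ x) ∘L Φ y) (v : H)
    (x y : X) :
    scalarKernel (kernelProj K v) x y =
      adjoint (Φ x ∘L toSpanSingleton ℂ v) ∘L (Φ y ∘L toSpanSingleton ℂ v) := by
  refine ContinuousLinearMap.ext_ring ?_
  simp [scalarKernel, kernelProj, hK, ContinuousLinearMap.adjoint_comp,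
    ContinuousLinearMap.adjoint_toSpanSingleton]

theorem isPosDef_kernelProj (hK : IsPosDef K) (v : H) :
    IsPosDef (scalarKernel (kernelProj K v)) := by
  obtain ⟨E, _, _, _, Φ, hΦ, -⟩ := hK.exists_features
  exact isPosDef_of_factor (kernelProj_factor hΦ v)

theorem mem_rkhs_kernelProj_iff (hK : IsPosDef K) (v : H) {f : X → ℂ} :
    f ∈ rkhs (scalarKernel (kernelProj K v)) ↔ ∃ F ∈ rkhs K, f = fun x => inner ℂ v (F x) := by
  obtain ⟨E, _, _, _, Φ, hΦ, -⟩ := hK.exists_features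
  have hadj : ∀ x u, adjoint (Φ x ∘L toSpanSingleton ℂ v) u = inner ℂ v (adjoint (Φ x) u) := by
    simp [ContinuousLinearMap.adjoint_comp, ContinuousLinearMap.adjoint_toSpanSingleton]
  rw [mem_rkhs_iff (kernelProj_factor hΦ v)]
  simp only [hadj]
  constructor
  · rintro ⟨u, hu⟩
    exact ⟨_, (mem_rkhs_iff hΦ).2 ⟨u, fun x => rfl⟩, funext hu⟩
  · rintro ⟨F, hF, rfl⟩
    obtain ⟨u, hu⟩ := (mem_rkhs_iff hΦ).1 hF
    exact ⟨u, fun x => congrArg (inner ℂ v) (hu x)⟩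

end ScalarKernels

/-! ### Vector measures with a density -/

section Density

variable {X : Type*} [MeasurableSpace X] {E F G : Type*} [NormedAddCommGroup E]
  [NormedAddCommGroup F] [NormedAddCommGroup G] {η : VectorMeasure X F} {μ : Measure X} {g : X → F}

theorem integrable_norm_mul_norm (hg : AEStronglyMeasurable g μ) {f : X → E}
    (hf : Integrable f (μ.withDensity fun x => ‖g x‖ₑ)) :
    Integrable (fun x => ‖f x‖ * ‖g x‖) μ := by
  simpa only [toReal_enorm, smul_eq_mul, mul_comm ‖g _‖] using
    (integrable_withDensity_iff_integrable_smul₀' hg.enorm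
      (Eventually.of_forall fun x => enorm_lt_top)).1 hf.norm

theorem integral_norm_mul_norm (hg : AEStronglyMeasurable g μ) (f : X → E) :
    ∫ x, ‖f x‖ * ‖g x‖ ∂μ = ∫ x, ‖f x‖ ∂μ.withDensity fun x => ‖g x‖ₑ := by
  rw [integral_withDensity_eq_integral_toReal_smul₀ hg.enorm
    (Eventually.of_forall fun x => enorm_lt_top)]
  simp only [toReal_enorm, smul_eq_mul, mul_comm]

variable [NormedSpace ℝ E] [NormedSpace ℝ F] [NormedSpace ℝ G]

theorem variation_eq_withDensity [CompleteSpace F] (hg : Integrable g μ)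
    (hη : ∀ A, MeasurableSet A → η A = ∫ x in A, g x ∂μ) :
    η.variation = μ.withDensity fun x => ‖g x‖ₑ := by
  have hη' : η = μ.withDensityᵥ g := VectorMeasure.ext fun A hA => by
    rw [hη A hA, withDensityᵥ_apply hg hA]
  rw [hη', Measure.variation_withDensityᵥ hg]

theorem bilin_congr_ae (hg : AEStronglyMeasurable g μ) (B : E →L[ℝ] F →L[ℝ] G) {f f' : X → E}
    (h : f =ᵐ[μ.withDensity fun x => ‖g x‖ₑ] f') :
    (fun x => B (f x) (g x)) =ᵐ[μ] fun x => B (f' x) (g x) := by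
  rw [EventuallyEq, ae_withDensity_iff' hg.enorm] at h
  filter_upwards [h] with x hx
  by_cases hgx : g x = 0
  · simp [hgx]
  · rw [hx (by simpa using hgx)]

theorem norm_bilin_le (B : E →L[ℝ] F →L[ℝ] G) (e : E) (f : F) :
    ‖B e f‖ ≤ ‖B‖ * (‖e‖ * ‖f‖) :=
  (B.le_opNorm₂ e f).trans_eq (mul_assoc _ _ _)

theorem integrable_bilin (hg : AEStronglyMeasurable g μ) (B : E →L[ℝ] F →L[ℝ] G) {f : X → E}
    (hf : Integrable f (μ.withDensity fun x => ‖g x‖ₑ)) :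
    Integrable (fun x => B (f x) (g x)) μ := by
  obtain ⟨f', hf', hff'⟩ := hf.aestronglyMeasurable
  have hmeas : AEStronglyMeasurable (fun x => B (f x) (g x)) μ :=
    (B.aestronglyMeasurable_comp₂ hf'.aestronglyMeasurable hg).congr
      (bilin_congr_ae hg B hff').symm
  exact ((integrable_norm_mul_norm hg hf).const_mul ‖B‖).mono' hmeas
    (Eventually.of_forall fun x => norm_bilin_le B _ _)

theorem norm_integral_bilin_le (hg : AEStronglyMeasurable g μ) (B : E →L[ℝ] F →L[ℝ] G) {f : X → E}
    (hf : Integrable f (μ.withDensity fun x => ‖g x‖ₑ)) :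
    ‖∫ x, B (f x) (g x) ∂μ‖ ≤ ‖B‖ * ∫ x, ‖f x‖ ∂μ.withDensity fun x => ‖g x‖ₑ := by
  rw [← integral_norm_mul_norm hg, ← integral_const_mul]
  exact norm_integral_le_of_norm_le ((integrable_norm_mul_norm hg hf).const_mul _)
    (Eventually.of_forall fun x => norm_bilin_le B _ _)

theorem continuous_integral_bilin (hg : AEStronglyMeasurable g μ) (B : E →L[ℝ] F →L[ℝ] G) :
    Continuous fun f : X →₁[μ.withDensity fun x => ‖g x‖ₑ] E => ∫ x, B (f x) (g x) ∂μ := by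
  refine LipschitzWith.continuous (K := ‖B‖₊) (LipschitzWith.of_dist_le_mul fun f f' => ?_)
  have hf := L1.integrable_coeFn f
  have hf' := L1.integrable_coeFn f'
  rw [dist_eq_norm, dist_eq_norm, L1.norm_eq_integral_norm, coe_nnnorm,
    ← integral_sub (integrable_bilin hg B hf) (integrable_bilin hg B hf')]
  calc ‖∫ x, (B (f x) (g x) - B (f' x) (g x)) ∂μ‖
      = ‖∫ x, B ((f - f' : X → E) x) (g x) ∂μ‖ := by
        simp only [Pi.sub_apply, map_sub, _root_.sub_apply]
    _ ≤ ‖B‖ * ∫ x, ‖(f - f' : X → E) x‖ ∂_ := norm_integral_bilin_le hg B (hf.sub hf')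
    _ = ‖B‖ * ∫ x, ‖(f - f') x‖ ∂_ := by
        congr 1
        exact integral_congr_ae ((Lp.coeFn_sub f f').symm.fun_comp norm)

theorem integral_eq_of_density [CompleteSpace F] [CompleteSpace G] (hg : Integrable g μ)
    (hη : ∀ A, MeasurableSet A → η A = ∫ x in A, g x ∂μ) (B : E →L[ℝ] F →L[ℝ] G) {f : X → E}
    (hf : η.Integrable f) : η.integral f B = ∫ x, B (f x) (g x) ∂μ := by
  have hν := variation_eq_withDensity hg hη
  have hbilin : ∀ f : X → E, η.Integrable f → Integrable (fun x => B (f x) (g x)) μ :=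
    fun f hf => integrable_bilin hg.1 B (hν ▸ hf)
  refine hf.induction (P := fun f => η.integral f B = ∫ x, B (f x) (g x) ∂μ) ?_ ?_ ?_ ?_
  · intro c s hs hc
    have : IsFiniteMeasure (η.variation.restrict s) := ⟨by simpa⟩
    rw [VectorMeasure.integral_indicator_const _ hs, hη s hs,
      ← (B c).integral_comp_comm hg.integrableOn, ← integral_indicator hs]
    refine integral_congr_ae (Eventually.of_forall fun x => ?_)
    by_cases hx : x ∈ s <;> simp [hx]
  · intro f f' _ hf hf' h h'
    rw [VectorMeasure.integral_add hf hf', h, h', ← integral_add (hbilin f hf) (hbilin f' hf')]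
    simp only [Pi.add_apply, map_add, _root_.add_apply]
  · refine isClosed_eq VectorMeasure.continuous_integral ?_
    have hcont : ∀ ν, ν = μ.withDensity (fun x => ‖g x‖ₑ) →
        Continuous fun f : X →₁[ν] E => ∫ x, B (f x) (g x) ∂μ := by
      rintro _ rfl
      exact continuous_integral_bilin hg.1 B
    exact hcont _ hν
  · intro f f' hff' _ h
    rw [← VectorMeasure.integral_congr_ae hff', h]
    exact integral_congr_ae (bilin_congr_ae hg.1 B (hν ▸ hff'))

end Density

section HilbertDensity

variable {X : Type*} [MeasurableSpace X]
  {H : Type*} [NormedAddCommGroup H] [InnerProductSpace ℂ H] {η : VectorMeasure X H}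

theorem bartleIntegral_smul {f : X → H} (hf : η.Integrable f) (c : ℂ) :
    bartleIntegral η (fun x => c • f x) = c * bartleIntegral η f := by
  have hpre := VectorMeasure.integral_continuousLinearMap_comp (B := pairing H)
    (C := (c • ContinuousLinearMap.id ℂ H).restrictScalars ℝ) hf
  have hpost := VectorMeasure.continuousLinearMap_apply_integral (B := pairing H)
    (C := (ContinuousLinearMap.mul ℂ ℂ c).restrictScalars ℝ) hf
  have hcomm : (ContinuousLinearMap.compL ℝ H ℂ ℂ
      ((ContinuousLinearMap.mul ℂ ℂ c).restrictScalars ℝ)) ∘L pairing H =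
      pairing H ∘L (c • ContinuousLinearMap.id ℂ H).restrictScalars ℝ := by
    ext u v
    simp [pairing_apply]
  rw [hcomm, ← hpre] at hpost
  exact hpost.symm

theorem bartleIntegral_indicator_const [IsFiniteMeasure η.variation] {A : Set X}
    (hA : MeasurableSet A) (v : H) :
    bartleIntegral η (A.indicator fun _ => v) = inner ℂ (η A) v := by
  rw [bartleIntegral, VectorMeasure.integral_indicator_const _ hA, pairing_apply]

theorem integral_norm_le_mul_norm_L2 {V : Type*} [NormedAddCommGroup V] {ν : Measure X}
    [IsFiniteMeasure ν] (f : Lp V 2 ν) : ∫ x, ‖f x‖ ∂ν ≤ √(ν.real Set.univ) * ‖f‖ := by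
  have hle := eLpNorm_le_eLpNorm_mul_rpow_measure_univ (μ := ν) (p := 1) (q := 2) (by norm_num)
    (Lp.aestronglyMeasurable f)
  rw [eLpNorm_one_eq_lintegral_enorm] at hle
  have hexp : (1 / (1 : ENNReal).toReal - 1 / (2 : ENNReal).toReal) = 1 / 2 := by norm_num
  rw [hexp] at hle
  rw [integral_norm_eq_lintegral_enorm (Lp.aestronglyMeasurable f), Lp.norm_def, mul_comm,
    Real.sqrt_eq_rpow, measureReal_def, ENNReal.toReal_rpow, ← ENNReal.toReal_mul]
  exact ENNReal.toReal_mono (ENNReal.mul_ne_top (Lp.eLpNorm_ne_top f) (by finiteness)) hle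

theorem exists_clm_L2_eq_bartleIntegral (η : VectorMeasure X H) [IsFiniteMeasure η.variation] :
    ∃ L : Lp H 2 η.variation →L[ℂ] ℂ, ∀ f, L f = bartleIntegral η f := by
  have hint : ∀ f : Lp H 2 η.variation, η.Integrable f := fun f =>
    (Lp.memLp f).integrable (by norm_num)
  let L : Lp H 2 η.variation →ₗ[ℂ] ℂ :=
    { toFun := fun f => bartleIntegral η f
      map_add' := fun f f' => by
        rw [bartleIntegral, VectorMeasure.integral_congr_ae (Lp.coeFn_add f f'),
          VectorMeasure.integral_add (hint f) (hint f')]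
        rfl
      map_smul' := fun c f => by
        rw [bartleIntegral, VectorMeasure.integral_congr_ae (Lp.coeFn_smul c f)]
        exact bartleIntegral_smul (hint f) c }
  refine ⟨L.mkContinuous (‖pairing H‖ * √(η.variation.real Set.univ)) fun f => ?_, fun f => rfl⟩
  calc ‖bartleIntegral η f‖ ≤ ‖pairing H‖ * ∫ x, ‖f x‖ ∂η.variation :=
        VectorMeasure.norm_integral_le_integral_norm
    _ ≤ ‖pairing H‖ * (√(η.variation.real Set.univ) * ‖f‖) := by
        gcongr
        exact integral_norm_le_mul_norm_L2 f
    _ = _ := (mul_assoc _ _ _).symm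

/-- The density is the Riesz vector in `L²(|η|)` of the functional `f ↦ ∫ ⟨f, dη⟩`. -/
theorem exists_density [CompleteSpace H] (η : VectorMeasure X H) [IsFiniteMeasure η.variation] :
    ∃ g : X → H, StronglyMeasurable g ∧ Integrable g η.variation ∧
      ∀ A, MeasurableSet A → η A = ∫ x in A, g x ∂η.variation := by
  obtain ⟨L, hL⟩ := exists_clm_L2_eq_bartleIntegral η
  let g : Lp H 2 η.variation := (InnerProductSpace.toDual ℂ _).symm L
  refine ⟨g, Lp.stronglyMeasurable g, (Lp.memLp g).integrable (by norm_num),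
    fun A hA => ext_inner_left ℂ fun v => ?_⟩
  rw [← L2.inner_indicatorConstLp_eq_inner_setIntegral ℂ hA v g (hμs := measure_ne_top _ _),
    ← inner_conj_symm (indicatorConstLp _ _ _ _) g, InnerProductSpace.toDual_symm_apply, hL,
    bartleIntegral, VectorMeasure.integral_congr_ae indicatorConstLp_coeFn, ← bartleIntegral,
    bartleIntegral_indicator_const hA, inner_conj_symm]

theorem bartleIntegral_eq [CompleteSpace H] {μ : Measure X} {g : X → H} (hg : Integrable g μ)
    (hη : ∀ A, MeasurableSet A → η A = ∫ x in A, g x ∂μ) {f : X → H} (hf : η.Integrable f) :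
    bartleIntegral η f = ∫ x, inner ℂ (g x) (f x) ∂μ :=
  integral_eq_of_density hg hη (pairing H) hf

end HilbertDensity

section WeakBochner

variable {X : Type*} [MeasurableSpace X] {H : Type*} [NormedAddCommGroup H] [InnerProductSpace ℂ H]

theorem IsWeakBochnerIntegral.weakBochnerIntegral_eq {η : VectorMeasure X H}
    {T : X → H →L[ℂ] H} {u : H}
    (h : IsWeakBochnerIntegral η T u) : weakBochnerIntegral η T = u := by
  have hex : ∃ u, IsWeakBochnerIntegral η T u := ⟨u, h⟩
  rw [weakBochnerIntegral, dif_pos hex]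
  exact ext_inner_right ℂ fun v => (hex.choose_spec.2 v).trans (h.2 v).symm

end WeakBochner

/-! ### Functionals of bounded continuous functions -/

section BoundedFunctions

open ContinuousLinearMap (adjoint)
variable {X : Type*} [TopologicalSpace X]
  {H : Type*} [NormedAddCommGroup H] [InnerProductSpace ℂ H]

theorem exists_clm_adjoint_apply [CompleteSpace H] {E : Type*} [NormedAddCommGroup E]
    [InnerProductSpace ℂ E] [CompleteSpace E] (Ψ : X →ᵇ (H →L[ℂ] E)) :
    ∃ T : E →L[ℂ] (X →ᵇ H), ∀ u x, T u x = adjoint (Ψ x) u := by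
  have hbound : ∀ u x, ‖adjoint (Ψ x) u‖ ≤ ‖Ψ‖ * ‖u‖ := fun u x => by
    refine (adjoint (Ψ x)).le_of_opNorm_le ?_ u
    rw [LinearIsometryEquiv.norm_map]
    exact Ψ.norm_coe_le_norm x
  have hcont : ∀ u, Continuous fun x => adjoint (Ψ x) u := fun u =>
    (adjoint.continuous.comp Ψ.continuous).clm_apply continuous_const
  let T : E →ₗ[ℂ] (X →ᵇ H) :=
    { toFun := fun u => .ofNormedAddCommGroup _ (hcont u) _ (hbound u)
      map_add' := fun u v => by ext x; simp
      map_smul' := fun c u => by ext x; simp }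
  exact ⟨T.mkContinuous ‖Ψ‖ fun u => (BoundedContinuousFunction.norm_le (by positivity)).2
    (hbound u), fun u x => rfl⟩

variable [MeasurableSpace X] [OpensMeasurableSpace X] [SecondCountableTopology X]

theorem integrable_boundedContinuous {V : Type*} [NormedAddCommGroup V] (η : VectorMeasure X V)
    [IsFiniteMeasure η.variation] (F : X →ᵇ V) : η.Integrable F :=
  Integrable.of_bound F.continuous.stronglyMeasurable.aestronglyMeasurable ‖F‖
    (Eventually.of_forall F.norm_coe_le_norm)

variable (η : VectorMeasure X H) [IsFiniteMeasure η.variation]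

theorem exists_clm_eq_bartleIntegral :
    ∃ L : (X →ᵇ H) →L[ℂ] ℂ, ∀ F, L F = bartleIntegral η F := by
  let L : (X →ᵇ H) →ₗ[ℂ] ℂ :=
    { toFun := fun F => bartleIntegral η F
      map_add' := fun F F' => VectorMeasure.integral_add (integrable_boundedContinuous η F)
        (integrable_boundedContinuous η F')
      map_smul' := fun c F => bartleIntegral_smul (integrable_boundedContinuous η F) c }
  refine ⟨L.mkContinuous (‖pairing H‖ * η.variation.real Set.univ) fun F => ?_, fun F => rfl⟩
  calc ‖bartleIntegral η F‖ ≤ ‖pairing H‖ * ∫ x, ‖F x‖ ∂η.variation :=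
        VectorMeasure.norm_integral_le_integral_norm
    _ ≤ ‖pairing H‖ * ∫ _, ‖F‖ ∂η.variation := by
        gcongr ‖pairing H‖ * ?_
        exact integral_mono (integrable_boundedContinuous η F).norm (integrable_const _)
          F.norm_coe_le_norm
    _ = _ := by rw [integral_const, smul_eq_mul, mul_assoc]

variable [CompleteSpace H] {E : Type*} [NormedAddCommGroup E] [InnerProductSpace ℂ E]
  [CompleteSpace E]

theorem exists_inner_eq_bartleIntegral (Ψ : X →ᵇ (H →L[ℂ] E)) :
    ∃ Z : E, ∀ u, inner ℂ Z u = bartleIntegral η fun x => adjoint (Ψ x) u := by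
  obtain ⟨L, hL⟩ := exists_clm_eq_bartleIntegral η
  obtain ⟨T, hT⟩ := exists_clm_adjoint_apply Ψ
  refine ⟨(InnerProductSpace.toDual ℂ E).symm (L ∘L T), fun u => ?_⟩
  rw [InnerProductSpace.toDual_symm_apply, ContinuousLinearMap.comp_apply, hL, funext (hT u)]

variable {η} in
theorem weakBochnerIntegral_adjoint_comp {Ψ : X →ᵇ (H →L[ℂ] E)} {Z : E}
    (hZ : ∀ u, inner ℂ Z u = bartleIntegral η fun x => adjoint (Ψ x) u) (S : H →L[ℂ] E) :
    weakBochnerIntegral η (fun x => adjoint (Ψ x) ∘L S) = adjoint S Z := by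
  obtain ⟨T, hT⟩ := exists_clm_adjoint_apply Ψ
  refine IsWeakBochnerIntegral.weakBochnerIntegral_eq ⟨fun v => ?_, fun v => ?_⟩
  · simpa only [funext (hT (S v))] using! integrable_boundedContinuous η (T (S v))
  · rw [ContinuousLinearMap.adjoint_inner_left, hZ]
    rfl

end BoundedFunctions

section Energy

open ContinuousLinearMap (adjoint)
variable {m q : ℕ} {U : Opens (EuclideanSpace ℝ (Fin m))}
  {H : Type*} [NormedAddCommGroup H] [InnerProductSpace ℂ H] [CompleteSpace H]
  {K : U → U → H →L[ℂ] H} {η : (Fin m → ℕ) → VectorMeasure U H}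

theorem energy_eq_inner_sum {E : Type*} [NormedAddCommGroup E] [InnerProductSpace ℂ E]
    [CompleteSpace E] {Ψ : (Fin m → ℕ) → U →ᵇ (H →L[ℂ] E)} {Z : (Fin m → ℕ) → E}
    (hη : ∀ α ∈ multiIndices m q, IsFiniteMeasure (η α).variation)
    (hΨ : ∀ α ∈ multiIndices m q, ∀ β ∈ multiIndices m q, ∀ x y,
      mixedDeriv α β K x y = adjoint (Ψ α x) ∘L Ψ β y)
    (hZ : ∀ α ∈ multiIndices m q, ∀ u,
      inner ℂ (Z α) u = bartleIntegral (η α) fun x => adjoint (Ψ α x) u) :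
    energy q K η = inner ℂ (∑ α ∈ multiIndices m q, Z α) (∑ α ∈ multiIndices m q, Z α) := by
  rw [energy, inner_sum]
  refine Finset.sum_congr rfl fun α hα => ?_
  rw [sum_inner]
  refine Finset.sum_congr rfl fun β hβ => ?_
  have := hη α hα
  simp only [hΨ α hα β hβ, weakBochnerIntegral_adjoint_comp (hZ α hα)]
  exact (hZ β hβ _).symm

/-- The energy is the squared norm of the vector of the reproducing kernel Hilbert space which
represents the functional `f ↦ ∑ ∫ ⟨∂^α f, dη_α⟩`. -/
theorem energy_eq_zero_iff (hK : IsPosDef K) (hq : IsCqq q K)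
    (hb : ∀ α ∈ multiIndices m q, ∃ M : ℝ, ∀ x, ‖mixedDeriv α α K x x‖ ≤ M)
    (hη : ∀ α ∈ multiIndices m q, IsFiniteMeasure (η α).variation) :
    energy q K η = 0 ↔ ∀ f ∈ rkhs K,
      ∑ α ∈ multiIndices m q, bartleIntegral (η α) (multiDeriv α f) = 0 := by
  obtain ⟨E, _, _, _, Φ, hΦK, -⟩ := hK.exists_features
  have hΦ : IsCq q Φ := isCq_of_factor hq hΦK
  have hΨ : ∀ α ∈ multiIndices m q, ∃ Ψ : U →ᵇ (H →L[ℂ] E), ∀ x, Ψ x = multiDeriv α Φ x := by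
    intro α hα
    obtain ⟨M, hM⟩ := hb α hα
    exact ⟨.ofNormedAddCommGroup _ (hΦ.continuous_multiDeriv hα) _ fun x =>
      norm_multiDeriv_features_le hΦ hΦK hα (hM x), fun x => rfl⟩
  choose! Ψ hΨ using hΨ
  have hZ : ∀ α ∈ multiIndices m q, ∃ Z : E, ∀ u,
      inner ℂ Z u = bartleIntegral (η α) fun x => adjoint (Ψ α x) u := fun α hα =>
    have := hη α hα
    exists_inner_eq_bartleIntegral (η α) (Ψ α)
  choose! Z hZ using hZ
  have hfunctional : ∀ u : E, ∑ α ∈ multiIndices m q,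
      bartleIntegral (η α) (multiDeriv α fun x => adjoint (Φ x) u) =
        inner ℂ (∑ α ∈ multiIndices m q, Z α) u := by
    intro u
    rw [sum_inner]
    refine Finset.sum_congr rfl fun α hα => ?_
    rw [hZ α hα, funext (multiDeriv_adjoint_apply hΦ hα u)]
    simp only [hΨ α hα]
  rw [energy_eq_inner_sum hη (fun α hα β hβ x y => by
    rw [hΨ α hα, hΨ β hβ, mixedDeriv_of_factor hΦ hΦK hα hβ]) hZ, inner_self_eq_zero]
  constructor
  · intro h f hf
    obtain ⟨u, hu⟩ := (mem_rkhs_iff hΦK).1 hf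
    rw [funext hu, hfunctional, h, inner_zero_left]
  · intro h
    rw [← inner_self_eq_zero (𝕜 := ℂ), ← hfunctional]
    exact h _ ((mem_rkhs_iff hΦK).2 ⟨_, fun x => rfl⟩)

end Energy

/-! ### Jets of functions in the reproducing kernel Hilbert space -/

section JetSpaces

open ContinuousLinearMap (adjoint)
variable {m q : ℕ} {U : Opens (EuclideanSpace ℝ (Fin m))}

/-- The index set of the derivatives of order at most `q` at the points of `A`. The bounded
continuous functions on it, with the sup norm, are the space of jets on `A`. -/
abbrev JetIndex (q : ℕ) (A : Set U) : Type := {α : Fin m → ℕ // α ∈ multiIndices m q} × A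

section Normed

variable {V : Type*} [NormedAddCommGroup V] [NormedSpace ℝ V] {A : Set U}

/-- `F` is the jet of `f` on `A`, that is the family of the derivatives of order at most `q` of `f`
at the points of `A`. -/
def IsJetOf (F : JetIndex q A →ᵇ V) (f : U → V) : Prop :=
  ∀ d, F d = multiDeriv d.1.1 f d.2.1

theorem IsJetOf.unique {F F' : JetIndex q A →ᵇ V} {f : U → V} (h : IsJetOf F f)
    (h' : IsJetOf F' f) : F = F' :=
  BoundedContinuousFunction.ext fun d => (h d).trans (h' d).symm

theorem exists_isJetOf {f : U → V} (hf : IsCq q f)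
    (hb : ∀ α ∈ multiIndices m q, ∃ C, ∀ x ∈ A, ‖multiDeriv α f x‖ ≤ C) :
    ∃ F : JetIndex q A →ᵇ V, IsJetOf F f := by
  choose! C hC using hb
  have hcont : Continuous fun d : JetIndex q A => multiDeriv d.1.1 f d.2.1 :=
    continuous_prod_of_discrete_left.2 fun α =>
      (hf.continuous_multiDeriv α.2).comp continuous_subtype_val
  refine ⟨.ofNormedAddCommGroup _ hcont (∑ α ∈ multiIndices m q, |C α|) fun d => ?_, fun d => rfl⟩
  calc ‖multiDeriv d.1.1 f d.2.1‖ ≤ |C d.1.1| := (hC _ d.1.2 _ d.2.2).trans (le_abs_self _)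
    _ ≤ ∑ α ∈ multiIndices m q, |C α| :=
      Finset.single_le_sum (f := fun α => |C α|) (fun α _ => abs_nonneg _) d.1.2

theorem exists_isJetOf_of_isCompact (hA : IsCompact A) {f : U → V} (hf : IsCq q f) :
    ∃ F : JetIndex q A →ᵇ V, IsJetOf F f :=
  exists_isJetOf hf fun _ hα =>
    hA.exists_bound_of_continuousOn (hf.continuous_multiDeriv hα).continuousOn

end Normed

variable {H : Type*} [NormedAddCommGroup H] [InnerProductSpace ℂ H] [CompleteSpace H] {A : Set U}
  {K : U → U → H →L[ℂ] H}

theorem exists_jetMap_of_factor {E : Type*} [NormedAddCommGroup E] [InnerProductSpace ℂ E]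
    [CompleteSpace E] {Φ : U → H →L[ℂ] E} (hq : IsCqq q K)
    (hΦ : ∀ x y, K x y = adjoint (Φ x) ∘L Φ y)
    (hb : ∀ α ∈ multiIndices m q, ∃ M, ∀ x ∈ A, ‖mixedDeriv α α K x x‖ ≤ M) :
    ∃ T : E →L[ℂ] (JetIndex q A →ᵇ H), ∀ u, IsJetOf (T u) fun x => adjoint (Φ x) u := by
  have hΦq : IsCq q Φ := isCq_of_factor hq hΦ
  obtain ⟨Ψ, hΨ⟩ := exists_isJetOf hΦq (A := A) fun α hα => by
    obtain ⟨M, hM⟩ := hb α hα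
    exact ⟨√M, fun x hx => norm_multiDeriv_features_le hΦq hΦ hα (hM x hx)⟩
  obtain ⟨T, hT⟩ := exists_clm_adjoint_apply Ψ
  exact ⟨T, fun u d => by rw [hT, hΨ, multiDeriv_adjoint_apply hΦq d.1.2]⟩

theorem exists_isJetOf_of_mem_rkhs (hK : IsPosDef K) (hq : IsCqq q K)
    (hb : ∀ α ∈ multiIndices m q, ∃ M, ∀ x ∈ A, ‖mixedDeriv α α K x x‖ ≤ M) {f : U → H}
    (hf : f ∈ rkhs K) : ∃ F : JetIndex q A →ᵇ H, IsJetOf F f := by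
  obtain ⟨E, _, _, _, Φ, hΦ, -⟩ := hK.exists_features
  obtain ⟨T, hT⟩ := exists_jetMap_of_factor hq hΦ hb
  obtain ⟨u, hu⟩ := (mem_rkhs_iff hΦ).1 hf
  exact ⟨T u, funext hu ▸ hT u⟩

/-- The functional is represented by a vector of the feature space; as a function, this vector is
continuous, hence it vanishes if it is orthogonal to a dense set of kernel sections. -/
theorem jet_functional_eq_zero (hK : IsPosDef K) (hq : IsCqq q K)
    (hb : ∀ α ∈ multiIndices m q, ∃ M, ∀ x ∈ A, ‖mixedDeriv α α K x x‖ ≤ M)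
    (L : (JetIndex q A →ᵇ H) →L[ℂ] ℂ) {D : Set U} (hD : Dense D)
    (hsec : ∀ y ∈ D, ∀ v, ∀ F : JetIndex q A →ᵇ H, IsJetOf F (fun x => K x y v) → L F = 0)
    {f : U → H} (hf : f ∈ rkhs K) {F : JetIndex q A →ᵇ H} (hF : IsJetOf F f) : L F = 0 := by
  obtain ⟨E, _, _, _, Φ, hΦ, htotal⟩ := hK.exists_features
  obtain ⟨T, hT⟩ := exists_jetMap_of_factor hq hΦ hb
  set Z := (InnerProductSpace.toDual ℂ E).symm (L ∘L T) with hZ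
  have hLT : ∀ u, L (T u) = inner ℂ Z u := fun u => by
    rw [hZ, InnerProductSpace.toDual_symm_apply, ContinuousLinearMap.comp_apply]
  have hZD : Set.EqOn (fun x => adjoint (Φ x) Z) (fun _ => 0) D := fun y hy =>
    ext_inner_right ℂ fun v => by
      rw [ContinuousLinearMap.adjoint_inner_left, inner_zero_left, ← hLT]
      refine hsec y hy v _ ?_
      simp only [hΦ]
      exact hT _
  have hcont : Continuous fun x => adjoint (Φ x) Z :=
    (isCq_adjoint_apply (isCq_of_factor hq hΦ) Z).continuous
  have hZ0 : Z = 0 := htotal Z (congrFun (hcont.ext_on hD continuous_const hZD))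
  obtain ⟨u, hu⟩ := (mem_rkhs_iff hΦ).1 hf
  rw [hF.unique (funext hu ▸ hT u), hLT, hZ0, inner_zero_left]

end JetSpaces

/-! ### Integrals of positive definite kernels -/

section PositiveKernels

open ContinuousLinearMap (adjoint)

variable {X : Type*} {H : Type*} [NormedAddCommGroup H] [InnerProductSpace ℂ H] [CompleteSpace H]

theorem rkhs_subset_add {K₁ K₂ : X → X → H →L[ℂ] H} (h₁ : IsPosDef K₁) (h₂ : IsPosDef K₂) :
    rkhs K₁ ⊆ rkhs fun x y => K₁ x y + K₂ x y := by
  obtain ⟨E₁, _, _, _, Φ₁, hΦ₁, -⟩ := h₁.exists_features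
  obtain ⟨E₂, _, _, _, Φ₂, hΦ₂, -⟩ := h₂.exists_features
  let Φ : X → H →L[ℂ] WithLp 2 (E₁ × E₂) := fun x =>
    (WithLp.prodContinuousLinearEquiv 2 ℂ E₁ E₂).symm.toContinuousLinearMap ∘L (Φ₁ x).prod (Φ₂ x)
  have hΦ : ∀ x y, K₁ x y + K₂ x y = adjoint (Φ x) ∘L Φ y := fun x y =>
    ContinuousLinearMap.ext fun v => ext_inner_left ℂ fun w => by
      rw [ContinuousLinearMap.comp_apply, ContinuousLinearMap.adjoint_inner_right,
        _root_.add_apply, inner_add_right, hΦ₁, hΦ₂, WithLp.prod_inner_apply]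
      simp [Φ, ContinuousLinearMap.adjoint_inner_right]
  intro f hf
  obtain ⟨u, hu⟩ := (mem_rkhs_iff hΦ₁).1 hf
  refine (mem_rkhs_iff hΦ).2 ⟨WithLp.toLp 2 (u, 0), fun x => ext_inner_left ℂ fun w => ?_⟩
  rw [hu, ContinuousLinearMap.adjoint_inner_right, ContinuousLinearMap.adjoint_inner_right,
    WithLp.prod_inner_apply]
  simp [Φ]

universe u in
theorem IsPosDef.exists_gram {X : Type u} {k : X → X → ℂ} (hk : IsPosDef (scalarKernel k)) :
    ∃ (E : Type u) (_ : NormedAddCommGroup E) (_ : InnerProductSpace ℂ E) (φ : X → E),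
      ∀ x y, k x y = inner ℂ (φ x) (φ y) := by
  obtain ⟨E, _, _, _, Φ, hΦ, -⟩ := hk.exists_features
  refine ⟨E, inferInstance, inferInstance, fun x => Φ x 1, fun x y => ?_⟩
  rw [← ContinuousLinearMap.adjoint_inner_right, ← ContinuousLinearMap.comp_apply, ← hΦ]
  simp [scalarKernel]

theorem exists_inner_eq_of_isPositive {T : H →L[ℂ] H} (hT : T.IsPositive) :
    ∃ S : H →L[ℂ] H, ∀ a b, inner ℂ a (T b) = inner ℂ (S a) (S b) := by
  obtain ⟨S, hS⟩ := CStarAlgebra.nonneg_iff_eq_star_mul_self.1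
    ((ContinuousLinearMap.nonneg_iff_isPositive T).2 hT)
  refine ⟨S, fun a b => ?_⟩
  rw [hS, ContinuousLinearMap.star_eq_adjoint, mul_apply_eq_comp,
    ContinuousLinearMap.adjoint_inner_right]

open scoped ComplexOrder in
open Matrix in
/-- The quadratic form of the product is the sum of the entries of the Hadamard product of two
Gram matrices. -/
theorem isPosDef_smul_of_isPositive {k : X → X → ℂ} (hk : IsPosDef (scalarKernel k))
    {T : H →L[ℂ] H} (hT : T.IsPositive) : IsPosDef fun x y => k x y • T := by
  obtain ⟨E, _, _, φ, hφ⟩ := hk.exists_gram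
  obtain ⟨S, hS⟩ := exists_inner_eq_of_isPositive hT
  refine (isPosDef_iff _).2 fun v => ?_
  have hgram := ((posSemidef_gram ℂ fun x : v.support => φ x).hadamard
    (posSemidef_gram ℂ fun x : v.support => S (v x))).dotProduct_mulVec_nonneg 1
  refine hgram.trans_eq ?_
  simp only [Finsupp.sum, ← Finset.sum_coe_sort v.support, dotProduct, mulVec, Pi.star_apply,
    Pi.one_apply, star_one, one_mul, mul_one, hadamard_apply, gram_apply, _root_.smul_apply,
    inner_smul_right, hφ, hS]

end PositiveKernels

section DensityKernel

variable {m q : ℕ} {U : Opens (EuclideanSpace ℝ (Fin m))}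

theorem IsCzqq.continuous_mixedDeriv {Ω : Type*} [TopologicalSpace Ω] {V : Type*}
    [NormedAddCommGroup V] [NormedSpace ℝ V] {p : Ω → U → U → V} (h : IsCzqq q p)
    {α β : Fin m → ℕ} (hα : α ∈ multiIndices m q) (hβ : β ∈ multiIndices m q) (x y : U) :
    Continuous fun w => mixedDeriv α β (p w) x y :=
  (h.2 α hα β hβ).comp (Continuous.prodMk_left (x, y))

variable {Ω : Type*} [MeasurableSpace Ω] {H : Type*} [NormedAddCommGroup H] [InnerProductSpace ℂ H]

/-- The kernel `∫ p_w(x, y) G(w) dν(w)`, which is the kernel `P` of the operator valued measure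
`G dν`. -/
noncomputable def densityKernel (p : Ω → U → U → ℂ) (G : Ω → H →L[ℂ] H) (ν : Measure Ω) :
    U → U → H →L[ℂ] H :=
  fun x y => ∫ w, p w x y • G w ∂ν

variable [TopologicalSpace Ω]

/-- Conditions under which the kernel `∫ p_w G(w) dν(w)` is positive definite, of class `C^{q,q}`
and has bounded derivatives. The bound `b` of the derivatives of `p_w` only has to be integrable
with respect to `‖G‖ dν`. -/
structure IsAdmissible (q : ℕ) (p : Ω → U → U → ℂ) (b : Ω → ℝ) (G : Ω → H →L[ℂ] H)
    (ν : Measure Ω) : Prop where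
  cont : IsCzqq q p
  posDef : ∀ w, IsPosDef (scalarKernel (p w))
  bound : ∀ α ∈ multiIndices m q, ∀ β ∈ multiIndices m q, ∀ w x y, ‖mixedDeriv α β (p w) x y‖ ≤ b w
  meas : AEStronglyMeasurable G ν
  pos : ∀ᵐ w ∂ν, (G w).IsPositive
  int : Integrable (fun w => b w * ‖G w‖) ν

namespace IsAdmissible

variable {p : Ω → U → U → ℂ} {b : Ω → ℝ} {G : Ω → H →L[ℂ] H} {ν : Measure Ω} {α β : Fin m → ℕ}

theorem restrict (h : IsAdmissible q p b G ν) (B : Set Ω) :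
    IsAdmissible q p b G (ν.restrict B) where
  cont := h.cont
  posDef := h.posDef
  bound := h.bound
  meas := h.meas.restrict
  pos := ae_restrict_of_ae h.pos
  int := h.int.restrict

theorem norm_le (h : IsAdmissible q p b G ν) (hα : α ∈ multiIndices m q)
    (hβ : β ∈ multiIndices m q) (w : Ω) (x y : U) :
    ‖mixedDeriv α β (p w) x y • G w‖ ≤ b w * ‖G w‖ := by
  rw [norm_smul]
  gcongr
  exact h.bound α hα β hβ w x y

variable [OpensMeasurableSpace Ω]

theorem aestronglyMeasurable (h : IsAdmissible q p b G ν) (hα : α ∈ multiIndices m q)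
    (hβ : β ∈ multiIndices m q) (x y : U) :
    AEStronglyMeasurable (fun w => mixedDeriv α β (p w) x y • G w) ν :=
  (h.cont.continuous_mixedDeriv hα hβ x y).measurable.aestronglyMeasurable.smul h.meas

theorem integrable (h : IsAdmissible q p b G ν) (hα : α ∈ multiIndices m q)
    (hβ : β ∈ multiIndices m q) (x y : U) :
    Integrable (fun w => mixedDeriv α β (p w) x y • G w) ν :=
  h.int.mono' (h.aestronglyMeasurable hα hβ x y) (Eventually.of_forall fun w =>
    h.norm_le hα hβ w x y)

theorem integrable_smul (h : IsAdmissible q p b G ν) (x y : U) :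
    Integrable (fun w => p w x y • G w) ν := by
  simpa only [mixedDeriv_zero] using
    h.integrable (zero_mem_multiIndices m q) (zero_mem_multiIndices m q) x y

theorem isCqq_and_mixedDeriv (h : IsAdmissible q p b G ν) :
    IsCqq q (densityKernel p G ν) ∧ ∀ α ∈ multiIndices m q, ∀ β ∈ multiIndices m q, ∀ x y,
      mixedDeriv α β (densityKernel p G ν) x y = ∫ w, mixedDeriv α β (p w) x y • G w ∂ν := by
  have h₀ := zero_mem_multiIndices m q
  let S : Ω → ℂ →L[ℝ] H →L[ℂ] H := fun w =>
    (ContinuousLinearMap.toSpanSingleton ℂ (G w)).restrictScalars ℝ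
  have hjets := isCqq_of_jets (q := q)
    (J := fun α β x y => ∫ w, mixedDeriv α β (p w) x y • G w ∂ν)
    (fun x => isJet_integral (J := fun w β y => mixedDeriv 0 β (p w) x y • G w)
      (fun w => ((h.cont.1 w).isJet_right h₀ x).comp_clm (S w))
      (fun β hβ y => h.aestronglyMeasurable h₀ (mem_multiIndices.2 hβ) x y)
      (fun β hβ w y => h.norm_le h₀ (mem_multiIndices.2 hβ) w x y) h.int)
    (fun β hβ y => isJet_integral (J := fun w α x => mixedDeriv α β (p w) x y • G w)
      (fun w => ((h.cont.1 w).isJet_left hβ y).comp_clm (S w))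
      (fun α hα x => h.aestronglyMeasurable (mem_multiIndices.2 hα) hβ x y)
      (fun α hα w x => h.norm_le (mem_multiIndices.2 hα) hβ w x y) h.int)
    (fun α hα β hβ => continuous_of_dominated
      (fun z => h.aestronglyMeasurable hα hβ z.1 z.2)
      (fun z => Eventually.of_forall fun w => h.norm_le hα hβ w z.1 z.2) h.int
      (Eventually.of_forall fun w => ((h.cont.1 w).2.2 α hα β hβ).smul continuous_const))
  simpa only [mixedDeriv_zero] using! hjets

theorem isCqq (h : IsAdmissible q p b G ν) : IsCqq q (densityKernel p G ν) :=
  h.isCqq_and_mixedDeriv.1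

theorem mixedDeriv_eq (h : IsAdmissible q p b G ν) (hα : α ∈ multiIndices m q)
    (hβ : β ∈ multiIndices m q) (x y : U) :
    mixedDeriv α β (densityKernel p G ν) x y = ∫ w, mixedDeriv α β (p w) x y • G w ∂ν :=
  h.isCqq_and_mixedDeriv.2 α hα β hβ x y

theorem exists_bound (h : IsAdmissible q p b G ν) (hα : α ∈ multiIndices m q)
    (hβ : β ∈ multiIndices m q) :
    ∃ M, ∀ x y, ‖mixedDeriv α β (densityKernel p G ν) x y‖ ≤ M := by
  refine ⟨∫ w, b w * ‖G w‖ ∂ν, fun x y => ?_⟩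
  rw [h.mixedDeriv_eq hα hβ]
  exact norm_integral_le_of_norm_le h.int (Eventually.of_forall fun w => h.norm_le hα hβ w x y)

theorem multiDeriv_section (h : IsAdmissible q p b G ν) (hα : α ∈ multiIndices m q) (x y : U)
    (v : H) :
    multiDeriv α (fun x => densityKernel p G ν x y v) x =
      ∫ w, mixedDeriv α 0 (p w) x y • G w v ∂ν := by
  have h₀ := zero_mem_multiIndices m q
  have heval := (h.isCqq.isJet_left h₀ y).isCq.multiDeriv_comp_clm
    ((ContinuousLinearMap.apply ℂ H v).restrictScalars ℝ) hα x
  simp only [mixedDeriv_zero, ← mixedDeriv_zero_right] at heval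
  refine heval.trans ?_
  rw [h.mixedDeriv_eq hα h₀]
  exact ContinuousLinearMap.integral_apply (h.integrable hα h₀ x y) v

variable [CompleteSpace H]

open scoped ComplexOrder in
theorem isPosDef (h : IsAdmissible q p b G ν) : IsPosDef (densityKernel p G ν) := by
  have hcomm : ∀ x y (a b : H), Integrable (fun w => inner ℂ a ((p w x y • G w) b)) ν ∧
      ∫ w, inner ℂ a ((p w x y • G w) b) ∂ν = inner ℂ a (densityKernel p G ν x y b) :=
    fun x y a b =>
      let L := (innerSL ℂ a).comp (ContinuousLinearMap.apply ℂ H b)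
      ⟨L.integrable_comp (h.integrable_smul x y), L.integral_comp_comm (h.integrable_smul x y)⟩
  refine (isPosDef_iff _).2 fun v => ?_
  have hsum : (v.sum fun x a => v.sum fun y b => inner ℂ a (densityKernel p G ν x y b)) =
      ∫ w, v.sum fun x a => v.sum fun y b => inner ℂ a ((p w x y • G w) b) ∂ν := by
    simp only [Finsupp.sum]
    rw [integral_finsetSum _ fun x _ => integrable_finsetSum _ fun y _ => (hcomm _ _ _ _).1]
    refine Finset.sum_congr rfl fun x _ => ?_
    rw [integral_finsetSum _ fun y _ => (hcomm _ _ _ _).1]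
    exact Finset.sum_congr rfl fun y _ => (hcomm _ _ _ _).2.symm
  rw [hsum]
  refine integral_nonneg_of_ae ?_
  filter_upwards [h.pos] with w hw
  exact (isPosDef_iff _).1 (isPosDef_smul_of_isPositive (h.posDef w) hw) v

theorem rkhs_restrict_subset (h : IsAdmissible q p b G ν) {B : Set Ω} (hB : MeasurableSet B) :
    rkhs (densityKernel p G (ν.restrict B)) ⊆ rkhs (densityKernel p G ν) := by
  have hadd : densityKernel p G ν = fun x y =>
      densityKernel p G (ν.restrict B) x y + densityKernel p G (ν.restrict Bᶜ) x y := by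
    funext x y
    exact (integral_add_compl hB (h.integrable_smul x y)).symm
  rw [hadd]
  exact rkhs_subset_add (h.restrict B).isPosDef (h.restrict Bᶜ).isPosDef

theorem exists_isJetOf_section (h : IsAdmissible q p b G ν) (A : Set U) (y : U) (v : H) :
    ∃ F : BoundedContinuousFunction (JetIndex q A) H,
      IsJetOf F fun x => densityKernel p G ν x y v := by
  refine exists_isJetOf_of_mem_rkhs h.isPosDef h.isCqq (fun α hα => ?_)
    (kernel_section_mem_rkhs h.isPosDef y v)
  obtain ⟨M, hM⟩ := h.exists_bound hα hα
  exact ⟨M, fun x _ => hM x x⟩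

end IsAdmissible

end DensityKernel

/-! ### Functionals on the jets of integral kernels -/

section Tensor

variable {D : Type*} [TopologicalSpace D] {H : Type*} [NormedAddCommGroup H]
  [InnerProductSpace ℂ H]

variable (D H) in
/-- The elementary tensor of a scalar function `φ` and a vector `v`, as the bounded continuous
function `d ↦ φ(d) v`. -/
noncomputable def tensor : (D →ᵇ ℂ) →L[ℂ] H →L[ℂ] (D →ᵇ H) :=
  LinearMap.mkContinuous₂
    (LinearMap.mk₂ ℂ (fun (φ : D →ᵇ ℂ) (v : H) => BoundedContinuousFunction.ofNormedAddCommGroup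
        (fun d => φ d • v) (φ.continuous.smul continuous_const) (‖φ‖ * ‖v‖) fun d => by
          rw [norm_smul]; gcongr; exact φ.norm_coe_le_norm d)
      (fun φ ψ v => by ext d; simp [add_smul])
      (fun c φ v => by ext d; simp [mul_smul])
      (fun φ v w => by ext d; simp)
      (fun c φ v => by ext d; exact smul_comm (φ d) c v))
    1 fun φ v => by
      rw [one_mul]
      refine (BoundedContinuousFunction.norm_le (by positivity)).2 fun d => ?_
      exact (norm_smul_le (φ d) v).trans (by gcongr; exact φ.norm_coe_le_norm d)

@[simp]
theorem tensor_apply (φ : D →ᵇ ℂ) (v : H) (d : D) : tensor D H φ v d = φ d • v := rfl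

theorem exists_dist_sum_inner_smul_lt_of_totallyBounded {s : Set H} (hs : TotallyBounded s) {ε : ℝ}
    (hε : 0 < ε) :
    ∃ (n : ℕ) (e : Fin n → H), ∀ x ∈ s, dist x (∑ k, inner ℂ (e k) x • e k) < ε := by
  obtain ⟨t, ht, hst⟩ := Metric.totallyBounded_iff.1 hs ε hε
  have : FiniteDimensional ℂ (Submodule.span ℂ t) := FiniteDimensional.span_of_finite ℂ ht
  let e := stdOrthonormalBasis ℂ (Submodule.span ℂ t)
  refine ⟨_, fun k => e k, fun x hx => ?_⟩
  have hproj : ∑ k, inner ℂ (e k : H) x • (e k : H) =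
      (Submodule.span ℂ t).starProjection x := by
    rw [e.starProjection_eq_sum_rankOne]
    simp
  obtain ⟨a, ha, hxa⟩ := Set.mem_iUnion₂.1 (hst hx)
  rw [hproj, dist_eq_norm, Submodule.starProjection_minimal]
  refine (ciInf_le ⟨0, Set.forall_mem_range.2 fun _ => norm_nonneg _⟩
    (⟨a, Submodule.subset_span ha⟩ : Submodule.span ℂ t)).trans_lt ?_
  rw [← dist_eq_norm]
  exact Metric.mem_ball.1 hxa

theorem functional_eq_zero_of_totallyBounded (L : (D →ᵇ H) →L[ℂ] ℂ) {F : D →ᵇ H}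
    (hF : TotallyBounded (Set.range F))
    (h : ∀ e v, ∀ φ : D →ᵇ ℂ, (∀ d, φ d = inner ℂ e (F d)) → L (tensor D H φ v) = 0) :
    L F = 0 := by
  let φ : H → D →ᵇ ℂ := fun e => (innerSL ℂ e).compLeftContinuousBounded D F
  refine (isClosed_eq L.continuous continuous_const).closure_subset
    (s := {S | L S = 0}) (Metric.mem_closure_iff.2 fun ε hε => ?_)
  obtain ⟨n, e, he⟩ := exists_dist_sum_inner_smul_lt_of_totallyBounded hF (half_pos hε)
  refine ⟨∑ k, tensor D H (φ (e k)) (e k), ?_, ?_⟩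
  · change L _ = 0
    rw [map_sum]
    exact Finset.sum_eq_zero fun k _ => h (e k) _ _ fun d => rfl
  · refine ((BoundedContinuousFunction.dist_le (half_pos hε).le).2 fun d => ?_).trans_lt
      (half_lt_self hε)
    simpa [φ] using (he (F d) ⟨d, rfl⟩).le

end Tensor

section JetFunctionals

variable {m q : ℕ} {U : Opens (EuclideanSpace ℝ (Fin m))}
  {Ω : Type*} [MeasurableSpace Ω]
  {H : Type*} [NormedAddCommGroup H] [InnerProductSpace ℂ H]
  {p : Ω → U → U → ℂ} {b : Ω → ℝ} {G : Ω → H →L[ℂ] H} {ν : Measure Ω} {A : Set U}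
  {L : (JetIndex q A →ᵇ H) →L[ℂ] ℂ}

/-- The functional `L` on jets commutes with the integrals of the sections `p_w(·, y) G(w) v`. -/
def CommutesWithIntegral (L : (JetIndex q A →ᵇ H) →L[ℂ] ℂ) (p : Ω → U → U → ℂ)
    (G : Ω → H →L[ℂ] H) (ν : Measure Ω) : Prop :=
  ∀ y v, ∀ J : Ω → JetIndex q A →ᵇ ℂ, (∀ w, IsJetOf (J w) fun x => p w x y) →
    Integrable (fun w => L (tensor _ H (J w) (G w v))) ν ∧
    ∀ B, MeasurableSet B → ∀ F : JetIndex q A →ᵇ H,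
      IsJetOf F (fun x => densityKernel p G (ν.restrict B) x y v) →
      L F = ∫ w in B, L (tensor _ H (J w) (G w v)) ∂ν

theorem isJetOf_inner {f : U → H} (hf : IsCq q f) {F : JetIndex q A →ᵇ H} (hF : IsJetOf F f)
    (e : H) {φ : JetIndex q A →ᵇ ℂ} (hφ : ∀ d, φ d = inner ℂ e (F d)) :
    IsJetOf φ fun x => inner ℂ e (f x) := fun d => by
  rw [hφ, hF d]
  exact (hf.multiDeriv_comp_clm ((innerSL ℂ e).restrictScalars ℝ) d.1.2 _).symm

variable [TopologicalSpace Ω]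

namespace IsAdmissible

theorem exists_isJetOf_scalar (h : IsAdmissible q p b G ν) (A : Set U) (w : Ω) (y : U) :
    ∃ J : JetIndex q A →ᵇ ℂ, IsJetOf J fun x => p w x y := by
  have h₀ := zero_mem_multiIndices m q
  have hq : IsCq q fun x => p w x y := by
    simpa only [mixedDeriv_zero] using ((h.cont.1 w).isJet_left h₀ y).isCq
  refine exists_isJetOf hq fun α hα => ⟨b w, fun x _ => ?_⟩
  rw [← mixedDeriv_zero_right]
  exact h.bound α hα 0 h₀ w x y

variable [OpensMeasurableSpace Ω] [CompleteSpace H]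

theorem ae_functional_section_eq_zero (h : IsAdmissible q p b G ν)
    (hL : CommutesWithIntegral L p G ν)
    (hvan : ∀ f ∈ rkhs (densityKernel p G ν), ∀ F, IsJetOf F f → L F = 0)
    {y : U} {J : Ω → JetIndex q A →ᵇ ℂ} (hJ : ∀ w, IsJetOf (J w) fun x => p w x y) (v : H) :
    ∀ᵐ w ∂ν, L (tensor _ H (J w) (G w v)) = 0 := by
  obtain ⟨hint, hcomm⟩ := hL y v J hJ
  refine hint.ae_eq_zero_of_forall_setIntegral_eq_zero fun B hB _ => ?_
  obtain ⟨F, hF⟩ := (h.restrict B).exists_isJetOf_section A y v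
  rw [← hcomm B hB F hF]
  exact hvan _ (h.rkhs_restrict_subset hB
    (kernel_section_mem_rkhs (h.restrict B).isPosDef y v)) F hF

theorem ae_functional_eq_zero (h : IsAdmissible q p b G ν)
    (hL : CommutesWithIntegral L p G ν)
    (hvan : ∀ f ∈ rkhs (densityKernel p G ν), ∀ F, IsJetOf F f → L F = 0) (v : H) :
    ∀ᵐ w ∂ν, ∀ f ∈ rkhs (scalarKernel (p w)), ∀ F, IsJetOf F f →
      L (tensor _ H F (G w v)) = 0 := by
  choose J hJ using h.exists_isJetOf_scalar A
  obtain ⟨D, hDc, hD⟩ := exists_countable_dense U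
  have hsections : ∀ᵐ w ∂ν, ∀ y ∈ D, L (tensor _ H (J w y) (G w v)) = 0 :=
    (ae_ball_iff hDc).2 fun y _ =>
      h.ae_functional_section_eq_zero hL hvan (fun w => hJ w y) v
  filter_upwards [hsections] with w hw f hf F hF
  have hscalar := isCqq_scalarKernel (h.cont.1 w)
  refine jet_functional_eq_zero (h.posDef w) hscalar.1 (fun α hα => ⟨b w, fun x _ => ?_⟩)
    (L ∘L (tensor _ H).flip (G w v)) hD (fun y hy c F hF => ?_) hf hF
  · rw [hscalar.2 α hα α hα]
    exact (ContinuousLinearMap.opNorm_mul_apply_le ℂ ℂ _).trans (h.bound α hα α hα w x x)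
  · have hcq : IsCq q fun x => p w x y := by
      simpa only [mixedDeriv_zero] using
        ((h.cont.1 w).isJet_left (zero_mem_multiIndices m q) y).isCq
    have hFJ : F = c • J w y := BoundedContinuousFunction.ext fun d => by
      rw [hF d, BoundedContinuousFunction.smul_apply, hJ w y d, smul_eq_mul, mul_comm]
      exact hcq.multiDeriv_comp_clm
        (((ContinuousLinearMap.mul ℂ ℂ).flip c).restrictScalars ℝ) d.1.2 d.2.1
    rw [hFJ, map_smul, ContinuousLinearMap.comp_apply, ContinuousLinearMap.flip_apply, hw y hy,
      smul_zero]

/-- The functional `v ↦ L(φ ⊗ v)` is `⟨u, ·⟩` for some `u`, and `⟨u, G(w) u⟩ = L(φ ⊗ G(w) u)`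
vanishes almost everywhere when `φ` is the jet of a function on which the kernels `p_w` decide. -/
theorem functional_eq_zero (h : IsAdmissible q p b G ν) (hL : CommutesWithIntegral L p G ν)
    (hvan : ∀ f ∈ rkhs (densityKernel p G ν), ∀ F, IsJetOf F f → L F = 0)
    (hG : ∀ u, (∀ᵐ w ∂ν, inner ℂ u (G w u) = 0) → u = 0) {𝓕 : Set (U → ℂ)}
    (hdet : ∀ w u, (∀ f ∈ rkhs (scalarKernel (p w)), ∀ F, IsJetOf F f → L (tensor _ H F u) = 0) →
      ∀ f ∈ 𝓕, ∀ F, IsJetOf F f → L (tensor _ H F u) = 0)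
    {f : U → H} (hf : IsCq q f) (hf𝓕 : ∀ e, (fun x => inner ℂ e (f x)) ∈ 𝓕)
    {F : JetIndex q A →ᵇ H} (hF : IsJetOf F f) (hFr : TotallyBounded (Set.range F)) : L F = 0 := by
  refine functional_eq_zero_of_totallyBounded L hFr fun e v φ hφ => ?_
  set u := (InnerProductSpace.toDual ℂ H).symm (L ∘L tensor _ H φ)
  have huL : ∀ v, inner ℂ u v = L (tensor _ H φ v) := fun v =>
    InnerProductSpace.toDual_symm_apply
  have hu₀ : u = 0 := by
    refine hG u ?_
    filter_upwards [h.ae_functional_eq_zero hL hvan u] with w hw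
    rw [huL]
    exact hdet w _ hw _ (hf𝓕 e) _ (isJetOf_inner hf hF e hφ)
  rw [← huL, hu₀, inner_zero_left]

end IsAdmissible

end JetFunctionals

/-! ### Densities of operator valued measures -/

section SetAverages

variable {X : Type*} [MeasurableSpace X] {μ : Measure X} {E : Type*} [NormedAddCommGroup E]
  [NormedSpace ℝ E] [CompleteSpace E] {f : X → E} {C : Set E}

theorem measure_dist_lt_eq_zero_of_forall_setAverage_mem (hf : StronglyMeasurable f)
    (hfi : Integrable f μ) (h0 : 0 ∈ C)
    (h : ∀ B, MeasurableSet B → μ B ≠ 0 → μ B ≠ ⊤ → ⨍ x in B, f x ∂μ ∈ C) (c : E) :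
    μ {x | dist (f x) c < Metric.infDist c C / 2} = 0 := by
  set d := Metric.infDist c C
  set B := {x | dist (f x) c < d / 2}
  by_contra hB0
  have hBm : MeasurableSet B :=
    (hf.dist stronglyMeasurable_const).measurableSet_lt stronglyMeasurable_const
  obtain ⟨x, hx⟩ := nonempty_of_measure_ne_zero hB0
  have hd0 : 0 < d / 2 := dist_nonneg.trans_lt hx
  have hBtop : μ B ≠ ⊤ := by
    refine ((measure_mono fun y hy => ?_).trans_lt (hfi.measure_norm_ge_lt_top hd0)).ne
    have hd_le : d ≤ ‖c‖ := by simpa using Metric.infDist_le_dist_of_mem h0 (x := c)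
    have hcy : ‖c‖ ≤ dist c (f y) + ‖f y‖ := by
      simpa using dist_triangle c (f y) 0
    have hy' : dist (f y) c < d / 2 := hy
    change d / 2 ≤ ‖f y‖
    linarith [dist_comm c (f y)]
  have hball : ⨍ x in B, f x ∂μ ∈ Metric.closedBall c (d / 2) :=
    (convex_closedBall c (d / 2)).set_average_mem Metric.isClosed_closedBall hB0 hBtop
      ((ae_restrict_iff' hBm).2 (Eventually.of_forall fun _ hx => Metric.ball_subset_closedBall hx))
      hfi.integrableOn
  have hle := Metric.infDist_le_dist_of_mem (x := c) (h B hBm hB0 hBtop)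
  rw [dist_comm] at hle
  linarith [Metric.mem_closedBall.1 hball]

/-- The complement of `C` is covered, on the separable range of `f`, by countably many balls
`B(c, infDist c C / 2)`. -/
theorem ae_mem_of_forall_setAverage_mem (hf : Integrable f μ) (hC : IsClosed C) (h0 : 0 ∈ C)
    (h : ∀ B, MeasurableSet B → μ B ≠ 0 → μ B ≠ ⊤ → ⨍ x in B, f x ∂μ ∈ C) : ∀ᵐ x ∂μ, f x ∈ C := by
  obtain ⟨g, hg, hfg⟩ := hf.1
  have hgi : Integrable g μ := hf.congr hfg
  obtain ⟨s, hs, hgs⟩ := hg.isSeparable_range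
  have hnull : ∀ᵐ x ∂μ, ∀ c ∈ s, ¬ dist (g x) c < Metric.infDist c C / 2 :=
    (ae_ball_iff hs).2 fun c _ => by
      rw [ae_iff]
      simpa only [not_not] using measure_dist_lt_eq_zero_of_forall_setAverage_mem hg hgi h0
        (fun B hB hB0 hBtop => setAverage_congr_fun (μ := μ) hB
          (hfg.mono fun x hx _ => hx) ▸ h B hB hB0 hBtop) c
  filter_upwards [hfg, hnull] with x hx hxs
  rw [hx]
  by_contra hxC
  have hd : 0 < Metric.infDist (g x) C := (hC.notMem_iff_infDist_pos ⟨0, h0⟩).1 hxC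
  obtain ⟨c, hc, hxc⟩ := Metric.mem_closure_iff.1 (hgs ⟨x, rfl⟩) (Metric.infDist (g x) C / 3)
    (by positivity)
  refine hxs c hc ?_
  linarith [Metric.infDist_le_infDist_add_dist (s := C) (x := g x) (y := c)]

end SetAverages

section OperatorMeasures

variable {Ω : Type*} [MeasurableSpace Ω]
  {H : Type*} [NormedAddCommGroup H] [InnerProductSpace ℂ H]
  {Λ : VectorMeasure Ω (H →L[ℂ] H)} {lam : Measure Ω} {G : Ω → H →L[ℂ] H}

theorem measureProj_apply (Λ : VectorMeasure Ω (H →L[ℂ] H)) (v : H) (A : Set Ω) :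
    measureProj Λ v A = inner ℂ v (Λ A v) := rfl

theorem exists_sigmaFinite_forall_setIntegral_eq {E : Type*} [NormedAddCommGroup E]
    [NormedSpace ℝ E] {f : Ω → E} (hf : Integrable f lam) :
    ∃ ν : Measure Ω, SigmaFinite ν ∧ Integrable f ν ∧
      ∀ A, ∫ w in A, f w ∂ν = ∫ w in A, f w ∂lam := by
  let hfin := hf.aefinStronglyMeasurable
  refine ⟨lam.restrict hfin.sigmaFiniteSet, inferInstance, hf.restrict, fun A => ?_⟩
  rw [← integral_add_compl hfin.measurableSet hf.restrict,
    Measure.restrict_comm hfin.measurableSet, Measure.restrict_comm hfin.measurableSet.compl,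
    integral_eq_zero_of_ae (ae_restrict_of_ae hfin.ae_eq_zero_compl), add_zero]

variable [CompleteSpace H]

theorem inner_setIntegral_apply (hG : Integrable G lam) (v : H) (A : Set Ω) :
    inner ℂ v ((∫ w in A, G w ∂lam) v) = ∫ w in A, inner ℂ v (G w v) ∂lam :=
  (((innerSL ℂ v).comp (ContinuousLinearMap.apply ℂ H v)).integral_comp_comm hG.restrict).symm

theorem integrable_inner_apply (hG : Integrable G lam) (v : H) :
    Integrable (fun w => inner ℂ v (G w v)) lam :=
  ((innerSL ℂ v).comp (ContinuousLinearMap.apply ℂ H v)).integrable_comp hG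

theorem measureProj_eq_zero_iff (hG : Integrable G lam)
    (hΛG : ∀ A, MeasurableSet A → Λ A = ∫ w in A, G w ∂lam) (v : H) :
    measureProj Λ v = 0 ↔ ∀ᵐ w ∂lam, inner ℂ v (G w v) = 0 := by
  constructor
  · intro h
    refine (integrable_inner_apply hG v).ae_eq_zero_of_forall_setIntegral_eq_zero fun A hA _ => ?_
    rw [← inner_setIntegral_apply hG, ← hΛG A hA, ← measureProj_apply, h]
    rfl
  · intro h
    ext A hA
    rw [measureProj_apply, hΛG A hA, inner_setIntegral_apply hG]
    exact integral_eq_zero_of_ae (ae_restrict_of_ae h)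

open scoped ComplexOrder in
theorem ae_isPositive_of_forall_setIntegral (hG : Integrable G lam)
    (h : ∀ A, MeasurableSet A → (∫ w in A, G w ∂lam).IsPositive) :
    ∀ᵐ w ∂lam, (G w).IsPositive := by
  have hclosed : IsClosed {T : H →L[ℂ] H | T.IsPositive} := by
    simpa only [ContinuousLinearMap.nonneg_iff_isPositive] using
      CStarAlgebra.isClosed_nonneg (A := H →L[ℂ] H)
  refine ae_mem_of_forall_setAverage_mem hG hclosed ContinuousLinearMap.isPositive_zero
    fun A hA _ _ => ?_
  rw [setAverage_eq, ← Complex.coe_smul]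
  exact (h A hA).smul_of_nonneg (Complex.zero_le_real.2 (by positivity))

end OperatorMeasures

/-! ### Universality -/

section Universality

section Approximation

theorem mem_topologicalClosure_of_forall_functional {E : Type*} [NormedAddCommGroup E]
    [NormedSpace ℂ E] {S : Submodule ℂ E} {x : E}
    (h : ∀ L : E →L[ℂ] ℂ, (∀ s ∈ S, L s = 0) → L x = 0) : x ∈ S.topologicalClosure := by
  have : IsClosed (S.topologicalClosure : Set E) := S.isClosed_topologicalClosure
  refine (Submodule.Quotient.mk_eq_zero _).1
    (SeparatingDual.eq_zero_of_forall_dual_eq_zero (R := ℂ) fun L => ?_)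
  refine h (L ∘L S.topologicalClosure.mkQL) fun s hs => ?_
  have hzero : S.topologicalClosure.mkQL s = 0 :=
    (Submodule.Quotient.mk_eq_zero _).2 (S.le_topologicalClosure hs)
  rw [ContinuousLinearMap.comp_apply, hzero, map_zero]

variable {m q : ℕ} {U : Opens (EuclideanSpace ℝ (Fin m))} {A : Set U}

theorem IsJetOf.norm_multiDeriv_sub_le {V : Type*} [NormedAddCommGroup V] [NormedSpace ℝ V]
    {F F' : JetIndex q A →ᵇ V} {f f' : U → V} (hF : IsJetOf F f) (hF' : IsJetOf F' f')
    {α : Fin m → ℕ} (hα : α ∈ multiIndices m q) {x : U} (hx : x ∈ A) :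
    ‖multiDeriv α f x - multiDeriv α f' x‖ ≤ dist F F' := by
  rw [← hF (⟨α, hα⟩, ⟨x, hx⟩), ← hF' (⟨α, hα⟩, ⟨x, hx⟩), ← dist_eq_norm]
  exact BoundedContinuousFunction.dist_coe_le_dist _

theorem IsJetOf.dist_le {V : Type*} [NormedAddCommGroup V] [NormedSpace ℝ V]
    {F F' : JetIndex q A →ᵇ V} {f f' : U → V} (hF : IsJetOf F f) (hF' : IsJetOf F' f')
    {ε : ℝ} (hε : 0 ≤ ε)
    (h : ∀ x ∈ A, ∑ α ∈ multiIndices m q, ‖multiDeriv α f x - multiDeriv α f' x‖ ≤ ε) :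
    dist F F' ≤ ε := by
  refine (BoundedContinuousFunction.dist_le hε).2 fun d => ?_
  rw [hF d, hF' d, dist_eq_norm]
  exact (Finset.single_le_sum (f := fun α => ‖multiDeriv α f d.2.1 - multiDeriv α f' d.2.1‖)
    (fun α _ => norm_nonneg _) d.1.2).trans (h _ d.2.2)

theorem IsJetOf.apply_eq_mixedDeriv {V : Type*} [NormedAddCommGroup V] [NormedSpace ℝ V]
    {k : U → U → V} {y : U} {F : JetIndex q A →ᵇ V} (hF : IsJetOf F fun x => k x y)
    (d : JetIndex q A) : F d = mixedDeriv d.1.1 0 k d.2.1 y := by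
  rw [hF d, mixedDeriv_zero_right]

variable {H : Type*} [NormedAddCommGroup H] [InnerProductSpace ℂ H] [CompleteSpace H]
  {K : U → U → H →L[ℂ] H}

theorem exists_mem_rkhs_approx (hK : IsPosDef K) (hq : IsCqq q K)
    (hb : ∀ α ∈ multiIndices m q, ∃ M, ∀ x ∈ A, ‖mixedDeriv α α K x x‖ ≤ M)
    {g : U → H} {F : JetIndex q A →ᵇ H} (hF : IsJetOf F g)
    (h : ∀ L : (JetIndex q A →ᵇ H) →L[ℂ] ℂ, (∀ f ∈ rkhs K, ∀ F, IsJetOf F f → L F = 0) → L F = 0)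
    {ε : ℝ} (hε : 0 < ε) : ∃ f ∈ rkhs K, ∀ x ∈ A,
      ∑ α ∈ multiIndices m q, ‖multiDeriv α f x - multiDeriv α g x‖ < ε := by
  obtain ⟨E, _, _, _, Φ, hΦ, -⟩ := hK.exists_features
  obtain ⟨T, hT⟩ := exists_jetMap_of_factor hq hΦ hb
  have hFT : F ∈ (LinearMap.range T.toLinearMap).topologicalClosure := by
    refine mem_topologicalClosure_of_forall_functional fun L hL => h L fun f hf F' hF' => ?_
    obtain ⟨u, hu⟩ := (mem_rkhs_iff hΦ).1 hf
    rw [hF'.unique (funext hu ▸ hT u)]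
    exact hL _ ⟨u, rfl⟩
  have hne : (multiIndices m q).Nonempty := ⟨0, zero_mem_multiIndices m q⟩
  have hcard : (0 : ℝ) < (multiIndices m q).card := mod_cast hne.card_pos
  obtain ⟨_, ⟨u, rfl⟩, hd⟩ := Metric.mem_closure_iff.1 hFT (ε / (multiIndices m q).card)
    (by positivity)
  refine ⟨_, (mem_rkhs_iff hΦ).2 ⟨u, fun _ => rfl⟩, fun x hx => ?_⟩
  rw [dist_comm] at hd
  calc ∑ α ∈ multiIndices m q, ‖_ - multiDeriv α g x‖
      < ∑ _ ∈ multiIndices m q, ε / (multiIndices m q).card :=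
        Finset.sum_lt_sum_of_nonempty hne fun α hα =>
          ((hT u).norm_multiDeriv_sub_le hF hα hx).trans_lt hd
    _ = ε := by rw [Finset.sum_const, nsmul_eq_mul, mul_div_cancel₀ _ hcard.ne']

theorem IsCqUniversal.functional_eq_zero (hK : IsCqUniversal q K) (hA : IsCompact A)
    {V : Type*} [NormedAddCommGroup V] [NormedSpace ℂ V]
    (L : (JetIndex q A →ᵇ H) →L[ℂ] V) (hL : ∀ f ∈ rkhs K, ∀ F, IsJetOf F f → L F = 0)
    {f : U → H} (hf : IsCq q f) {F : JetIndex q A →ᵇ H} (hF : IsJetOf F f) : L F = 0 := by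
  refine (isClosed_eq L.continuous continuous_const).closure_subset
    (s := {S | L S = 0}) (Metric.mem_closure_iff.2 fun ε hε => ?_)
  obtain ⟨f', hf', hff'⟩ := hK.2.2 A hA f hf (ε / 2) (half_pos hε)
  obtain ⟨F', hF'⟩ := exists_isJetOf_of_isCompact hA (hK.2.1 f' hf')
  refine ⟨F', hL f' hf' F' hF', ?_⟩
  rw [dist_comm]
  exact (hF'.dist_le hF (half_pos hε).le fun x hx => (hff' x hx).le).trans_lt (half_lt_self hε)

end Approximation

section Projections

variable {m q : ℕ} {U : Opens (EuclideanSpace ℝ (Fin m))}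

theorem isCq_const {V : Type*} [NormedAddCommGroup V] [NormedSpace ℝ V] (c : V) :
    IsCq q fun _ : U => c :=
  contDiffOn_const.congr fun _ hx => zeroExt_of_mem (fun _ : U => c) hx

variable {H : Type*} [NormedAddCommGroup H] [InnerProductSpace ℂ H]

theorem exists_clm_inner_eq {v : H} (hv : v ≠ 0) : ∃ R : ℂ →L[ℂ] H, ∀ z, inner ℂ v (R z) = z := by
  have hvv : (inner ℂ v v : ℂ) ≠ 0 := inner_self_ne_zero.2 hv
  refine ⟨ContinuousLinearMap.toSpanSingleton ℂ ((inner ℂ v v : ℂ)⁻¹ • v), fun z => ?_⟩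
  simp [-inner_self_eq_norm_sq_to_K, hvv]

theorem IsCqUniversal.kernelProj [CompleteSpace H] {K : U → U → H →L[ℂ] H}
    (hK : IsCqUniversal q K) {v : H} (hv : v ≠ 0) :
    IsCqUniversal q (scalarKernel (kernelProj K v)) := by
  refine ⟨isPosDef_kernelProj hK.1 v, fun f hf => ?_, fun A hA g hg ε hε => ?_⟩
  · obtain ⟨F, hF, rfl⟩ := (mem_rkhs_kernelProj_iff hK.1 v).1 hf
    exact (hK.2.1 F hF).comp_clm ((innerSL ℂ v).restrictScalars ℝ)
  obtain ⟨R, hR⟩ := exists_clm_inner_eq hv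
  let L : H →L[ℝ] ℂ := (innerSL ℂ v).restrictScalars ℝ
  obtain ⟨F, hF, hFg⟩ := hK.2.2 A hA _ (hg.comp_clm (R.restrictScalars ℝ)) (ε / ‖v‖) (by positivity)
  refine ⟨_, (mem_rkhs_kernelProj_iff hK.1 v).2 ⟨F, hF, rfl⟩, fun x hx => ?_⟩
  have hFgx := hFg x hx
  rw [lt_div_iff₀ (norm_pos_iff.2 hv), Finset.sum_mul] at hFgx
  refine (Finset.sum_le_sum fun α hα => ?_).trans_lt hFgx
  have hLF : multiDeriv α (fun x => inner ℂ v (F x)) x = L (multiDeriv α F x) :=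
    (hK.2.1 F hF).multiDeriv_comp_clm L hα x
  have hLg : multiDeriv α g x = L (multiDeriv α (fun x => R.restrictScalars ℝ (g x)) x) := by
    rw [← (hg.comp_clm (R.restrictScalars ℝ)).multiDeriv_comp_clm L hα x]
    exact congrArg (multiDeriv α · x) (funext fun x => (hR (g x)).symm)
  rw [hLF, hLg, ← map_sub, mul_comm]
  exact norm_inner_le_norm _ _

theorem eq_zero_of_mem_rkhs_zero [CompleteSpace H] {X : Type*} {f : X → H}
    (hf : f ∈ rkhs fun _ _ : X => (0 : H →L[ℂ] H)) (x : X) : f x = 0 := by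
  obtain ⟨u, hu⟩ := (mem_rkhs_iff (Φ := fun _ : X => (0 : H →L[ℂ] H)) fun _ _ => by simp).1 hf
  simp [hu x]

theorem not_isCqUniversal_zero [Nonempty U] :
    ¬ IsCqUniversal q fun _ _ : U => (0 : ℂ →L[ℂ] ℂ) := by
  intro h
  obtain ⟨x⟩ := ‹Nonempty U›
  obtain ⟨f, hf, hfx⟩ := h.2.2 {x} isCompact_singleton _ (isCq_const 1) 1 one_pos
  have hlt := (Finset.single_le_sum (fun α _ => norm_nonneg _)
    (zero_mem_multiIndices m q)).trans_lt (hfx x rfl)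
  rw [multiDeriv_zero, multiDeriv_zero, eq_zero_of_mem_rkhs_zero hf x] at hlt
  simp at hlt

end Projections

namespace IsAdmissible

variable {m q : ℕ} {U : Opens (EuclideanSpace ℝ (Fin m))} {A : Set U}
  {Ω : Type*} [TopologicalSpace Ω] [MeasurableSpace Ω]
  {H : Type*} [NormedAddCommGroup H] [InnerProductSpace ℂ H]
  {p : Ω → U → U → ℂ} {b : Ω → ℝ} {G : Ω → H →L[ℂ] H} {ν : Measure Ω}

theorem norm_jet_le (h : IsAdmissible q p b G ν) {y : U} {J : JetIndex q A →ᵇ ℂ} {w : Ω}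
    (hJ : IsJetOf J fun x => p w x y) : ‖J‖ ≤ |b w| :=
  (BoundedContinuousFunction.norm_le (abs_nonneg _)).2 fun d => by
    rw [hJ.apply_eq_mixedDeriv]
    exact (h.bound _ d.1.2 0 (zero_mem_multiIndices m q) w _ y).trans (le_abs_self _)

variable [OpensMeasurableSpace Ω]

theorem stronglyMeasurable_jet (h : IsAdmissible q p b G ν) (hA : IsCompact A) {y : U}
    {J : Ω → JetIndex q A →ᵇ ℂ} (hJ : ∀ w, IsJetOf (J w) fun x => p w x y) :
    StronglyMeasurable J := by
  have : CompactSpace A := isCompact_iff_compactSpace.1 hA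
  let c : C(Ω × JetIndex q A, ℂ) := ⟨fun z => mixedDeriv z.2.1.1 0 (p z.1) z.2.2.1 y, by
    rw [← (Homeomorph.prodComm _ _).comp_continuous_iff',
      ← (Homeomorph.prodAssoc _ _ _).symm.comp_continuous_iff', continuous_prod_of_discrete_left]
    exact fun α => (h.cont.2 α.1 α.2 0 (zero_mem_multiIndices m q)).comp
      (f := fun z : A × Ω => (z.2, z.1.1, y)) (by fun_prop)⟩
  have hJc : J = fun w => BoundedContinuousFunction.mkOfCompact (c.curry w) :=
    funext fun w => BoundedContinuousFunction.ext (hJ w).apply_eq_mixedDeriv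
  rw [hJc]
  exact (ContinuousMap.isometryEquivBoundedOfCompact _ _).continuous.comp_stronglyMeasurable
    c.curry.continuous.stronglyMeasurable

theorem integrable_tensor_jet (h : IsAdmissible q p b G ν) (hA : IsCompact A) {y : U}
    {J : Ω → JetIndex q A →ᵇ ℂ} (hJ : ∀ w, IsJetOf (J w) fun x => p w x y) (v : H) :
    Integrable (fun w => tensor _ H (J w) (G w v)) ν := by
  refine (h.int.norm.mul_const ‖v‖).mono' ?_ (Eventually.of_forall fun w => ?_)
  · exact (tensor _ H).aestronglyMeasurable_comp₂
      (h.stronglyMeasurable_jet hA hJ).aestronglyMeasurable (h.meas.apply_continuousLinearMap v)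
  · refine (BoundedContinuousFunction.norm_le (by positivity)).2 fun d => ?_
    rw [tensor_apply, norm_smul, norm_mul, norm_norm, mul_assoc]
    gcongr
    · exact ((J w).norm_coe_le_norm d).trans (h.norm_jet_le (hJ w))
    · exact (G w).le_opNorm v

variable [CompleteSpace H]

theorem commutesWithIntegral_of_isCompact (h : IsAdmissible q p b G ν) (hA : IsCompact A)
    (L : (JetIndex q A →ᵇ H) →L[ℂ] ℂ) : CommutesWithIntegral L p G ν := by
  intro y v J hJ
  have hint := h.integrable_tensor_jet hA hJ v
  refine ⟨L.integrable_comp hint, fun B _ F hF => ?_⟩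
  rw [L.integral_comp_comm hint.restrict]
  congr 1
  ext d
  calc F d = ∫ w in B, tensor _ H (J w) (G w v) d ∂ν := by
        simp only [hF d, (h.restrict B).multiDeriv_section d.1.2, tensor_apply,
          (hJ _).apply_eq_mixedDeriv]
    _ = (∫ w in B, tensor _ H (J w) (G w v) ∂ν) d :=
        (BoundedContinuousFunction.evalCLM ℂ d).integral_comp_comm hint.restrict

theorem isCqUniversal (h : IsAdmissible q p b G ν)
    (hG : ∀ u, (∀ᵐ w ∂ν, inner ℂ u (G w u) = 0) → u = 0)
    (hp : ∀ w, IsCqUniversal q (scalarKernel (p w))) : IsCqUniversal q (densityKernel p G ν) := by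
  refine ⟨h.isPosDef, fun f hf => isCq_of_mem_rkhs h.isPosDef h.isCqq hf,
    fun A hA g hg ε hε => ?_⟩
  have : CompactSpace A := isCompact_iff_compactSpace.1 hA
  obtain ⟨F, hF⟩ := exists_isJetOf_of_isCompact hA hg
  refine exists_mem_rkhs_approx h.isPosDef h.isCqq (fun α hα => ?_) hF (fun L hL => ?_) hε
  · obtain ⟨M, hM⟩ := h.exists_bound hα hα
    exact ⟨M, fun x _ => hM x x⟩
  · exact h.functional_eq_zero (h.commutesWithIntegral_of_isCompact hA L) hL hG
      (𝓕 := {f | IsCq q f}) (fun w u hu f hf F hF =>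
        (hp w).functional_eq_zero hA (L ∘L (tensor _ H).flip u) hu hf hF) hg
      (fun e => hg.comp_clm ((innerSL ℂ e).restrictScalars ℝ)) hF
      (isCompact_range F.continuous).totallyBounded

end IsAdmissible

end Universality

/-! ### Functionals given by vector measures -/

section MeasureFunctionals

section Fubini

variable {X Ω : Type*} [MeasurableSpace X] [MeasurableSpace Ω] {H : Type*} [NormedAddCommGroup H]
  [InnerProductSpace ℂ H] [CompleteSpace H] {ν : Measure Ω}

theorem integrable_bartleIntegral_and_bartleIntegral_integral [SFinite ν] (η : VectorMeasure X H)
    [IsFiniteMeasure η.variation] {f : X → Ω → H} {c : Ω → ℝ}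
    (hf : AEStronglyMeasurable (Function.uncurry f) (η.variation.prod ν)) (hc : Integrable c ν)
    (hb : ∀ x w, ‖f x w‖ ≤ c w) :
    Integrable (fun w => bartleIntegral η (f · w)) ν ∧
      bartleIntegral η (fun x => ∫ w, f x w ∂ν) = ∫ w, bartleIntegral η (f · w) ∂ν := by
  obtain ⟨g, -, hg, hgη⟩ := exists_density η
  have hprod : Integrable (fun z : X × Ω => inner ℂ (g z.1) (f z.1 z.2)) (η.variation.prod ν) :=
    (hg.norm.mul_prod hc).mono' (hg.1.comp_fst.inner hf) (Eventually.of_forall fun z =>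
      (norm_inner_le_norm _ _).trans (by gcongr; exact hb _ _))
  have hsection : (fun w => bartleIntegral η (f · w)) =ᵐ[ν]
      fun w => ∫ x, inner ℂ (g x) (f x w) ∂η.variation := by
    filter_upwards [hf.prod_swap.prodMk_left] with w hw
    exact bartleIntegral_eq hg hgη
      (Integrable.of_bound hw (c w) (Eventually.of_forall fun x => hb x w))
  have hint : η.Integrable fun x => ∫ w, f x w ∂ν :=
    Integrable.of_bound hf.integral_prod_right' (∫ w, c w ∂ν) (Eventually.of_forall fun x =>
      norm_integral_le_of_norm_le hc (Eventually.of_forall (hb x)))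
  refine ⟨hprod.integral_prod_right.congr hsection.symm, ?_⟩
  rw [bartleIntegral_eq hg hgη hint, integral_congr_ae hsection, ← integral_integral_swap hprod]
  refine integral_congr_ae ?_
  filter_upwards [hf.prodMk_left] with x hx
  exact (integral_inner (hc.mono' hx (Eventually.of_forall (hb x))) (g x)).symm

end Fubini

variable {m q : ℕ} {U : Opens (EuclideanSpace ℝ (Fin m))}

section Jets

variable {V : Type*} [NormedAddCommGroup V] [NormedSpace ℝ V]

/-- The component of index `α` of a jet on `U`. -/
noncomputable def jetComponent (α : {α : Fin m → ℕ // α ∈ multiIndices m q})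
    (F : JetIndex q (Set.univ : Set U) →ᵇ V) : U →ᵇ V :=
  F.compContinuous ⟨fun x => (α, ⟨x, trivial⟩), by fun_prop⟩

theorem IsJetOf.jetComponent_eq {F : JetIndex q (Set.univ : Set U) →ᵇ V} {f : U → V}
    (hF : IsJetOf F f) (α : {α : Fin m → ℕ // α ∈ multiIndices m q}) :
    ⇑(jetComponent α F) = multiDeriv α.1 f :=
  funext fun x => hF (α, ⟨x, trivial⟩)

theorem IsCqZero.exists_isJetOf {f : U → V} (hf : IsCqZero q f) :
    ∃ F : JetIndex q (Set.univ : Set U) →ᵇ V, IsJetOf F f ∧ TotallyBounded (Set.range F) := by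
  let S : Set V := ⋃ α : {α // α ∈ multiIndices m q}, insert 0 (Set.range (multiDeriv α.1 f))
  have hS : IsCompact S := isCompact_iUnion fun α =>
    (hf.2 α α.2).isCompact_insert_range_of_cocompact (hf.1.continuous_multiDeriv α.2)
  have hfS : ∀ α ∈ multiIndices m q, ∀ x, multiDeriv α f x ∈ S := fun α hα x =>
    Set.mem_iUnion.2 ⟨⟨α, hα⟩, Or.inr ⟨x, rfl⟩⟩
  obtain ⟨C, hC⟩ := hS.isBounded.exists_norm_le
  obtain ⟨F, hF⟩ := OpKernel.exists_isJetOf (A := Set.univ) hf.1 fun α hα =>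
    ⟨C, fun x _ => hC _ (hfS α hα x)⟩
  refine ⟨F, hF, hS.totallyBounded.subset ?_⟩
  rintro _ ⟨d, rfl⟩
  rw [hF d]
  exact hfS _ d.1.2 d.2.1

theorem IsCqZero.comp_clm {W : Type*} [NormedAddCommGroup W] [NormedSpace ℝ W] {f : U → V}
    (hf : IsCqZero q f) (L : V →L[ℝ] W) : IsCqZero q fun x => L (f x) := by
  refine ⟨hf.1.comp_clm L, fun α hα => ?_⟩
  rw [funext (hf.1.multiDeriv_comp_clm L hα)]
  exact (map_zero L ▸ L.continuous.tendsto 0).comp (hf.2 α hα)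

end Jets

variable {H : Type*} [NormedAddCommGroup H] [InnerProductSpace ℂ H]

theorem isJetOf_tensor {A : Set U} {f : U → ℂ} (hf : IsCq q f) {F : JetIndex q A →ᵇ ℂ}
    (hF : IsJetOf F f) (u : H) : IsJetOf (tensor _ H F u) fun x => f x • u := fun d => by
  rw [tensor_apply, hF d]
  exact (hf.multiDeriv_comp_clm
    ((ContinuousLinearMap.toSpanSingleton ℂ u).restrictScalars ℝ) d.1.2 _).symm

theorem exists_clm_eq_sum_bartleIntegral {η : (Fin m → ℕ) → VectorMeasure U H}
    (hη : ∀ α ∈ multiIndices m q, IsFiniteMeasure (η α).variation) :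
    ∃ L : (JetIndex q (Set.univ : Set U) →ᵇ H) →L[ℂ] ℂ, ∀ F f, IsJetOf F f →
      L F = ∑ α ∈ multiIndices m q, bartleIntegral (η α) (multiDeriv α f) := by
  have hcomponent : ∀ α : {α // α ∈ multiIndices m q},
      ∃ L : (JetIndex q (Set.univ : Set U) →ᵇ H) →L[ℂ] ℂ,
        ∀ F, L F = bartleIntegral (η α) (jetComponent α F) := fun α => by
    have := hη α α.2
    obtain ⟨L, hL⟩ := exists_clm_eq_bartleIntegral (η α)
    exact ⟨L ∘L BoundedContinuousFunction.compContinuousCLM H ℂ _, fun F => hL (jetComponent α F)⟩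
  choose L hL using hcomponent
  refine ⟨∑ α, L α, fun F f hF => ?_⟩
  rw [_root_.sum_apply, ← Finset.sum_coe_sort (multiIndices m q)]
  exact Finset.sum_congr rfl fun α _ => by rw [hL, hF.jetComponent_eq]

variable [CompleteSpace H]

theorem isRadonBV_withDensityᵥ {μ : Measure U} {g : U → H} (hg : Integrable g μ) :
    IsRadonBV (μ.withDensityᵥ g) := by
  have hvar : (μ.withDensityᵥ g).variation = μ.withDensity fun x => ‖g x‖ₑ :=
    variation_eq_withDensity hg fun A hA => withDensityᵥ_apply hg hA
  have hfin : IsFiniteMeasure (μ.withDensityᵥ g).variation :=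
    hvar ▸ isFiniteMeasure_withDensity hg.2.ne
  have : LocallyCompactSpace U := U.isOpen.locallyCompactSpace
  exact ⟨hfin, inferInstance⟩

variable {H' : Type*} [NormedAddCommGroup H'] [InnerProductSpace ℂ H'] [CompleteSpace H']

theorem exists_transpose_measure (η : VectorMeasure U H) [IsFiniteMeasure η.variation]
    (T : H' →L[ℂ] H) :
    ∃ η' : VectorMeasure U H', IsRadonBV η' ∧ ∀ F : U →ᵇ H',
      bartleIntegral η' F = bartleIntegral η fun x => T (F x) := by
  obtain ⟨g, -, hg, hη⟩ := exists_density η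
  have hg' : Integrable (fun x => ContinuousLinearMap.adjoint T (g x)) η.variation :=
    (ContinuousLinearMap.adjoint T).integrable_comp hg
  have hη' := isRadonBV_withDensityᵥ hg'
  have := hη'.1
  refine ⟨_, hη', fun F => ?_⟩
  have hTF : η.Integrable fun x => T (F x) :=
    integrable_boundedContinuous η (T.compLeftContinuousBounded U F)
  rw [bartleIntegral_eq hg' (fun A hA => withDensityᵥ_apply hg' hA)
    (integrable_boundedContinuous _ F), bartleIntegral_eq hg hη hTF]
  simp only [ContinuousLinearMap.adjoint_inner_left]

theorem exists_transpose_measures {η : (Fin m → ℕ) → VectorMeasure U H}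
    (hη : ∀ α ∈ multiIndices m q, IsFiniteMeasure (η α).variation) (T : H' →L[ℂ] H) :
    ∃ η' : (Fin m → ℕ) → VectorMeasure U H', (∀ α ∈ multiIndices m q, IsRadonBV (η' α)) ∧
      ∀ f : U → H', IsCq q f → (∃ F : JetIndex q (Set.univ : Set U) →ᵇ H', IsJetOf F f) →
        ∑ α ∈ multiIndices m q, bartleIntegral (η' α) (multiDeriv α f) =
          ∑ α ∈ multiIndices m q, bartleIntegral (η α) (multiDeriv α fun x => T (f x)) := by
  have hex : ∀ α ∈ multiIndices m q, ∃ η' : VectorMeasure U H', IsRadonBV η' ∧ ∀ F : U →ᵇ H',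
      bartleIntegral η' F = bartleIntegral (η α) fun x => T (F x) := fun α hα =>
    have := hη α hα
    exists_transpose_measure (η α) T
  choose! η' hradon hη' using hex
  refine ⟨η', hradon, fun f hf ⟨F, hF⟩ => Finset.sum_congr rfl fun α hα => ?_⟩
  rw [← hF.jetComponent_eq ⟨α, hα⟩, hη' α hα, hF.jetComponent_eq ⟨α, hα⟩]
  exact congrArg _ (funext fun x => (hf.multiDeriv_comp_clm (T.restrictScalars ℝ) hα x).symm)

end MeasureFunctionals

/-! ### Integral strict positive definiteness -/

section StrictPositivity

variable {m q : ℕ} {U : Opens (EuclideanSpace ℝ (Fin m))}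
  {H : Type*} [NormedAddCommGroup H] [InnerProductSpace ℂ H]

theorem IsCqq.norm_mixedDeriv_kernelProj_le {K : U → U → H →L[ℂ] H} (hK : IsCqq q K)
    {α β : Fin m → ℕ} (hα : α ∈ multiIndices m q) (hβ : β ∈ multiIndices m q) (v : H) (x y : U) :
    ‖mixedDeriv α β (scalarKernel (kernelProj K v)) x y‖ ≤ ‖mixedDeriv α β K x y‖ * ‖v‖ ^ 2 := by
  have hproj := isCqq_kernelProj hK v
  rw [(isCqq_scalarKernel hproj.1).2 α hα β hβ, hproj.2 α hα β hβ]
  calc ‖ContinuousLinearMap.mul ℂ ℂ (inner ℂ v (mixedDeriv α β K x y v))‖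
      ≤ ‖inner ℂ v (mixedDeriv α β K x y v)‖ := ContinuousLinearMap.opNorm_mul_apply_le ℂ ℂ _
    _ ≤ ‖v‖ * (‖mixedDeriv α β K x y‖ * ‖v‖) :=
      (norm_inner_le_norm _ _).trans (by gcongr; exact ContinuousLinearMap.le_opNorm _ _)
    _ = ‖mixedDeriv α β K x y‖ * ‖v‖ ^ 2 := by ring

variable [CompleteSpace H]

theorem IsCqIntStrictPosDef.sum_eq_zero {K : U → U → H →L[ℂ] H} (hK : IsCqIntStrictPosDef q K)
    {η : (Fin m → ℕ) → VectorMeasure U H} (hη : ∀ α ∈ multiIndices m q, IsRadonBV (η α))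
    (h : ∀ f ∈ rkhs K, ∑ α ∈ multiIndices m q, bartleIntegral (η α) (multiDeriv α f) = 0)
    {f : U → H} (hf : IsCqZero q f) :
    ∑ α ∈ multiIndices m q, bartleIntegral (η α) (multiDeriv α f) = 0 :=
  hK.2.2.2 η hη ((energy_eq_zero_iff hK.1 hK.2.1 hK.2.2.1 fun α hα => (hη α hα).1).2 h) f hf

theorem IsCqIntStrictPosDef.exists_isJetOf {K : U → U → H →L[ℂ] H} (hK : IsCqIntStrictPosDef q K)
    {f : U → H} (hf : f ∈ rkhs K) :
    ∃ F : JetIndex q (Set.univ : Set U) →ᵇ H, IsJetOf F f :=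
  exists_isJetOf_of_mem_rkhs hK.1 hK.2.1
    (fun α hα => (hK.2.2.1 α hα).imp fun _ hM x _ => hM x) hf

theorem IsCqIntStrictPosDef.kernelProj {K : U → U → H →L[ℂ] H} (hK : IsCqIntStrictPosDef q K)
    {v : H} (hv : v ≠ 0) : IsCqIntStrictPosDef q (scalarKernel (kernelProj K v)) := by
  have hpos := isPosDef_kernelProj hK.1 v
  have hcq := (isCqq_scalarKernel (isCqq_kernelProj hK.2.1 v).1).1
  have hb : ∀ α ∈ multiIndices m q, ∃ M : ℝ, ∀ x,
      ‖mixedDeriv α α (scalarKernel (OpKernel.kernelProj K v)) x x‖ ≤ M := fun α hα => by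
    obtain ⟨M, hM⟩ := hK.2.2.1 α hα
    exact ⟨M * ‖v‖ ^ 2, fun x => (hK.2.1.norm_mixedDeriv_kernelProj_le hα hα v x x).trans
      (by gcongr; exact hM x)⟩
  refine ⟨hpos, hcq, hb, fun η hη henergy f hf => ?_⟩
  have hfin := fun α hα => (hη α hα).1
  rw [energy_eq_zero_iff hpos hcq hb hfin] at henergy
  obtain ⟨η', hη', htranspose⟩ := exists_transpose_measures hfin (innerSL ℂ v)
  obtain ⟨R, hR⟩ := exists_clm_inner_eq hv
  have hRf : IsCqZero q fun x => R (f x) := hf.comp_clm (R.restrictScalars ℝ)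
  have hzero := hK.sum_eq_zero hη' (fun g hg => ?_) hRf
  · rw [htranspose _ hRf.1 (hRf.exists_isJetOf.imp fun _ h => h.1)] at hzero
    simpa only [innerSL_apply_apply, hR] using hzero
  · rw [htranspose g (isCq_of_mem_rkhs hK.1 hK.2.1 hg) (hK.exists_isJetOf hg)]
    exact henergy _ ((mem_rkhs_kernelProj_iff hK.1 v).2 ⟨g, hg, rfl⟩)

/-- The functional `φ ↦ L(φ ⊗ u)` is again given by measures. -/
theorem IsCqIntStrictPosDef.functional_tensor_eq_zero {k : U → U → ℂ}
    (hk : IsCqIntStrictPosDef q (scalarKernel k)) {η : (Fin m → ℕ) → VectorMeasure U H}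
    (hη : ∀ α ∈ multiIndices m q, IsFiniteMeasure (η α).variation)
    {L : (JetIndex q (Set.univ : Set U) →ᵇ H) →L[ℂ] ℂ}
    (hL : ∀ F f, IsJetOf F f →
      L F = ∑ α ∈ multiIndices m q, bartleIntegral (η α) (multiDeriv α f)) {u : H}
    (hu : ∀ f ∈ rkhs (scalarKernel k), ∀ F, IsJetOf F f → L (tensor _ H F u) = 0)
    {f : U → ℂ} (hf : IsCqZero q f) {F : JetIndex q (Set.univ : Set U) →ᵇ ℂ} (hF : IsJetOf F f) :
    L (tensor _ H F u) = 0 := by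
  obtain ⟨η', hradon, hη'⟩ :=
    exists_transpose_measures hη (ContinuousLinearMap.toSpanSingleton ℂ u)
  have htensor : ∀ f : U → ℂ, IsCq q f → ∀ F, IsJetOf F f → L (tensor _ H F u) =
      ∑ α ∈ multiIndices m q, bartleIntegral (η' α) (multiDeriv α f) := fun f hf F hF =>
    (hL _ _ (isJetOf_tensor hf hF u)).trans (hη' f hf ⟨F, hF⟩).symm
  rw [htensor f hf.1 F hF]
  refine hk.sum_eq_zero hradon (fun g hg => ?_) hf
  obtain ⟨F, hF⟩ := hk.exists_isJetOf hg
  rw [← htensor g (isCq_of_mem_rkhs hk.1 hk.2.1 hg) F hF]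
  exact hu g hg F hF

namespace IsAdmissible

variable {Ω : Type*} [TopologicalSpace Ω] [MeasurableSpace Ω] [OpensMeasurableSpace Ω]
  {p : Ω → U → U → ℂ} {b : Ω → ℝ} {G : Ω → H →L[ℂ] H} {ν : Measure Ω} [SFinite ν]

theorem bartleIntegral_section (h : IsAdmissible q p b G ν) (η : VectorMeasure U H)
    [IsFiniteMeasure η.variation] {α : Fin m → ℕ} (hα : α ∈ multiIndices m q) (y : U) (v : H) :
    Integrable (fun w => bartleIntegral η fun x => mixedDeriv α 0 (p w) x y • G w v) ν ∧
      bartleIntegral η (multiDeriv α fun x => densityKernel p G ν x y v) =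
        ∫ w, bartleIntegral η fun x => mixedDeriv α 0 (p w) x y • G w v ∂ν := by
  have h₀ := zero_mem_multiIndices m q
  rw [funext fun x => h.multiDeriv_section hα x y v]
  refine integrable_bartleIntegral_and_bartleIntegral_integral η
    (f := fun x w => mixedDeriv α 0 (p w) x y • G w v) ?_ (h.int.mul_const ‖v‖) fun x w => ?_
  · have hmeas : StronglyMeasurable
        (Function.uncurry fun (x : U) w => mixedDeriv α 0 (p w) x y) :=
      stronglyMeasurable_uncurry_of_continuous_of_stronglyMeasurable
        (fun w => ((h.cont.1 w).2.2 α hα 0 h₀).comp (Continuous.prodMk_left y))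
        fun x => (h.cont.continuous_mixedDeriv hα h₀ x y).stronglyMeasurable
    exact hmeas.aestronglyMeasurable.smul (h.meas.apply_continuousLinearMap v).comp_snd
  · rw [← _root_.smul_apply]
    exact ContinuousLinearMap.le_of_opNorm_le _ (h.norm_le hα h₀ w x y) v

theorem commutesWithIntegral_of_measures (h : IsAdmissible q p b G ν)
    {η : (Fin m → ℕ) → VectorMeasure U H}
    (hη : ∀ α ∈ multiIndices m q, IsFiniteMeasure (η α).variation)
    {L : (JetIndex q (Set.univ : Set U) →ᵇ H) →L[ℂ] ℂ}
    (hL : ∀ F f, IsJetOf F f →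
      L F = ∑ α ∈ multiIndices m q, bartleIntegral (η α) (multiDeriv α f)) :
    CommutesWithIntegral L p G ν := by
  intro y v J hJ
  have h₀ := zero_mem_multiIndices m q
  have hcq : ∀ w, IsCq q fun x => p w x y := fun w => by
    simpa only [mixedDeriv_zero] using ((h.cont.1 w).isJet_left h₀ y).isCq
  have hLJ : ∀ w, L (tensor _ H (J w) (G w v)) = ∑ α ∈ multiIndices m q,
      bartleIntegral (η α) fun x => mixedDeriv α 0 (p w) x y • G w v := fun w => by
    rw [hL _ _ (isJetOf_tensor (hcq w) (hJ w) (G w v))]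
    refine Finset.sum_congr rfl fun α hα => congrArg _ (funext fun x => ?_)
    rw [mixedDeriv_zero_right]
    exact (hcq w).multiDeriv_comp_clm
      ((ContinuousLinearMap.toSpanSingleton ℂ (G w v)).restrictScalars ℝ) hα x
  have hsection := fun (B : Set Ω) α hα =>
    have := hη α hα
    (h.restrict B).bartleIntegral_section (η α) hα y v
  simp only [hLJ]
  refine ⟨integrable_finsetSum _ fun α hα => ?_, fun B _ F hF => ?_⟩
  · simpa using (hsection Set.univ α hα).1
  · rw [hL _ _ hF, integral_finsetSum _ fun α hα => (hsection B α hα).1]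
    exact Finset.sum_congr rfl fun α hα => (hsection B α hα).2

theorem isCqIntStrictPosDef (h : IsAdmissible q p b G ν)
    (hG : ∀ u, (∀ᵐ w ∂ν, inner ℂ u (G w u) = 0) → u = 0)
    (hp : ∀ w, IsCqIntStrictPosDef q (scalarKernel (p w))) :
    IsCqIntStrictPosDef q (densityKernel p G ν) := by
  have hb : ∀ α ∈ multiIndices m q, ∃ M : ℝ, ∀ x,
      ‖mixedDeriv α α (densityKernel p G ν) x x‖ ≤ M := fun α hα =>
    (h.exists_bound hα hα).imp fun _ hM x => hM x x
  refine ⟨h.isPosDef, h.isCqq, hb, fun η hη henergy f hf => ?_⟩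
  have hfin := fun α hα => (hη α hα).1
  rw [energy_eq_zero_iff h.isPosDef h.isCqq hb hfin] at henergy
  obtain ⟨L, hL⟩ := exists_clm_eq_sum_bartleIntegral hfin
  obtain ⟨F, hF, hrange⟩ := hf.exists_isJetOf
  rw [← hL F f hF]
  exact h.functional_eq_zero (h.commutesWithIntegral_of_measures hfin hL)
    (fun g hg F hF => (hL F g hF).trans (henergy g hg)) hG (𝓕 := {f | IsCqZero q f})
    (fun w u hu f hf F hF => (hp w).functional_tensor_eq_zero hfin hL hu hf hF) hf.1
    (fun e => hf.comp_clm ((innerSL ℂ e).restrictScalars ℝ)) hF hrange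

end IsAdmissible

end StrictPositivity

/-! ### The zero kernel -/

section ZeroKernel

variable {m q : ℕ} {U : Opens (EuclideanSpace ℝ (Fin m))}

section LocalVanishing

variable {V : Type*} [NormedAddCommGroup V] [NormedSpace ℝ V] {W : Set U} {f : U → V}

theorem partialDeriv_eq_zero_of_isOpen (hW : IsOpen W) (i : Fin m) (hf : ∀ x ∈ W, f x = 0) :
    ∀ x ∈ W, partialDeriv i f x = 0 := by
  intro x hx
  have hnear : zeroExt f =ᶠ[𝓝 (x : EuclideanSpace ℝ (Fin m))] fun _ => 0 := by
    filter_upwards [(U.isOpen.isOpenMap_subtype_val W hW).mem_nhds ⟨x, hx, rfl⟩]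
    rintro _ ⟨y, hy, rfl⟩
    rw [zeroExt_coe, hf y hy]
  rw [partialDeriv, hnear.lineDeriv_eq, lineDeriv, deriv_const]

theorem multiDeriv_eq_zero_of_isOpen (hW : IsOpen W) (α : Fin m → ℕ) (hf : ∀ x ∈ W, f x = 0) :
    ∀ x ∈ W, multiDeriv α f x = 0 := by
  rw [multiDeriv_eq_listDeriv]
  induction List.finRange m with
  | nil => exact hf
  | cons i l ih =>
    rw [listDeriv_cons]
    induction α i with
    | zero => exact ih
    | succ n ihn =>
      rw [Function.iterate_succ_apply']
      exact partialDeriv_eq_zero_of_isOpen hW i ihn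

end LocalVanishing

theorem exists_isCqZero_ne_zero (x : U) : ∃ f : U → ℂ, IsCqZero q f ∧ f x ≠ 0 := by
  obtain ⟨r, hr, hrU⟩ := Metric.nhds_basis_closedBall.mem_iff.1 (U.isOpen.mem_nhds x.2)
  let φ : ContDiffBump (x : EuclideanSpace ℝ (Fin m)) := ⟨r / 2, r, by positivity, by linarith⟩
  have hsupp : IsCompact {y : U | (y : EuclideanSpace ℝ (Fin m)) ∈ Metric.closedBall x.1 r} :=
    Topology.IsInducing.subtypeVal.isCompact_preimage' (isCompact_closedBall x.1 r)
      (by simpa using hrU)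
  have hφ : ∀ y ∈ {y : U | (y : EuclideanSpace ℝ (Fin m)) ∈ Metric.closedBall x.1 r}ᶜ,
      (φ y : ℂ) = 0 := fun y hy => by
    rw [φ.zero_of_le_dist (not_le.1 fun hle => hy hle).le, Complex.ofReal_zero]
  refine ⟨fun y => (φ y : ℂ), ⟨?_, fun α _ => ?_⟩, ?_⟩
  · exact (Complex.ofRealCLM.contDiff.comp φ.contDiff).contDiffOn.congr fun y hy =>
      zeroExt_of_mem (fun y : U => (φ y : ℂ)) hy
  · refine tendsto_const_nhds.congr' ?_
    filter_upwards [hsupp.compl_mem_cocompact] with y hy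
    exact (multiDeriv_eq_zero_of_isOpen hsupp.isClosed.isOpen_compl α hφ y hy).symm
  · exact Complex.ofReal_ne_zero.2 (φ.pos_of_mem_ball (Metric.mem_ball_self φ.rOut_pos)).ne'

theorem exists_bartleIntegral_eq_inner {H : Type*} [NormedAddCommGroup H] [InnerProductSpace ℂ H]
    [CompleteSpace H] (x : U) (v : H) :
    ∃ η : VectorMeasure U H, IsRadonBV η ∧ ∀ F : U →ᵇ H, bartleIntegral η F = inner ℂ v (F x) := by
  have hv : Integrable (fun _ : U => v) (Measure.dirac x) := integrable_const v
  have hη := isRadonBV_withDensityᵥ hv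
  have := hη.1
  refine ⟨_, hη, fun F => ?_⟩
  rw [bartleIntegral_eq hv (fun A hA => withDensityᵥ_apply hv hA)
    (integrable_boundedContinuous _ F), integral_dirac]

theorem not_isCqIntStrictPosDef_zero [Nonempty U] :
    ¬ IsCqIntStrictPosDef q fun _ _ : U => (0 : ℂ →L[ℂ] ℂ) := by
  intro h
  obtain ⟨x⟩ := ‹Nonempty U›
  obtain ⟨f, hf, hfx⟩ := exists_isCqZero_ne_zero (q := q) x
  obtain ⟨F, hF, -⟩ := hf.exists_isJetOf
  choose η hη hηx using fun α : Fin m → ℕ =>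
    exists_bartleIntegral_eq_inner x (if α = 0 then 1 else 0 : ℂ)
  have hsum := h.sum_eq_zero (fun α _ => hη α) (fun g hg => ?_) hf
  · have hηf : ∀ α ∈ multiIndices m q, bartleIntegral (η α) (multiDeriv α f) =
        if α = 0 then f x else 0 := fun α hα => by
      rw [← hF.jetComponent_eq ⟨α, hα⟩, hηx, hF.jetComponent_eq ⟨α, hα⟩]
      split_ifs with h0 <;> simp [h0, multiDeriv_zero]
    rw [Finset.sum_congr rfl hηf, Finset.sum_ite_eq', if_pos (zero_mem_multiIndices m q)] at hsum
    exact hfx hsum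
  · refine Finset.sum_eq_zero fun α _ => ?_
    have hg0 : multiDeriv α g = (0 : U →ᵇ ℂ) := funext fun y => multiDeriv_eq_zero_of_isOpen
      isOpen_univ α (fun z _ => eq_zero_of_mem_rkhs_zero hg z) y trivial
    rw [hg0, hηx]
    exact inner_zero_right _

end ZeroKernel

/-! ### The kernel of an operator valued measure -/

section IntegralKernel

variable {m q : ℕ} {U : Opens (EuclideanSpace ℝ (Fin m))}

theorem IsCqDominated.integrable {Ω : Type*} [TopologicalSpace Ω] [MeasurableSpace Ω]
    [OpensMeasurableSpace Ω] {V : Type*} [NormedAddCommGroup V] [NormedSpace ℝ V]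
    [SecondCountableTopology V] {p : Ω → U → U → V} {μ : Measure Ω} (h : IsCqDominated q p μ)
    (hp : IsCzqq q p) (x y : U) : Integrable (fun w => p w x y) μ := by
  obtain ⟨h, hi, hb⟩ := h
  have h0 := zero_mem_multiIndices m q
  have hcont := hp.continuous_mixedDeriv h0 h0 x y
  have hbound := fun w => hb 0 h0 0 h0 w x y
  simp only [mixedDeriv_zero] at hcont hbound
  exact hi.norm.mono' hcont.aestronglyMeasurable (Eventually.of_forall hbound)

variable {Ω : Type*} [MeasurableSpace Ω] {H : Type*} [NormedAddCommGroup H] [InnerProductSpace ℂ H]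
  [CompleteSpace H] {p : Ω → U → U → ℂ} {G : Ω → H →L[ℂ] H} {ν : Measure Ω}

theorem integralKernel_eq_densityKernel {Λ : VectorMeasure Ω (H →L[ℂ] H)}
    (hint : ∀ x y, Integrable (fun w => p w x y) Λ.variation) (hG : Integrable G ν)
    (hΛG : ∀ A, MeasurableSet A → Λ A = ∫ w in A, G w ∂ν) :
    integralKernel p Λ = densityKernel p G ν :=
  funext₂ fun x y => integral_eq_of_density hG hΛG _ (hint x y)

theorem exists_isAdmissible [TopologicalSpace Ω] (hp : IsCzqq q p)
    (hpd : ∀ w, IsPosDef (scalarKernel (p w))) {Λ : VectorMeasure Ω (H →L[ℂ] H)}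
    (hΛpos : ∀ A, (Λ A).IsPositive) (hG : Integrable G ν)
    (hΛG : ∀ A, MeasurableSet A → Λ A = ∫ w in A, G w ∂ν) (hdom : IsCqDominated q p Λ.variation) :
    ∃ b, IsAdmissible q p b G ν := by
  obtain ⟨h, hi, hb⟩ := hdom
  rw [variation_eq_withDensity hG hΛG] at hi
  exact ⟨fun w => ‖h w‖, hp, hpd, hb, hG.1,
    ae_isPositive_of_forall_setIntegral hG fun A hA => hΛG A hA ▸ hΛpos A,
    integrable_norm_mul_norm hG.1 hi⟩

theorem scalarKernel_kernelProj_eq_zero (hint : ∀ x y, Integrable (fun w => p w x y • G w) ν)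
    {v : H} (hv : ∀ᵐ w ∂ν, inner ℂ v (G w v) = 0) :
    scalarKernel (kernelProj (densityKernel p G ν) v) = fun _ _ => 0 := by
  funext x y
  have hproj : kernelProj (densityKernel p G ν) v x y = 0 := by
    refine (((innerSL ℂ v).comp (ContinuousLinearMap.apply ℂ H v)).integral_comp_comm
      (hint x y)).symm.trans (integral_eq_zero_of_ae ?_)
    filter_upwards [hv] with w hw
    simp [hw]
  rw [scalarKernel, hproj, map_zero]

end IntegralKernel

end OpKernel

open OpKernel in
theorem mainTheorem5_general
    {m q : ℕ} (U : Opens (EuclideanSpace ℝ (Fin m))) [Nonempty U]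
    {Ω : Type*} [TopologicalSpace Ω] [MeasurableSpace Ω] [OpensMeasurableSpace Ω]
    {H : Type*} [NormedAddCommGroup H] [InnerProductSpace ℂ H] [CompleteSpace H]
    (p : Ω → U → U → ℂ) (hp : IsCzqq q p)
    (hpd : ∀ w, IsPosDef (scalarKernel (p w)))
    (Λ : VectorMeasure Ω (H →L[ℂ] H))
    (hΛpos : ∀ A, (Λ A).IsPositive) (lam : Measure Ω)
    (G : Ω → H →L[ℂ] H) (hG : Integrable G lam)
    (hΛG : ∀ A, MeasurableSet A → Λ A = ∫ w in A, G w ∂lam)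
    (hdom : IsCqDominated q p Λ.variation) :
    (∀ x y, Integrable (fun w => p w x y) Λ.variation) ∧
    IsPosDef (integralKernel p Λ) ∧
    IsCqq q (integralKernel p Λ) ∧
    (∀ f ∈ rkhs (integralKernel p Λ), IsCq q f) ∧
    ((∀ w, IsCqUniversal q (scalarKernel (p w))) →
      List.TFAE [
        IsCqUniversal q (integralKernel p Λ),
        ∀ v : H, v ≠ 0 → IsCqUniversal q
          (scalarKernel (kernelProj (integralKernel p Λ) v)),
        ∀ v : H, v ≠ 0 → measureProj Λ v ≠ 0]) ∧
    ((∀ w, IsCqIntStrictPosDef q (scalarKernel (p w))) →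
      List.TFAE [
        IsCqIntStrictPosDef q (integralKernel p Λ),
        ∀ v : H, v ≠ 0 → IsCqIntStrictPosDef q
          (scalarKernel (kernelProj (integralKernel p Λ) v)),
        ∀ v : H, v ≠ 0 → measureProj Λ v ≠ 0]) := by
  have hint := hdom.integrable hp
  obtain ⟨ν, _, hGν, hν⟩ := exists_sigmaFinite_forall_setIntegral_eq hG
  have hΛν : ∀ A, MeasurableSet A → Λ A = ∫ w in A, G w ∂ν := fun A hA =>
    (hΛG A hA).trans (hν A).symm
  obtain ⟨b, h⟩ := exists_isAdmissible hp hpd hΛpos hGν hΛν hdom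
  rw [integralKernel_eq_densityKernel hint hGν hΛν]
  have hzero : ∀ v, measureProj Λ v = 0 →
      scalarKernel (kernelProj (densityKernel p G ν) v) = fun _ _ => 0 := fun v hv =>
    scalarKernel_kernelProj_eq_zero h.integrable_smul ((measureProj_eq_zero_iff hGν hΛν v).1 hv)
  have hdef : (∀ v, v ≠ 0 → measureProj Λ v ≠ 0) →
      ∀ u, (∀ᵐ w ∂ν, inner ℂ u (G w u) = 0) → u = 0 := fun hΛv u hu =>
    not_imp_not.1 (hΛv u) ((measureProj_eq_zero_iff hGν hΛν u).2 hu)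
  refine ⟨hint, h.isPosDef, h.isCqq, fun f => isCq_of_mem_rkhs h.isPosDef h.isCqq,
    fun hp => ?_, fun hp => ?_⟩
  · tfae_have 1 → 2 := fun hP v hv => hP.kernelProj hv
    tfae_have 2 → 3 := fun hP v hv hΛv => not_isCqUniversal_zero (hzero v hΛv ▸ hP v hv)
    tfae_have 3 → 1 := fun hΛv => h.isCqUniversal (hdef hΛv) hp
    tfae_finish
  · tfae_have 1 → 2 := fun hP v hv => hP.kernelProj hv
    tfae_have 2 → 3 := fun hP v hv hΛv => not_isCqIntStrictPosDef_zero (hzero v hΛv ▸ hP v hv)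
    tfae_have 3 → 1 := fun hΛv => h.isCqIntStrictPosDef (hdef hΛv) hp
    tfae_finish

theorem mainTheorem5
    {m q : ℕ} (U : TopologicalSpace.Opens (EuclideanSpace ℝ (Fin m))) [Nonempty U]
    {Ω : Type*} [TopologicalSpace Ω] [T2Space Ω] [LocallyCompactSpace Ω]
    [MeasurableSpace Ω] [BorelSpace Ω]
    {H : Type*} [NormedAddCommGroup H] [InnerProductSpace ℂ H] [CompleteSpace H]
    [TopologicalSpace.SeparableSpace H]
    (p : Ω → U → U → ℂ) (hp : OpKernel.IsCzqq q p)
    (hpd : ∀ w, OpKernel.IsPosDef (OpKernel.scalarKernel (p w)))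
    (Λ : MeasureTheory.VectorMeasure Ω (H →L[ℂ] H))
    (hΛpos : ∀ A, (Λ A).IsPositive) (hΛ : OpKernel.IsRadonBV Λ)
    (lam : MeasureTheory.Measure Ω) [MeasureTheory.IsFiniteMeasure lam]
    (G : Ω → H →L[ℂ] H) (hG : MeasureTheory.Integrable G lam)
    (hΛG : ∀ A, MeasurableSet A → Λ A = ∫ w in A, G w ∂lam)
    (hdom : OpKernel.IsCqDominated q p Λ.variation) :
    (∀ x y, MeasureTheory.Integrable (fun w => p w x y) Λ.variation) ∧
    OpKernel.IsPosDef (OpKernel.integralKernel p Λ) ∧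
    OpKernel.IsCqq q (OpKernel.integralKernel p Λ) ∧
    (∀ f ∈ OpKernel.rkhs (OpKernel.integralKernel p Λ), OpKernel.IsCq q f) ∧
    ((∀ w, OpKernel.IsCqUniversal q (OpKernel.scalarKernel (p w))) →
      List.TFAE [
        OpKernel.IsCqUniversal q (OpKernel.integralKernel p Λ),
        ∀ v : H, v ≠ 0 → OpKernel.IsCqUniversal q
          (OpKernel.scalarKernel (OpKernel.kernelProj (OpKernel.integralKernel p Λ) v)),
        ∀ v : H, v ≠ 0 → OpKernel.measureProj Λ v ≠ 0]) ∧
    ((∀ w, OpKernel.IsCqIntStrictPosDef q (OpKernel.scalarKernel (p w))) →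
      List.TFAE [
        OpKernel.IsCqIntStrictPosDef q (OpKernel.integralKernel p Λ),
        ∀ v : H, v ≠ 0 → OpKernel.IsCqIntStrictPosDef q
          (OpKernel.scalarKernel (OpKernel.kernelProj (OpKernel.integralKernel p Λ) v)),
        ∀ v : H, v ≠ 0 → OpKernel.measureProj Λ v ≠ 0]) :=
  mainTheorem5_general U p hp hpd Λ hΛpos lam G hG hΛG hdom
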